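/- **Setting.** Let $G$ be a QED vertex graph with $h$ loops, without lepton loops, with two external lepton lines and one external photon line. Its $2h$ internal lepton lines form one path through all vertices $0,1,\dots,2h$; the line $l$ ($0\le l<2h$) goes from the vertex $l$ to the vertex $l+1$; the external lepton momentum $p_1=p-q/2$ enters at the vertex $0$, $p_2=p+q/2$ leaves at the vertex $2h$; the external photon, with momentum $q$, enters at some vertex, and every other vertex is an end of exactly one of the $h$ internal photon lines. Let $E$ be the set of all $L=3h$ internal lines. A *1-tree* is a set $T\subseteq E$ that connects all vertices and has no cycles; a *tree with cycle* is a set containing a cycle that becomes a 1-tree after deleting any line of this cycle. For $s\subseteq E$ let $N(s)=\min_T|s\setminus T|$ over all 1-trees $T$, and let the UV degree of divergence be $\omega(s)=2N(s)-|s|+\tfrac12\,|\{\text{lepton lines of }s\}|$. For a photon line $i$ let $\mathrm{LPath}(i)$ be the set of the lepton lines on the lepton path between its ends, and let the I-closure be $\mathrm{IClos}(s)=s\cup\{i \text{ photon line}:\mathrm{LPath}(i)\subseteq s\}$. Assume that $\omega(s)<0$ for all $s\subseteq E$ with $s\ne\emptyset$ and $s\ne E$. **The projector.** Let $m>0$,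 let the metric be $(g_{\mu\nu})=\mathrm{diag}(1,-1,-1,-1)$, write $\hat a=a^\nu\gamma_\nu$ and $\sigma_{\mu\nu}=\tfrac12(\gamma_\mu\gamma_\nu-\gamma_\nu\gamma_\mu)$. For an amplitude $\Gamma_\mu(p,q)$, write $$\bar\psi_2\Gamma_\mu\psi_1=\bar\psi_2\Big(f(q^2)\gamma_\mu-\tfrac1{2m}\,g(q^2)\,\sigma_{\mu\nu}q^\nu+k(q^2)\,q_\mu\Big)\psi_1$$ with form factors $f,g,k$, for all real $p,q$ with $p_1^2=p_2^2=m^2$ and all spinors with $(\hat p_1-m)\psi_1=0=\bar\psi_2(\hat p_2-m)$, and put $\mathcal A\Gamma=\lim_{q^2\to0}g(q^2)$ (through real on-shell momenta, i.e. $q^2\to 0^-$). **The integrand.** For $z\in(0,\infty)^E$ let $D(z)=\sum_T\prod_{e\notin T}z_e$ (sum over 1-trees). For different lepton lines $l_1,l_2$ let $B_{l_1l_2}(z)=\sum_{T'}\pm\prod_{e\notin T'}z_e$, the sum over trees with cycle that have $l_1,l_2$ on the cycle, with the sign $+$ if $l_1,l_2$ have the same direction on the cycle and $-$ otherwise. Let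 $Q_l(z)=\sum_{T\ni l}p[T]\prod_{e\notin T}z_e$ (sum over 1-trees), where $p[T]$ is the sum of the external momenta outgoing from the component of $T\setminus l$ to which $l$ is directed. Let $W(z)=m^2(Z(z)-\sum_{l\ \mathrm{lepton}}z_l)$, where $Z(z)$ is the resistance between the vertices $0$ and $2h$ of the electric circuit $G$ with line resistances $z_e$. For a set $P$ of disjoint unordered pairs of lepton lines let $\Gamma^P_\mu(z;p,q)$ be the matrix product along the lepton path (later factors to the left) of the following multipliers: $\gamma_\mu$ at the external photon vertex; $\gamma_\nu$ at every other vertex, $\nu$ being the index of its photon line; $\gamma_\rho$ for each lepton line in a pair of $P$, $\rho$ being the index of the pair; $m+\hat Q_l(z)/D(z)$ for each other lepton line $l$; all repeated indices are contracted with the metric. The Feynman parametric integrand is $$I'(z)=\sum_P c_P\,\frac{1}{D(z)^2}\prod_{\{l_1,l_2\}\in P}\frac{B_{l_1l_2}(z)}{D(z)}\cdot\frac{\mathcal A\big[\Gamma^P(z;\cdot,\cdot)\big]}{W(z)^{h-|P|}},$$ where $c_P\in\mathbb C$ are arbitrary numerical coefficients independent of $z$ and $m$. ($h-|P|=L+u$,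 where $u=-2h-|P|$ is the degree of homogeneity in $z$ of the part of the term without $W$.) **Theorem.** There is a constant $C$, depending only on the graph $G$ (and the coefficients $c_P$), such that for all $m>0$ and all $z$ with $z_e>0$, $\sum_e z_e=1$, the following holds. The projections $\mathcal A[\Gamma^P(z;\cdot,\cdot)]$ exist and are uniquely determined for all $P$, and for every enumeration $j_1,\dots,j_L$ of $E$ with $z_{j_1}\ge z_{j_2}\ge\dots\ge z_{j_L}$ (Hepp sector), with $s^{[l]}=\{j_l,j_{l+1},\dots,j_L\}$ and $t_l=z_{j_l}/z_{j_{l-1}}$ for $l\ge2$, $$|I'(z)|\le C\cdot\frac{\prod_{l=2}^{L}t_l^{\max\left(\lceil-\omega(\mathrm{IClos}(s^{[l]}))\rceil-\frac12,\ \frac12\right)}}{\prod_{e\in E}z_e}.$$ -/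

import Mathlib

open scoped Classical Matrix Topology
open Filter

noncomputable section

namespace QED

/-! ### Minkowski space and Dirac matrices -/

/-- Diagonal entries of the metric tensor `g = diag(1, -1, -1, -1)`. -/
def metric (μ : Fin 4) : ℝ := if μ = 0 then 1 else -1

/-- Minkowski scalar product of two vectors given by contravariant components. -/
def mdot (p q : Fin 4 → ℝ) : ℝ := ∑ μ, metric μ * p μ * q μ

abbrev Mat4 := Matrix (Fin 4) (Fin 4) ℂ

/-- The Dirac matrices `γ^μ` (upper index) in the Dirac representation. -/
def gamma (μ : Fin 4) : Mat4 :=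
  ![!![1, 0, 0, 0; 0, 1, 0, 0; 0, 0, -1, 0; 0, 0, 0, -1],
    !![0, 0, 0, 1; 0, 0, 1, 0; 0, -1, 0, 0; -1, 0, 0, 0],
    !![0, 0, 0, -Complex.I; 0, 0, Complex.I, 0; 0, Complex.I, 0, 0; -Complex.I, 0, 0, 0],
    !![0, 0, 1, 0; 0, 0, 0, -1; -1, 0, 0, 0; 0, 1, 0, 0]] μ

/-- `γ_μ = g_{μν} γ^ν`. -/
def gammaLow (μ : Fin 4) : Mat4 := ((metric μ : ℝ) : ℂ) • gamma μ

/-- `p^ν γ_ν`. -/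
def slash (p : Fin 4 → ℝ) : Mat4 := ∑ ν, ((p ν : ℝ) : ℂ) • gammaLow ν

/-- `σ_{μν} = (γ_μ γ_ν - γ_ν γ_μ) / 2`. -/
def sigmaLow (μ ν : Fin 4) : Mat4 :=
  (1 / 2 : ℂ) • (gammaLow μ * gammaLow ν - gammaLow ν * gammaLow μ)

/-! ### The anomalous magnetic moment projector -/

/-- A vertex amplitude `Γ_μ(p, q)`: `p - q/2` is the incoming lepton momentum, `p + q/2` the
outgoing one, `q` the photon momentum; the tensor index `μ` is a lower one. -/
abbrev Amplitude := (Fin 4 → ℝ) → (Fin 4 → ℝ) → Fin 4 → Mat4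

/-- The lepton momenta `p - q/2` and `p + q/2` are on the mass shell. -/
def OnShell (m : ℝ) (p q : Fin 4 → ℝ) : Prop :=
  mdot (p - (1 / 2 : ℝ) • q) (p - (1 / 2 : ℝ) • q) = m ^ 2 ∧
  mdot (p + (1 / 2 : ℝ) • q) (p + (1 / 2 : ℝ) • q) = m ^ 2

/-- `f`, `g`, `h`, as functions of `q²`, are form factors of the amplitude `Γ`: on the mass shell
and between solutions of the Dirac equation, `Γ_μ` equals
`f(q²) γ_μ - g(q²)/(2m) σ_{μν} q^ν + h(q²) q_μ`. The row vector `ψ₂` is the Dirac conjugate of the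
outgoing spinor. -/
def HasFormFactors (m : ℝ) (Γ : Amplitude) (f g h : ℝ → ℂ) : Prop :=
  ∀ p q : Fin 4 → ℝ, OnShell m p q → ∀ ψ₁ ψ₂ : Fin 4 → ℂ,
    (slash (p - (1 / 2 : ℝ) • q) - (m : ℂ) • (1 : Mat4)) *ᵥ ψ₁ = 0 →
    ψ₂ ᵥ* (slash (p + (1 / 2 : ℝ) • q) - (m : ℂ) • (1 : Mat4)) = 0 →
    ∀ μ : Fin 4,
      ψ₂ ⬝ᵥ (Γ p q μ *ᵥ ψ₁) =
        ψ₂ ⬝ᵥ ((f (mdot q q) • gammaLow μ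
          - (g (mdot q q) / (2 * (m : ℂ))) • ∑ ν, ((q ν : ℝ) : ℂ) • sigmaLow μ ν
          + (h (mdot q q) * ((metric μ * q μ : ℝ) : ℂ)) • (1 : Mat4)) *ᵥ ψ₁)

/-- The value of the projector on `Γ` is `a`: the limit of the form factor `g(q²)` as `q² → 0`.
For real momenta on the mass shell near `q² = 0` one has `q² ≤ 0`. -/
def IsAMM (m : ℝ) (Γ : Amplitude) (a : ℂ) : Prop :=
  ∃ f g h : ℝ → ℂ, HasFormFactors m Γ f g h ∧ Tendsto g (𝓝[<] 0) (𝓝 a)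

/-- The anomalous magnetic moment projector. -/
def amm (m : ℝ) (Γ : Amplitude) : ℂ :=
  if hΓ : ∃ a, IsAMM m Γ a then hΓ.choose else 0

/-! ### Feynman graphs -/

/-- Internal lines of a vertex graph with `h` loops: `2h` lepton lines and `h` photon lines. -/
abbrev Line (h : ℕ) := Fin (2 * h) ⊕ Fin h

/-- A QED Feynman graph without lepton loops, with two external lepton lines and one external
photon line. The lepton lines form one path through all vertices, which are numbered
`0, 1, …, 2h` along it; the lepton line number `l` goes from the vertex `l` to the vertex `l + 1`.
The external lepton lines enter at the vertex `0` and leave at the vertex `2h`. The external photon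
is attached to the vertex `ext`, and every other vertex is an end of exactly one internal photon
line. The ends of the photon line `i` are `fst i` and `snd i`, in their order along the path. -/
structure VertexGraph (h : ℕ) where
  ext : Fin (2 * h + 1)
  fst : Fin h → Fin (2 * h + 1)
  snd : Fin h → Fin (2 * h + 1)
  fst_lt_snd : ∀ i, fst i < snd i
  fst_ne_ext : ∀ i, fst i ≠ ext
  snd_ne_ext : ∀ i, snd i ≠ ext
  existsUnique_photon : ∀ v, v ≠ ext → ∃! i, v = fst i ∨ v = snd i

namespace VertexGraph

variable {h : ℕ} (G : VertexGraph h)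

/-- Beginning of a line (photon lines are directed along the lepton path). -/
def src : Line h → Fin (2 * h + 1)
  | Sum.inl l => l.castSucc
  | Sum.inr i => G.fst i

/-- End of a line. -/
def tgt : Line h → Fin (2 * h + 1)
  | Sum.inl l => l.succ
  | Sum.inr i => G.snd i

/-- There is a path in `s` between `u` and `v`. -/
def Reach (s : Finset (Line h)) (u v : Fin (2 * h + 1)) : Prop :=
  Relation.ReflTransGen
    (fun x y => ∃ e ∈ s, (G.src e = x ∧ G.tgt e = y) ∨ (G.src e = y ∧ G.tgt e = x)) u v

/-- The line `e` of `s` lies on a cycle contained in `s`. -/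
def OnCycle (s : Finset (Line h)) (e : Line h) : Prop :=
  e ∈ s ∧ G.Reach (s.erase e) (G.src e) (G.tgt e)

/-- 1-trees: any two vertices are connected by a path in `T`, and `T` has no cycles. -/
def IsOneTree (T : Finset (Line h)) : Prop :=
  (∀ u v, G.Reach T u v) ∧ ∀ e, ¬ G.OnCycle T e

/-- Trees with cycle: there is a cycle, and deleting any line of it leaves a 1-tree. -/
def IsTreeWithCycle (T : Finset (Line h)) : Prop :=
  (∃ e, G.OnCycle T e) ∧ ∀ e, G.OnCycle T e → G.IsOneTree (T.erase e)

/-- The lepton lines of a set of lines. -/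
def leptons (s : Finset (Line h)) : Finset (Line h) := s.filter (fun e => e.isLeft)

/-- The minimum of `|s \ T|` over all 1-trees `T`. -/
def nLoops (s : Finset (Line h)) : ℕ :=
  sInf {n | ∃ T, G.IsOneTree T ∧ (s \ T).card = n}

/-- The ultraviolet degree of divergence. -/
def omega (s : Finset (Line h)) : ℚ :=
  2 * (G.nLoops s : ℚ) - (s.card : ℚ) + (1 / 2) * ((leptons s).card : ℚ)

/-- All sets of lines except the empty one and the whole graph have a negative ultraviolet degree
of divergence. -/
def NoUVDivergentSubgraphs : Prop :=
  ∀ s : Finset (Line h), s ≠ ∅ → s ≠ Finset.univ → G.omega s < 0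

/-- The lepton path connecting the ends of the photon line `i`. -/
def lpath (i : Fin h) : Finset (Line h) :=
  (Finset.univ.filter
    (fun l : Fin (2 * h) => G.fst i ≤ l.castSucc ∧ l.succ ≤ G.snd i)).image Sum.inl

/-- The I-closure. -/
def iclos (s : Finset (Line h)) : Finset (Line h) :=
  s ∪ (Finset.univ.filter (fun i : Fin h => G.lpath i ⊆ s)).image Sum.inr

/-! ### The parametric integrand -/

/-- `D(z)`: the sum over 1-trees `T` of the products of `z_l` over the lines outside `T`. -/
def D (z : Line h → ℝ) : ℝ :=
  ∑ T ∈ Finset.univ.filter (fun T => G.IsOneTree T), ∏ e ∈ Tᶜ, z e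

/-- `c(T')` for a tree with cycle `T'` and different lepton lines `l₁`, `l₂` on its cycle. The
directions of the lines on the cycle are the same iff the end of `l₁` is connected with the
beginning of `l₂` after the deletion of both lines. -/
def cycleSign (T : Finset (Line h)) (l₁ l₂ : Fin (2 * h)) : ℝ :=
  if G.Reach ((T.erase (Sum.inl l₁)).erase (Sum.inl l₂)) l₁.succ l₂.castSucc then 1 else -1

/-- `B_{l₁ l₂}(z)` for different lepton lines `l₁`, `l₂`. -/
def B (z : Line h → ℝ) (l₁ l₂ : Fin (2 * h)) : ℝ :=
  ∑ T ∈ Finset.univ.filter (fun T => G.IsTreeWithCycle T ∧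
      G.OnCycle T (Sum.inl l₁) ∧ G.OnCycle T (Sum.inl l₂)),
    G.cycleSign T l₁ l₂ * ∏ e ∈ Tᶜ, z e

/-- The momentum that passes through the lepton line `l` in the 1-tree `T`: the sum of the external
momenta outgoing from the component of `T \ l` to which `l` is directed. -/
def treeMomentum (T : Finset (Line h)) (l : Fin (2 * h)) (p q : Fin 4 → ℝ) : Fin 4 → ℝ :=
  (if G.Reach (T.erase (Sum.inl l)) l.succ (Fin.last (2 * h)) then p + (1 / 2 : ℝ) • q else 0)
  - (if G.Reach (T.erase (Sum.inl l)) l.succ 0 then p - (1 / 2 : ℝ) • q else 0)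
  - (if G.Reach (T.erase (Sum.inl l)) l.succ G.ext then q else 0)

/-- `Q_l(z)`, a 4-vector depending on `p` and `q`. -/
def Q (z : Line h → ℝ) (p q : Fin 4 → ℝ) (l : Fin (2 * h)) : Fin 4 → ℝ :=
  ∑ T ∈ Finset.univ.filter (fun T => G.IsOneTree T ∧ Sum.inl l ∈ T),
    (∏ e ∈ Tᶜ, z e) • G.treeMomentum T l p q

/-- Sets of disjoint unordered pairs of lepton lines; the pair `{a, b}` with `a < b` is represented
as `(a, b)`. -/
def IsPairing (P : Finset (Fin (2 * h) × Fin (2 * h))) : Prop :=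
  (∀ a ∈ P, a.1 < a.2) ∧
  ∀ a ∈ P, ∀ b ∈ P, a ≠ b → a.1 ≠ b.1 ∧ a.1 ≠ b.2 ∧ a.2 ≠ b.1 ∧ a.2 ≠ b.2

/-- The multiplier of the vertex `v`; `μ` is the tensor index of the external photon, `ν i` the
one of the photon line `i`. -/
def vertexFactor (μ : Fin 4) (ν : Fin h → Fin 4) (v : Fin (2 * h + 1)) : Mat4 :=
  if v = G.ext then gammaLow μ
  else ∑ i, if v = G.fst i ∨ v = G.snd i then gamma (ν i) else 0

/-- The multiplier of the lepton line `l`: a Dirac matrix with the tensor index of its pair if the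
line is paired, and `m + Q_l / D` (with `Q_l` contracted with Dirac matrices) otherwise. -/
def lineFactor (m : ℝ) (z : Line h → ℝ) (P : Finset (Fin (2 * h) × Fin (2 * h)))
    (ρ : {a // a ∈ P} → Fin 4) (p q : Fin 4 → ℝ) (l : Fin (2 * h)) : Mat4 :=
  if ∃ a ∈ P, l = a.1 ∨ l = a.2 then
    ∑ a : {a // a ∈ P}, if l = a.1.1 ∨ l = a.1.2 then gamma (ρ a) else 0
  else (m : ℂ) • (1 : Mat4) + slash ((G.D z)⁻¹ • G.Q z p q l)

/-- The matrix part of the term corresponding to the set of pairs `P`: the multipliers of the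
vertices and of the lepton lines, those that come later on the path standing further to the left,
with the contractions over the tensor indices of internal photon lines and of pairs. -/
def numerator (m : ℝ) (z : Line h → ℝ) (P : Finset (Fin (2 * h) × Fin (2 * h))) : Amplitude :=
  fun p q μ => ∑ ν : Fin h → Fin 4, ∑ ρ : {a // a ∈ P} → Fin 4,
    (((∏ i, metric (ν i)) * ∏ a, metric (ρ a) : ℝ) : ℂ) •
      ((List.ofFn (fun l : Fin (2 * h) =>
          G.vertexFactor μ ν l.succ * G.lineFactor m z P ρ p q l)).reverse.prod
        * G.vertexFactor μ ν 0)

/-- The global multipliers of the term corresponding to `P`: `1 / D²` and `B_{l₁ l₂} / D` for each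
pair. -/
def K (z : Line h → ℝ) (P : Finset (Fin (2 * h) × Fin (2 * h))) : ℝ :=
  1 / G.D z ^ 2 * ∏ a ∈ P, (G.B z a.1 a.2 / G.D z)

/-- `φ` is a system of electric potentials in the circuit with resistances `z` when the unit current
enters at the vertex `0` and leaves at the vertex `2h`: the currents, given by Ohm's law, satisfy
Kirchhoff's current law. -/
def IsPotential (z : Line h → ℝ) (φ : Fin (2 * h + 1) → ℝ) : Prop :=
  ∀ v, ∑ e, ((if G.src e = v then 1 else 0) - (if G.tgt e = v then 1 else 0)) *
      ((φ (G.src e) - φ (G.tgt e)) / z e)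
    = (if v = 0 then 1 else 0) - (if v = Fin.last (2 * h) then 1 else 0)

/-- The resistance of the circuit between the vertices incident to the external lepton lines. -/
def resistance (z : Line h → ℝ) : ℝ :=
  if hφ : ∃ φ, G.IsPotential z φ then hφ.choose 0 - hφ.choose (Fin.last (2 * h)) else 0

/-- `W(z) = m² (Z(z) - Z₀(z))`, where `Z₀(z)` is the resistance of the lepton path alone: the power
absorbed in the circuit whose external currents are the external momenta on the mass shell at
`q² = 0`, minus `∑ m² z_l` over the lepton lines. -/
def W (m : ℝ) (z : Line h → ℝ) : ℝ :=
  m ^ 2 * (G.resistance z - ∑ l : Fin (2 * h), z (Sum.inl l))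

/-- The Feynman parametric integrand after the application of the projector: the sum over all sets
`P` of disjoint pairs of lepton lines. There are `3h` lines, and the term of `P` before the division
by a power of `W` is homogeneous in `z` of degree `-2h - |P|`, so the power is `3h - (2h + |P|)`.
The numerical coefficients of the terms are `c P`. -/
def integrand (c : Finset (Fin (2 * h) × Fin (2 * h)) → ℂ) (m : ℝ) (z : Line h → ℝ) : ℂ :=
  ∑ P ∈ Finset.univ.filter IsPairing,
    c P * (G.K z P : ℂ) * amm m (G.numerator m z P) / (G.W m z : ℂ) ^ (3 * h - (2 * h + P.card))

/-! ### Hepp sectors -/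

/-- `s^{[k]}`: the lines with numbers `k, k + 1, …` in the order `j`. -/
def tail (j : Fin (3 * h) ≃ Line h) (k : Fin (3 * h)) : Finset (Line h) :=
  (Finset.univ.filter (fun k' => k ≤ k')).image j

/-- The sector variables `t_k`: the ratio of `z` at the line number `k` to `z` at the previous line
in the order `j` (the first of them is `z` itself). -/
def sectorVar (z : Line h → ℝ) (j : Fin (3 * h) ≃ Line h) (k : Fin (3 * h)) : ℝ :=
  if k.val = 0 then z (j k)
  else z (j k) / z (j ⟨k.val - 1, lt_of_le_of_lt (Nat.sub_le _ _) k.isLt⟩)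

/-- The degree of `t` corresponding to the set `s` in the bound. -/
def degree (s : Finset (Line h)) : ℝ :=
  max (((⌈-G.omega (G.iclos s)⌉ : ℤ) : ℝ) - 1 / 2) (1 / 2)

end VertexGraph

end QED

end

noncomputable section

namespace QED.VertexGraph

variable {h : ℕ} (G : VertexGraph h)

/-! ### Reachability and exchange in 1-trees -/

/-! In a Hepp sector every `z e` equals the largest variable, which lies between `1/(3h)` and `1`,
times the product of the sector variables `t_k` with `e ∈ s^{[k]}`. Up to constants, each factor of
the integrand is therefore bounded by a monomial in the `t_k`. Since `t_k ≤ 1`, the theorem reduces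
to one inequality between exponents for each set `s = s^{[k]}` other than the first.

The monomial bounds are as follows. `D` is bounded below with exponents `N(s)`, because one 1-tree
is optimal for all sets of a sector at once (`exists_optimal_tree`, a matroid exchange argument). `B
/ D` is at most a constant over the larger of its two `z`, because deleting a line of the cycle
leaves a 1-tree (`abs_B_div_D_le`). Thomson's principle, with a current divided between a photon
line `i` and `LPath(i)`, gives `-W ≥ m²/2 · z_e min(1, z_e/z_i)` for `e ∈ LPath(i)`
(`resistance_le`, `le_neg_W`). There is such a bound for each photon line, so the power `h - |P|` of
`W` can be distributed over the photon lines with nonnegative real weights `w i` of that total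
(`le_abs_W_pow`).

Dirac algebra makes the projection of `Γ^P` equal to `m^(2h-2|P|)` times a C¹ function of the
coefficients of `Q_l / D` at the two lepton momenta (`exists_amm_numerator`). These coefficients are
bounded, hence so is the function. For `P = ∅` more is needed. If all external momentum follows the
lepton path, the Dirac equation collapses the product to a multiple of `γ_μ`, and the projection
vanishes. It is thus at most a constant times the deviation from these bare coefficients, and the
deviation is controlled by the weight of the 1-trees that contain photon lines
(`IsOneTree.prod_le_of_photon`).

It remains to choose the weights. If `s` misses a lepton line, the I-closure is a proper set, its
loop number grows with every added photon line (`nLoops_add_card_photonsOut_le`), and the absence of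
divergences leaves a gap of `1/2` between half the number of lepton lines and the number of photon
lines with lepton paths in `s`, provided that there are such photon lines. If `s` contains all
lepton lines, the required exponent is `1/2`. It is saved on the photon line with the largest `z`,
whose weight is at most `1/2`; the half unit taken from it goes to another photon line and is paid
for by the gap (`exists_weights_of_nonempty`, `exists_weights_of_empty`). -/

theorem Reach.refl {s : Finset (Line h)} (u : Fin (2 * h + 1)) : G.Reach s u u :=
  Relation.ReflTransGen.refl

variable {G}

theorem Reach.trans {s : Finset (Line h)} {u v w : Fin (2 * h + 1)}
    (h₁ : G.Reach s u v) (h₂ : G.Reach s v w) : G.Reach s u w :=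
  Relation.ReflTransGen.trans h₁ h₂

theorem Reach.symm {s : Finset (Line h)} {u v : Fin (2 * h + 1)}
    (h₁ : G.Reach s u v) : G.Reach s v u := by
  induction h₁ with
  | refl => exact Reach.refl G u
  | tail _ hstep ih =>
    obtain ⟨e, he, h⟩ := hstep
    exact Relation.ReflTransGen.head ⟨e, he, h.symm⟩ ih

theorem Reach.mono {s t : Finset (Line h)} {u v : Fin (2 * h + 1)} (hst : s ⊆ t)
    (h₁ : G.Reach s u v) : G.Reach t u v :=
  Relation.ReflTransGen.mono (fun _ _ h => h.imp fun _ h => ⟨hst h.1, h.2⟩) _ _ h₁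

theorem reach_of_mem {s : Finset (Line h)} {e : Line h} (he : e ∈ s) :
    G.Reach s (G.src e) (G.tgt e) :=
  Relation.ReflTransGen.single ⟨e, he, Or.inl ⟨rfl, rfl⟩⟩

/-- A path can be shortened until it uses `f` at most once, in one of the two directions. -/
theorem reach_insert {s : Finset (Line h)} {f : Line h} {u v : Fin (2 * h + 1)}
    (huv : G.Reach (insert f s) u v) :
    G.Reach s u v ∨ (G.Reach s u (G.src f) ∧ G.Reach s (G.tgt f) v) ∨
      (G.Reach s u (G.tgt f) ∧ G.Reach s (G.src f) v) := by
  induction huv with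
  | refl => exact Or.inl (Reach.refl G u)
  | tail _ hstep ih =>
    obtain ⟨e, he, hxy⟩ := hstep
    rcases Finset.mem_insert.1 he with rfl | hes
    · rcases hxy with ⟨rfl, rfl⟩ | ⟨rfl, rfl⟩
      · rcases ih with h1 | ⟨h1, _⟩ | ⟨h1, _⟩
        · exact Or.inr (Or.inl ⟨h1, Reach.refl G _⟩)
        · exact Or.inr (Or.inl ⟨h1, Reach.refl G _⟩)
        · exact Or.inl h1
      · rcases ih with h1 | ⟨h1, _⟩ | ⟨h1, _⟩
        · exact Or.inr (Or.inr ⟨h1, Reach.refl G _⟩)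
        · exact Or.inl h1
        · exact Or.inr (Or.inr ⟨h1, Reach.refl G _⟩)
    · have hr : G.Reach s _ _ := Relation.ReflTransGen.single ⟨e, hes, hxy⟩
      rcases ih with h1 | ⟨h1, h2⟩ | ⟨h1, h2⟩
      · exact Or.inl (h1.trans hr)
      · exact Or.inr (Or.inl ⟨h1, h2.trans hr⟩)
      · exact Or.inr (Or.inr ⟨h1, h2.trans hr⟩)

/-- A path that leaves a set of vertices contains a line that crosses its boundary. -/
theorem Reach.exists_crossing {s : Finset (Line h)} {u v : Fin (2 * h + 1)}
    (A : Fin (2 * h + 1) → Prop) (huv : G.Reach s u v) (hu : A u) (hv : ¬ A v) :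
    ∃ e ∈ s, (A (G.src e) ∧ ¬ A (G.tgt e)) ∨ (¬ A (G.src e) ∧ A (G.tgt e)) := by
  by_contra hc
  push Not at hc
  apply hv
  clear hv
  induction huv with
  | refl => exact hu
  | tail _ hstep ih =>
    obtain ⟨e, he, ⟨rfl, rfl⟩ | ⟨rfl, rfl⟩⟩ := hstep
    · exact (hc e he).1 ih
    · by_contra hn
      exact (hc e he).2 hn ih

theorem IsOneTree.not_reach_erase {T : Finset (Line h)} (hT : G.IsOneTree T) {e : Line h}
    (he : e ∈ T) : ¬ G.Reach (T.erase e) (G.src e) (G.tgt e) :=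
  fun hr => hT.2 e ⟨he, hr⟩

/-- Deleting `e` splits the tree into the components of the two ends of `e`. A line `f` between them
reconnects the tree, and a cycle through any other line would either exist in `T` already or join
the components without `f`. -/
theorem IsOneTree.exchange {T : Finset (Line h)} (hT : G.IsOneTree T) {e f : Line h} (he : e ∈ T)
    (hf : ¬ G.Reach (T.erase e) (G.src f) (G.tgt f)) : G.IsOneTree (insert f (T.erase e)) := by
  set S := T.erase e with hS
  have hTS : T = insert e S := (Finset.insert_erase he).symm
  have hfS : f ∉ S := fun hm => hf (reach_of_mem hm)
  have hside : ∀ w, G.Reach S w (G.src e) ∨ G.Reach S w (G.tgt e) := by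
    intro w
    have := hT.1 w (G.src e)
    rw [hTS] at this
    rcases reach_insert this with h1 | ⟨h1, _⟩ | ⟨h1, _⟩
    · exact Or.inl h1
    · exact Or.inl h1
    · exact Or.inr h1
  have hmono : ∀ {u v}, G.Reach S u v → G.Reach (insert f S) u v :=
    fun hr => hr.mono (Finset.subset_insert _ _)
  have hff : G.Reach (insert f S) (G.src f) (G.tgt f) := reach_of_mem (Finset.mem_insert_self _ _)
  have hends : G.Reach (insert f S) (G.src e) (G.tgt e) := by
    rcases hside (G.src f) with h1 | h1 <;> rcases hside (G.tgt f) with h2 | h2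
    · exact absurd (h1.trans h2.symm) hf
    · exact ((hmono h1).symm.trans hff).trans (hmono h2)
    · exact ((hmono h2).symm.trans hff.symm).trans (hmono h1)
    · exact absurd (h1.trans h2.symm) hf
  have hto : ∀ w, G.Reach (insert f S) w (G.src e) := by
    intro w
    rcases hside w with h1 | h1
    · exact hmono h1
    · exact (hmono h1).trans hends.symm
  refine ⟨fun u v => (hto u).trans (hto v).symm, ?_⟩
  rintro g ⟨hg, hr⟩
  by_cases hgf : g = f
  · subst hgf
    rw [Finset.erase_insert hfS] at hr
    exact hf hr
  · have hgS : g ∈ S := (Finset.mem_insert.1 hg).resolve_left hgf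
    rw [Finset.erase_insert_of_ne (Ne.symm hgf)] at hr
    have hm : ∀ {u v}, G.Reach (S.erase g) u v → G.Reach S u v :=
      fun hr => hr.mono (Finset.erase_subset _ _)
    have hgg : G.Reach S (G.src g) (G.tgt g) := reach_of_mem hgS
    rcases reach_insert hr with h1 | ⟨h1, h2⟩ | ⟨h1, h2⟩
    · refine hT.2 g ⟨Finset.mem_of_mem_erase hgS, h1.mono ?_⟩
      exact Finset.erase_subset_erase _ (Finset.erase_subset _ _)
    · exact hf (((hm h1).symm.trans hgg).trans (hm h2).symm)
    · exact hf (((hm h2).trans hgg.symm).trans (hm h1))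

/-- The path in `T` between the ends of `e` must cross the cut that the deletion of `e` makes in
`T'`; a crossing line serves for both exchanges. -/
theorem IsOneTree.symm_exchange {T T' : Finset (Line h)} (hT : G.IsOneTree T)
    (hT' : G.IsOneTree T') {e : Line h} (he' : e ∈ T') (he : e ∉ T) :
    ∃ f ∈ T, f ∉ T' ∧ G.IsOneTree (insert e (T.erase f)) ∧
      G.IsOneTree (insert f (T'.erase e)) := by
  -- A subset of `T` of least size joining the ends of `e` plays the role of the path: removing any
  -- of its lines separates these ends.
  obtain ⟨S, hS, hmin⟩ := Finset.exists_min_image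
    (T.powerset.filter (fun S => G.Reach S (G.src e) (G.tgt e))) Finset.card
    ⟨T, by simp [hT.1]⟩
  simp only [Finset.mem_filter, Finset.mem_powerset] at hS hmin
  obtain ⟨f, hfS, hcross⟩ := hS.2.exists_crossing (fun v => G.Reach (T'.erase e) (G.src e) v)
    (Reach.refl G _) (hT'.not_reach_erase he')
  have hcut : ¬ G.Reach (T'.erase e) (G.src f) (G.tgt f) := by
    intro hr
    rcases hcross with ⟨h1, h2⟩ | ⟨h1, h2⟩
    · exact h2 (h1.trans hr)
    · exact h1 (h2.trans hr.symm)
  have hfT : f ∈ T := hS.1 hfS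
  refine ⟨f, hfT, ?_, ?_, hT'.exchange he' hcut⟩
  · intro hf'
    exact hcut (reach_of_mem (Finset.mem_erase.2 ⟨fun h => he (h ▸ hfT), hf'⟩))
  · refine hT.exchange hfT fun hr => ?_
    have hSf : ¬ G.Reach (S.erase f) (G.src e) (G.tgt e) := by
      intro hr'
      have := hmin (S.erase f) ⟨(Finset.erase_subset _ _).trans hS.1, hr'⟩
      have := Finset.card_erase_lt_of_mem hfS
      omega
    have hm : ∀ {u v}, G.Reach (S.erase f) u v → G.Reach (T.erase f) u v :=
      fun hr => hr.mono (Finset.erase_subset_erase _ hS.1)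
    have hr2 := hS.2
    rw [← Finset.insert_erase hfS] at hr2
    apply hT.not_reach_erase hfT
    rcases reach_insert hr2 with h1 | ⟨h1, h2⟩ | ⟨h1, h2⟩
    · exact absurd h1 hSf
    · exact ((hm h1).symm.trans hr).trans (hm h2).symm
    · exact ((hm h2).trans hr.symm).trans (hm h1)

theorem card_exchange {α : Type*} [DecidableEq α] {T s : Finset α} {e f : α} (he : e ∉ T) (hf : f ∈ T) :
    ((insert e (T.erase f)) ∩ s).card + (if f ∈ s then 1 else 0)
      = (T ∩ s).card + (if e ∈ s then 1 else 0) := by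
  have key : ∀ U : Finset α, (U ∩ s).card = ∑ x ∈ U, if x ∈ s then 1 else 0 := by
    intro U
    rw [← Finset.filter_mem_eq_inter, Finset.card_filter]
  rw [key, key, Finset.sum_insert (fun h => he (Finset.mem_of_mem_erase h)), add_assoc,
    Finset.sum_erase_add _ _ hf, add_comm]

/-! ### The lepton path -/

theorem inl_mem_leptons {s : Finset (Line h)} {l : Fin (2 * h)} :
    Sum.inl l ∈ leptons s ↔ Sum.inl l ∈ s := by simp [leptons]

theorem inr_notMem_leptons {s : Finset (Line h)} {i : Fin h} :
    Sum.inr i ∉ leptons s := by simp [leptons]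

theorem inl_mem_lpath {i : Fin h} {l : Fin (2 * h)} :
    Sum.inl l ∈ G.lpath i ↔ G.fst i ≤ l.castSucc ∧ l.succ ≤ G.snd i := by
  simp [lpath]

theorem inr_notMem_lpath {i k : Fin h} : Sum.inr k ∉ G.lpath i := by
  simp [lpath]

theorem inl_mem_lpath_iff_cut {i : Fin h} {l : Fin (2 * h)} :
    Sum.inl l ∈ G.lpath i ↔ G.fst i ≤ l.castSucc ∧ ¬ G.snd i ≤ l.castSucc := by
  rw [inl_mem_lpath, not_le, Fin.castSucc_lt_iff_succ_le]

/-- Neighbouring vertices `u, u + 1, …, v` are connected by the lepton lines between them. -/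
theorem reach_of_leptons {s : Finset (Line h)} {u v : Fin (2 * h + 1)} (huv : u ≤ v)
    (hs : ∀ l : Fin (2 * h), u ≤ l.castSucc → l.succ ≤ v → Sum.inl l ∈ s) : G.Reach s u v := by
  induction v using Fin.induction with
  | zero =>
    have : u = 0 := le_antisymm huv (Fin.zero_le _)
    rw [this]; exact Reach.refl G _
  | succ l ih =>
    rcases eq_or_lt_of_le huv with rfl | hlt
    · exact Reach.refl G _
    · have hle : u ≤ l.castSucc := by
        rw [Fin.le_def, Fin.val_castSucc]; rw [Fin.lt_def, Fin.val_succ] at hlt; omega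
      have h1 := ih hle (fun l' h1 h2 => hs l' h1 (h2.trans (Fin.castSucc_lt_succ).le))
      exact h1.trans (reach_of_mem (e := Sum.inl l) (hs l hle le_rfl))

theorem reach_lpath (i : Fin h) : G.Reach (G.lpath i) (G.fst i) (G.snd i) :=
  reach_of_leptons (G.fst_lt_snd i).le fun _ h1 h2 => inl_mem_lpath.2 ⟨h1, h2⟩

theorem lpath_nonempty (i : Fin h) : (G.lpath i).Nonempty := by
  obtain ⟨e, he, _⟩ := (reach_lpath (G := G) i).exists_crossing (fun v => v = G.fst i) rfl
    (G.fst_lt_snd i).ne'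
  exact ⟨e, he⟩

variable (G) in
theorem isOneTree_leptons : G.IsOneTree (leptons Finset.univ) := by
  refine ⟨?_, ?_⟩
  · have h0 : ∀ u, G.Reach (leptons Finset.univ) 0 u := fun u =>
      reach_of_leptons (Fin.zero_le _) fun l _ _ => by simp [leptons]
    exact fun u v => (h0 u).symm.trans (h0 v)
  · rintro e ⟨he, hr⟩
    obtain ⟨l, rfl⟩ : ∃ l, e = Sum.inl l := by
      cases e with
      | inl l => exact ⟨l, rfl⟩
      | inr i => exact absurd he inr_notMem_leptons
    obtain ⟨e', he', hc⟩ := hr.exists_crossing (fun v => v ≤ l.castSucc) le_rfl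
      (by simp [tgt])
    cases e' with
    | inr i => exact inr_notMem_leptons (Finset.mem_of_mem_erase he')
    | inl l' =>
      apply Finset.ne_of_mem_erase he'
      simp only [src, tgt, Fin.le_def, Fin.val_castSucc, Fin.val_succ] at hc
      congr 1
      ext
      omega

/-- `LPath(i)` has the same ends as `i`, so it crosses the cut left by the deletion of `i`. Trading
photon lines for lepton lines in this way gives both the loop count of the I-closure and the
smallness of 1-trees with photon lines. -/
theorem IsOneTree.exchange_photon {T : Finset (Line h)} (hT : G.IsOneTree T) {i : Fin h}
    (hi : Sum.inr i ∈ T) :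
    ∃ e ∈ G.lpath i, e ∉ T ∧ G.IsOneTree (insert e (T.erase (Sum.inr i))) := by
  obtain ⟨e, he, hc⟩ := (reach_lpath (G := G) i).exists_crossing
    (fun v => G.Reach (T.erase (Sum.inr i)) (G.fst i) v) (Reach.refl G _) (hT.not_reach_erase hi)
  have hcut : ¬ G.Reach (T.erase (Sum.inr i)) (G.src e) (G.tgt e) := by
    intro hr
    rcases hc with ⟨h1, h2⟩ | ⟨h1, h2⟩
    · exact h2 (h1.trans hr)
    · exact h1 (h2.trans hr.symm)
  refine ⟨e, he, fun heT => hcut (reach_of_mem (Finset.mem_erase.2 ⟨?_, heT⟩)),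
    hT.exchange hi hcut⟩
  rintro rfl
  exact inr_notMem_lpath he

/-! ### Numbers of loops and degrees of divergence -/

theorem nLoops_le {T : Finset (Line h)} (hT : G.IsOneTree T) (s : Finset (Line h)) :
    G.nLoops s ≤ (s \ T).card :=
  Nat.sInf_le ⟨T, hT, rfl⟩

variable (G) in
theorem exists_nLoops (s : Finset (Line h)) :
    ∃ T, G.IsOneTree T ∧ (s \ T).card = G.nLoops s :=
  Nat.sInf_mem (s := {n | ∃ T, G.IsOneTree T ∧ (s \ T).card = n})
    ⟨_, _, isOneTree_leptons G, rfl⟩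

theorem card_sdiff_add_inter {α : Type*} [DecidableEq α] (s T : Finset α) :
    (s \ T).card + (T ∩ s).card = s.card := by
  rw [Finset.inter_comm]; exact Finset.card_sdiff_add_card_inter s T

theorem mem_tail {j : Fin (3 * h) ≃ Line h} {k : Fin (3 * h)} {e : Line h} :
    e ∈ tail j k ↔ k ≤ j.symm e := by
  simp only [tail, Finset.mem_image, Finset.mem_filter, Finset.mem_univ, true_and]
  constructor
  · rintro ⟨k', hk, rfl⟩
    simpa using hk
  · intro hk
    exact ⟨j.symm e, hk, by simp⟩

variable (G) in
/-- There is a 1-tree that is optimal for all sets of a Hepp sector. -/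
theorem exists_optimal_tree (j : Fin (3 * h) ≃ Line h) :
    ∃ T, G.IsOneTree T ∧ ∀ k, (tail j k \ T).card = G.nLoops (tail j k) := by
  -- The tree maximizing the total overlap with all tails is shown to maximize each overlap
  -- separately.
  obtain ⟨T, hT, hmax⟩ := Finset.exists_max_image
    (Finset.univ.filter (fun T => G.IsOneTree T)) (fun T => ∑ k, (T ∩ tail j k).card)
    ⟨_, by simpa using isOneTree_leptons G⟩
  simp only [Finset.mem_filter, Finset.mem_univ, true_and] at hT hmax
  refine ⟨T, hT, fun k => le_antisymm ?_ (nLoops_le hT _)⟩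
  by_contra! hlt
  obtain ⟨T₀, hT₀, hT₀k⟩ := G.exists_nLoops (tail j k)
  -- Among the trees that are better for this `k`, one with the largest overlap with `T` is taken.
  obtain ⟨T', hT', hmax'⟩ := Finset.exists_max_image
    (Finset.univ.filter (fun T' => G.IsOneTree T' ∧ (T ∩ tail j k).card < (T' ∩ tail j k).card))
    (fun T' => (T' ∩ T).card)
    ⟨T₀, by
      simp only [Finset.mem_filter, Finset.mem_univ, true_and]
      refine ⟨hT₀, ?_⟩
      have h1 := card_sdiff_add_inter (tail j k) T₀
      have h2 := card_sdiff_add_inter (tail j k) T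
      omega⟩
  simp only [Finset.mem_filter, Finset.mem_univ, true_and] at hT' hmax'
  obtain ⟨e, he, heT⟩ : ∃ e ∈ T' ∩ tail j k, e ∉ T ∩ tail j k :=
    Finset.exists_mem_notMem_of_card_lt_card hT'.2
  rw [Finset.mem_inter] at he
  have heT : e ∉ T := fun h => heT (Finset.mem_inter.2 ⟨h, he.2⟩)
  obtain ⟨f, hfT, hfT', h1, h2⟩ := hT.symm_exchange hT'.1 he.1 heT
  -- If `f` is in the tail, replacing `e` by `f` in `T'` keeps it better than `T` and brings it
  -- closer to `T`. Otherwise `e` comes later than `f` in the order, so replacing `f` by `e` in `T`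
  -- lowers no overlap and raises the one for `k`.
  by_cases hfk : f ∈ tail j k
  · have hc := card_exchange (s := tail j k) hfT' he.1
    have hc' := card_exchange (s := T) hfT' he.1
    simp only [hfk, he.2, hfT, heT, if_true, if_false] at hc hc'
    have := hmax' _ ⟨h2, by omega⟩
    omega
  · have hc : ∀ k', (T ∩ tail j k').card ≤ ((insert e (T.erase f)) ∩ tail j k').card := by
      intro k'
      have := card_exchange (s := tail j k') heT hfT
      have himp : f ∈ tail j k' → e ∈ tail j k' := by
        rw [mem_tail] at hfk
        have hek := he.2
        rw [mem_tail] at hek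
        rw [mem_tail, mem_tail]
        intro h'
        exact (h'.trans (not_le.1 hfk).le).trans hek
      split_ifs at this <;> first | omega | tauto
    have hlt : (T ∩ tail j k).card < ((insert e (T.erase f)) ∩ tail j k).card := by
      have := card_exchange (s := tail j k) heT hfT
      simp only [hfk, he.2, if_true, if_false] at this
      omega
    have := hmax _ h1
    have := Finset.sum_lt_sum (fun k' _ => hc k') ⟨k, Finset.mem_univ k, hlt⟩
    omega

/-! ### The I-closure and the exponents of the bound -/

variable (G) in
/-- Photon lines whose lepton paths are in `s`. -/
def photonsIn (s : Finset (Line h)) : Finset (Fin h) :=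
  Finset.univ.filter (fun i => G.lpath i ⊆ s)

variable (G) in
/-- Photon lines outside `s` whose lepton paths are in `s`. -/
def photonsOut (s : Finset (Line h)) : Finset (Fin h) :=
  Finset.univ.filter (fun i => G.lpath i ⊆ s ∧ Sum.inr i ∉ s)

theorem iclos_sdiff (s : Finset (Line h)) : G.iclos s \ s = (G.photonsOut s).image Sum.inr := by
  ext e
  simp only [iclos, photonsOut, Finset.mem_sdiff, Finset.mem_union, Finset.mem_image,
    Finset.mem_filter, Finset.mem_univ, true_and]
  constructor
  · rintro ⟨h1 | ⟨i, hi, rfl⟩, h2⟩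
    · exact absurd h1 h2
    · exact ⟨i, ⟨hi, h2⟩, rfl⟩
  · rintro ⟨i, ⟨hi, h2⟩, rfl⟩
    exact ⟨Or.inr ⟨i, hi, rfl⟩, h2⟩

theorem subset_iclos (s : Finset (Line h)) : s ⊆ G.iclos s := Finset.subset_union_left

theorem card_iclos_sdiff (s : Finset (Line h)) :
    (G.iclos s \ s).card = (G.photonsOut s).card := by
  rw [iclos_sdiff, Finset.card_image_of_injective _ Sum.inr_injective]

theorem card_iclos (s : Finset (Line h)) :
    (G.iclos s).card = s.card + (G.photonsOut s).card := by
  rw [← card_iclos_sdiff, add_comm, Finset.card_sdiff_add_card_eq_card (subset_iclos s)]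

theorem leptons_iclos (s : Finset (Line h)) : leptons (G.iclos s) = leptons s := by
  ext e
  cases e <;> simp [leptons, iclos]

/-- An optimal 1-tree for the closure can avoid all added photon lines: each of them can be traded
for a line of its lepton path, which lies in `s`. All added lines then count as loops. -/
theorem nLoops_add_card_photonsOut_le (s : Finset (Line h)) :
    G.nLoops s + (G.photonsOut s).card ≤ G.nLoops (G.iclos s) := by
  obtain ⟨T₀, hT₀, hc₀⟩ := G.exists_nLoops (G.iclos s)
  obtain ⟨T, hT, hmin⟩ := Finset.exists_min_image
    (Finset.univ.filter (fun T => G.IsOneTree T ∧ (G.iclos s \ T).card = G.nLoops (G.iclos s)))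
    (fun T => (T ∩ (G.iclos s \ s)).card) ⟨T₀, by simp [hT₀, hc₀]⟩
  simp only [Finset.mem_filter, Finset.mem_univ, true_and] at hT hmin
  have hempty : T ∩ (G.iclos s \ s) = ∅ := by
    by_contra hne
    obtain ⟨x, hx⟩ := Finset.nonempty_iff_ne_empty.2 hne
    have hx' := hx
    rw [iclos_sdiff] at hx
    simp only [Finset.mem_inter, Finset.mem_image] at hx
    obtain ⟨hxT, i, hi, rfl⟩ := hx
    obtain ⟨e, he, heT, hex⟩ := hT.1.exchange_photon hxT
    have hes : e ∈ s := by
      have := (Finset.mem_filter.1 hi).2.1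
      exact this he
    have c1 := card_exchange (s := G.iclos s) heT hxT
    have c2 := card_exchange (s := G.iclos s \ s) heT hxT
    have hi1 : Sum.inr i ∈ G.iclos s \ s := (Finset.mem_inter.1 hx').2
    have hi2 : Sum.inr i ∈ G.iclos s := (Finset.mem_sdiff.1 hi1).1
    have he1 : e ∈ G.iclos s := subset_iclos s hes
    have he2 : e ∉ G.iclos s \ s := fun h => (Finset.mem_sdiff.1 h).2 hes
    rw [if_pos hi2, if_pos he1] at c1
    rw [if_pos hi1, if_neg he2] at c2
    have d1 := card_sdiff_add_inter (G.iclos s) T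
    have d2 := card_sdiff_add_inter (G.iclos s) (insert e (T.erase (Sum.inr i)))
    have := hmin _ ⟨hex, by omega⟩
    omega
  have h1 := card_sdiff_add_inter s T
  have h2 := card_sdiff_add_inter (G.iclos s) T
  have h3 := card_iclos (G := G) s
  have h4 : T ∩ s = T ∩ G.iclos s := by
    ext x
    simp only [Finset.mem_inter]
    refine ⟨fun hx => ⟨hx.1, subset_iclos s hx.2⟩, fun hx => ⟨hx.1, ?_⟩⟩
    by_contra hxs
    have : x ∈ T ∩ (G.iclos s \ s) := by simp [hx.1, hx.2, hxs]
    rw [hempty] at this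
    simp at this
  have h5 := nLoops_le hT.1 s
  rw [h4] at h1
  omega

/-- Each added photon line contributes `1` through the cardinality and at most `-2` through the loop
number. -/
theorem neg_omega_iclos_le (s : Finset (Line h)) :
    -G.omega (G.iclos s) ≤ (s.card : ℚ) - (G.photonsOut s).card
      - (leptons s).card / 2 - 2 * G.nLoops s := by
  have h1 : ((G.nLoops s : ℚ) + (G.photonsOut s).card) ≤ G.nLoops (G.iclos s) := by
    exact_mod_cast nLoops_add_card_photonsOut_le s
  rw [omega, card_iclos, leptons_iclos]
  push_cast
  linarith

/-- This separates the two cases of the power counting: the hypothesis on `omega` says nothing about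
a closure equal to the whole graph. -/
theorem iclos_eq_univ_iff (s : Finset (Line h)) :
    G.iclos s = Finset.univ ↔ leptons Finset.univ ⊆ s := by
  constructor
  · intro h1 e he
    cases e with
    | inr i => exact absurd he inr_notMem_leptons
    | inl l =>
      have : (Sum.inl l : Line h) ∈ G.iclos s := by rw [h1]; exact Finset.mem_univ _
      simpa [iclos] using this
  · intro h1
    refine Finset.eq_univ_iff_forall.2 fun e => ?_
    cases e with
    | inl l => exact subset_iclos s (h1 (by simp [leptons]))
    | inr i =>
      refine Finset.mem_union_right _ (Finset.mem_image_of_mem _ ?_)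
      simp only [Finset.mem_filter, Finset.mem_univ, true_and]
      intro e he
      cases e with
      | inr k => exact absurd he inr_notMem_lpath
      | inl l => exact h1 (by simp [leptons])

theorem photonsIn_leptons (s : Finset (Line h)) : G.photonsIn (leptons s) = G.photonsIn s := by
  ext i
  simp only [photonsIn, Finset.mem_filter, Finset.mem_univ, true_and]
  refine ⟨fun h1 => h1.trans (Finset.filter_subset _ _), fun h1 e he => ?_⟩
  cases e with
  | inr k => exact absurd he inr_notMem_lpath
  | inl l => exact inl_mem_leptons.2 (h1 he)

theorem photonsOut_leptons (s : Finset (Line h)) : G.photonsOut (leptons s) = G.photonsIn s := by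
  rw [← photonsIn_leptons]
  ext i
  simp [photonsIn, photonsOut, inr_notMem_leptons]

theorem leptons_leptons (s : Finset (Line h)) : leptons (leptons s) = leptons s := by
  simp [leptons]

/-- Without divergent subgraphs, a set with some but not all lepton lines has more than twice as
many lepton lines as there are photon lines with lepton paths in it. -/
theorem two_mul_card_photonsIn_lt (hG : G.NoUVDivergentSubgraphs) {s : Finset (Line h)}
    (hs : ¬ leptons Finset.univ ⊆ s) (hne : (leptons s).Nonempty) :
    2 * (G.photonsIn s).card < (leptons s).card := by
  -- For the closure of the lepton lines alone, every photon line with its path in `s` is an added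
  -- one, and the loop number of `leptons s` can be dropped as nonnegative.
  have h1 := hG (G.iclos (leptons s)) ?_ ?_
  · have h2 := neg_omega_iclos_le (G := G) (leptons s)
    rw [photonsOut_leptons, leptons_leptons] at h2
    have h3 : (0 : ℚ) ≤ G.nLoops (leptons s) := by positivity
    have : (2 * (G.photonsIn s).card : ℚ) < (leptons s).card := by linarith
    exact_mod_cast this
  · obtain ⟨e, he⟩ := hne
    exact Finset.ne_empty_of_mem (subset_iclos _ he)
  · rw [Ne, iclos_eq_univ_iff]
    exact fun h2 => hs (h2.trans (Finset.filter_subset _ _))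

theorem photonsIn_eq_empty {s : Finset (Line h)} (hs : leptons s = ∅) : G.photonsIn s = ∅ := by
  rw [← photonsIn_leptons, hs]
  ext i
  simp [photonsIn, Finset.subset_empty, (lpath_nonempty (G := G) i).ne_empty]

/-- Rounding a half-integer up costs at most `1/2`, which is exactly what `degree` subtracts. -/
theorem ceil_sub_half_le {x : ℚ} (n : ℤ) (hx : x ≤ n / 2) : ((⌈x⌉ : ℤ) : ℝ) - 1 / 2 ≤ n / 2 := by
  have h1 : ⌈x⌉ ≤ (n + 1) / 2 := by
    rw [Int.ceil_le]
    have : n ≤ 2 * ((n + 1) / 2) := by omega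
    have : (n : ℚ) ≤ 2 * (((n + 1) / 2 : ℤ) : ℚ) := by exact_mod_cast this
    linarith
  have h2 : 2 * ⌈x⌉ ≤ n + 1 := by omega
  have : (2 * ⌈x⌉ : ℝ) ≤ n + 1 := by exact_mod_cast h2
  linarith

theorem degree_le_of_not_subset (hG : G.NoUVDivergentSubgraphs) {s : Finset (Line h)}
    (hs : ¬ leptons Finset.univ ⊆ s) (hne : s.Nonempty) :
    G.degree s ≤ (s.card : ℝ) - (G.photonsOut s).card
      - (leptons s).card / 2 - 2 * G.nLoops s := by
  have h1 := hG (G.iclos s) (Finset.ne_empty_of_mem (subset_iclos s hne.choose_spec))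
    (by rwa [Ne, iclos_eq_univ_iff])
  have h2 := neg_omega_iclos_le (G := G) s
  have h3 := ceil_sub_half_le (x := -G.omega (G.iclos s))
    (2 * s.card - 2 * (G.photonsOut s).card - (leptons s).card - 4 * G.nLoops s)
    (by push_cast; linarith)
  push_cast at h3
  -- A negative `omega` makes the rounded value at least `1`, so the maximum in `degree` is its
  -- first entry.
  have h4 : (1 : ℤ) ≤ ⌈-G.omega (G.iclos s)⌉ := by
    rw [Int.one_le_ceil_iff]; linarith
  have h4 : (1 : ℝ) ≤ (⌈-G.omega (G.iclos s)⌉ : ℤ) := by exact_mod_cast h4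
  rw [degree, max_eq_left (by linarith)]
  linarith

theorem card_leptons_univ : (leptons (Finset.univ : Finset (Line h))).card = 2 * h := by
  have : leptons (Finset.univ : Finset (Line h)) = Finset.univ.image Sum.inl := by
    ext e; cases e <;> simp [leptons]
  rw [this, Finset.card_image_of_injective _ Sum.inl_injective]
  simp

/-- The closure is the whole graph, where `-ω ≤ 2h - h - h = 0`, so the maximum in `degree` is its
second entry. -/
theorem degree_of_subset {s : Finset (Line h)} (hs : leptons Finset.univ ⊆ s) :
    G.degree s = 1 / 2 := by
  have h1 := neg_omega_iclos_le (G := G) (leptons Finset.univ)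
  rw [(iclos_eq_univ_iff _).2 subset_rfl, photonsOut_leptons, leptons_leptons,
    card_leptons_univ] at h1
  have h0 : (G.photonsIn Finset.univ).card = h := by simp [photonsIn]
  have h3 : (0 : ℚ) ≤ G.nLoops (leptons Finset.univ) := by positivity
  rw [h0] at h1
  push_cast at h1
  have h2 : ⌈-G.omega (G.iclos s)⌉ ≤ 0 := by
    rw [(iclos_eq_univ_iff _).2 hs, Int.ceil_le]
    push_cast
    linarith
  have h2 : ((⌈-G.omega (G.iclos s)⌉ : ℤ) : ℝ) ≤ 0 := by exact_mod_cast h2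
  rw [degree, max_eq_right (by linarith)]

theorem nLoops_add_le_of_subset {s : Finset (Line h)} (hs : leptons Finset.univ ⊆ s) :
    G.nLoops s + 2 * h ≤ s.card := by
  have h1 := nLoops_le (isOneTree_leptons G) s
  have h2 := Finset.card_sdiff_add_card_eq_card hs
  rw [card_leptons_univ] at h2
  omega

end QED.VertexGraph

namespace QED.VertexGraph

variable {h : ℕ} {G : VertexGraph h}

/-! ### Bounds for `D` and `B` -/

theorem prod_compl_erase {T : Finset (Line h)} {e : Line h} (he : e ∈ T) (z : Line h → ℝ) :
    ∏ x ∈ (T.erase e)ᶜ, z x = z e * ∏ x ∈ Tᶜ, z x := by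
  rw [Finset.compl_erase, Finset.prod_insert (by simpa using he)]

theorem prod_compl_insert {T : Finset (Line h)} {e : Line h} (he : e ∉ T) (z : Line h → ℝ) :
    z e * ∏ x ∈ (insert e T)ᶜ, z x = ∏ x ∈ Tᶜ, z x := by
  rw [Finset.compl_insert, Finset.mul_prod_erase _ _ (by simpa using he)]

theorem IsOneTree.prod_le_D {T : Finset (Line h)} (hT : G.IsOneTree T) {z : Line h → ℝ}
    (hz : ∀ e, 0 < z e) : ∏ x ∈ Tᶜ, z x ≤ G.D z :=
  Finset.single_le_sum (f := fun T : Finset (Line h) => ∏ x ∈ Tᶜ, z x)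
    (fun _ _ => Finset.prod_nonneg fun e _ => (hz e).le) (by simpa using hT)

variable (G) in
theorem D_pos {z : Line h → ℝ} (hz : ∀ e, 0 < z e) : 0 < G.D z :=
  (Finset.prod_pos fun e _ => hz e).trans_le ((isOneTree_leptons G).prod_le_D hz)

/-- The number of all sets of lines. -/
def numSets (h : ℕ) : ℝ := Fintype.card (Finset (Line h))

theorem numSets_pos (h : ℕ) : 0 < numSets h := by
  unfold numSets; exact_mod_cast Fintype.card_pos

theorem abs_sum_le_numSets {s : Finset (Finset (Line h))} {f : Finset (Line h) → ℝ} {b : ℝ}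
    (hb : 0 ≤ b) (hf : ∀ T ∈ s, |f T| ≤ b) : |∑ T ∈ s, f T| ≤ numSets h * b := by
  calc |∑ T ∈ s, f T| ≤ ∑ T ∈ s, |f T| := Finset.abs_sum_le_sum_abs _ _
    _ ≤ s.card • b := Finset.sum_le_card_nsmul _ _ _ hf
    _ ≤ numSets h * b := by
        rw [nsmul_eq_mul]
        refine mul_le_mul_of_nonneg_right ?_ hb
        unfold numSets
        exact_mod_cast Finset.card_le_univ s

/-- Deleting the line `l` from the cycle leaves a 1-tree whose monomial is `z_l` times that of the
tree with cycle, so each term of `B` is at most `D / z_l`. -/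
theorem abs_B_div_D_le {z : Line h → ℝ} (hz : ∀ e, 0 < z e) (l₁ l₂ l : Fin (2 * h))
    (hl : l = l₁ ∨ l = l₂) : |G.B z l₁ l₂ / G.D z| ≤ numSets h / z (Sum.inl l) := by
  have hD := G.D_pos hz
  rw [abs_div, abs_of_pos hD, div_le_iff₀ hD]
  have : numSets h / z (Sum.inl l) * G.D z = numSets h * (G.D z / z (Sum.inl l)) := by ring
  rw [this]
  refine abs_sum_le_numSets (div_nonneg hD.le (hz _).le) fun T hT => ?_
  simp only [Finset.mem_filter, Finset.mem_univ, true_and] at hT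
  have hlT : G.OnCycle T (Sum.inl l) := by rcases hl with rfl | rfl; exacts [hT.2.1, hT.2.2]
  have h1 := (hT.1.2 _ hlT).prod_le_D hz
  rw [prod_compl_erase hlT.1] at h1
  have h0 : 0 ≤ ∏ x ∈ Tᶜ, z x := Finset.prod_nonneg fun e _ => (hz e).le
  have h2 : |G.cycleSign T l₁ l₂| = 1 := by
    unfold cycleSign; split_ifs <;> simp
  rw [abs_mul, h2, one_mul, abs_of_nonneg h0, le_div_iff₀ (hz _), mul_comm]
  exact h1

/-- A 1-tree with a photon line has a small contribution to `D`, if the lepton path of the photon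
line is short. -/
theorem IsOneTree.prod_le_of_photon {T : Finset (Line h)} (hT : G.IsOneTree T) {z : Line h → ℝ}
    (hz : ∀ e, 0 < z e) {i : Fin h} (hi : Sum.inr i ∈ T) {a : ℝ}
    (ha : ∀ e ∈ G.lpath i, z e ≤ a) :
    ∏ x ∈ Tᶜ, z x ≤ G.D z * min 1 (a / z (Sum.inr i)) := by
  rw [mul_min_of_nonneg _ _ (G.D_pos hz).le, mul_one]
  refine le_min (hT.prod_le_D hz) ?_
  -- The monomial of `T` is `z_e / z_i` times that of the exchanged tree.
  obtain ⟨e, he, heT, hex⟩ := hT.exchange_photon hi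
  have h1 := prod_compl_erase hi z
  have h2 := prod_compl_insert (fun h => heT (Finset.mem_of_mem_erase h) :
    e ∉ T.erase (Sum.inr i)) z
  rw [h1] at h2
  have h3 := hex.prod_le_D hz
  have h4 := G.D_pos hz
  have hzi := hz (Sum.inr i)
  rw [← mul_div_assoc, le_div_iff₀ hzi, mul_comm, ← h2, mul_comm]
  exact mul_le_mul h3 (ha e he) (hz e).le h4.le

/-! ### Momenta of the lepton lines -/

/-- The coefficient of the incoming lepton momentum in the momentum of the line `l` in `T`. -/
def treeCoeffIn (G : VertexGraph h) (T : Finset (Line h)) (l : Fin (2 * h)) : ℝ :=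
  (if G.Reach (T.erase (Sum.inl l)) l.succ G.ext then 1 else 0)
    - (if G.Reach (T.erase (Sum.inl l)) l.succ 0 then 1 else 0)

/-- The coefficient of the outgoing lepton momentum in the momentum of the line `l` in `T`. -/
def treeCoeffOut (G : VertexGraph h) (T : Finset (Line h)) (l : Fin (2 * h)) : ℝ :=
  (if G.Reach (T.erase (Sum.inl l)) l.succ (Fin.last (2 * h)) then 1 else 0)
    - (if G.Reach (T.erase (Sum.inl l)) l.succ G.ext then 1 else 0)

/-- The average over 1-trees of a function of a 1-tree containing the line `l`. -/
def treeAverage (G : VertexGraph h) (z : Line h → ℝ) (l : Fin (2 * h))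
    (f : Finset (Line h) → ℝ) : ℝ :=
  (∑ T ∈ Finset.univ.filter (fun T => G.IsOneTree T ∧ Sum.inl l ∈ T),
    (∏ e ∈ Tᶜ, z e) * f T) / G.D z

/-- The coefficients of `Q_l / D` at the incoming and the outgoing lepton momentum. -/
def coeff (G : VertexGraph h) (z : Line h → ℝ) (l : Fin (2 * h)) : ℝ × ℝ :=
  (treeAverage G z l (G.treeCoeffIn · l), treeAverage G z l (G.treeCoeffOut · l))

/-- The coefficients of the momentum of the line `l` when no momentum flows through photons. -/
def bareCoeff (G : VertexGraph h) (l : Fin (2 * h)) : ℝ × ℝ :=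
  if l.castSucc < G.ext then (1, 0) else (0, 1)

theorem treeMomentum_eq (T : Finset (Line h)) (l : Fin (2 * h)) (p q : Fin 4 → ℝ) :
    G.treeMomentum T l p q = G.treeCoeffIn T l • (p - (1 / 2 : ℝ) • q)
      + G.treeCoeffOut T l • (p + (1 / 2 : ℝ) • q) := by
  unfold treeMomentum treeCoeffIn treeCoeffOut
  ext μ
  simp only [Pi.sub_apply, Pi.add_apply, Pi.smul_apply, smul_eq_mul]
  split_ifs <;> simp <;> ring

theorem inv_D_smul_Q (z : Line h → ℝ) (p q : Fin 4 → ℝ) (l : Fin (2 * h)) :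
    (G.D z)⁻¹ • G.Q z p q l = (G.coeff z l).1 • (p - (1 / 2 : ℝ) • q)
      + (G.coeff z l).2 • (p + (1 / 2 : ℝ) • q) := by
  unfold Q coeff treeAverage
  simp only [treeMomentum_eq]
  generalize p - (1 / 2 : ℝ) • q = p₁
  generalize p + (1 / 2 : ℝ) • q = p₂
  simp only [smul_add, smul_smul, Finset.sum_add_distrib, ← Finset.sum_smul, div_eq_inv_mul]

/-- The weights of the 1-trees divided by `D` add up to `1`, so the constant `c` can be moved under
the average. -/
theorem abs_treeAverage_sub_le {z : Line h → ℝ} (hz : ∀ e, 0 < z e) (l : Fin (2 * h))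
    (f : Finset (Line h) → ℝ) (c b : ℝ) (hb : 0 ≤ b)
    (hf : ∀ T, G.IsOneTree T →
      (∏ e ∈ Tᶜ, z e) * |(if Sum.inl l ∈ T then f T else 0) - c| ≤ G.D z * b) :
    |treeAverage G z l f - c| ≤ numSets h * b := by
  have hD := G.D_pos hz
  have h1 : treeAverage G z l f - c = (∑ T ∈ Finset.univ.filter (fun T => G.IsOneTree T),
      (∏ e ∈ Tᶜ, z e) * ((if Sum.inl l ∈ T then f T else 0) - c)) / G.D z := by
    rw [treeAverage, sub_eq_iff_eq_add, ← Finset.filter_filter, Finset.sum_filter]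
    have : c = (∑ T ∈ Finset.univ.filter (fun T => G.IsOneTree T), (∏ e ∈ Tᶜ, z e) * c)
        / G.D z := by
      rw [← Finset.sum_mul]
      exact (mul_div_cancel_left₀ c hD.ne').symm
    conv_rhs => rw [this]
    rw [← add_div, ← Finset.sum_add_distrib]
    congr 1
    refine Finset.sum_congr rfl fun T _ => ?_
    rw [← this]
    split_ifs <;> ring
  rw [h1, abs_div, abs_of_pos hD, div_le_iff₀ hD]
  have : numSets h * b * G.D z = numSets h * (G.D z * b) := by ring
  rw [this]
  refine abs_sum_le_numSets (mul_nonneg hD.le hb) fun T hT => ?_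
  rw [abs_mul, abs_of_nonneg (Finset.prod_nonneg fun e _ => (hz e).le)]
  exact hf T (by simpa using hT)

theorem abs_treeCoeffIn_le (T : Finset (Line h)) (l : Fin (2 * h)) :
    |G.treeCoeffIn T l| ≤ 1 := by
  unfold treeCoeffIn; split_ifs <;> simp

theorem abs_treeCoeffOut_le (T : Finset (Line h)) (l : Fin (2 * h)) :
    |G.treeCoeffOut T l| ≤ 1 := by
  unfold treeCoeffOut; split_ifs <;> simp

/-- If no photon line of a 1-tree passes over the line `l`, the external momentum flows through `l`
as if there were no photons. -/
theorem IsOneTree.reach_iff_of_no_photon {T : Finset (Line h)} (hT : G.IsOneTree T)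
    {l : Fin (2 * h)} (hl : ∀ i, Sum.inr i ∈ T → Sum.inl l ∉ G.lpath i) :
    Sum.inl l ∈ T ∧ ∀ v, G.Reach (T.erase (Sum.inl l)) l.succ v ↔ l.castSucc < v := by
  -- Apart from `l`, no line of `T` crosses the cut between the vertices up to `l` and those from `l
  -- + 1` on.
  have hcr : ∀ e ∈ T, (e.elim (fun l' => l' = l) (fun _ => False)) ∨
      (G.src e ≤ l.castSucc ↔ G.tgt e ≤ l.castSucc) := by
    intro e he
    cases e with
    | inl l' =>
      simp only [src, tgt, Fin.le_def, Fin.val_castSucc, Fin.val_succ, Sum.elim_inl, Fin.ext_iff]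
      omega
    | inr i =>
      right
      have h1 := hl i he
      rw [inl_mem_lpath_iff_cut] at h1
      have h2 := G.fst_lt_snd i
      simp only [src, tgt]
      constructor
      · tauto
      · exact fun h3 => h2.le.trans h3
  have hno : ∀ u v, G.Reach (T.erase (Sum.inl l)) u v → u ≤ l.castSucc → v ≤ l.castSucc := by
    intro u v huv hu
    by_contra hv
    obtain ⟨e, he, hc⟩ := huv.exists_crossing (fun v => v ≤ l.castSucc) hu hv
    rcases hcr e (Finset.mem_of_mem_erase he) with h1 | h1
    · cases e with
      | inl l' => exact Finset.ne_of_mem_erase he (by rw [show l' = l from h1])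
      | inr i => exact h1
    · tauto
  have hls : ¬ l.succ ≤ l.castSucc := not_le.2 Fin.castSucc_lt_succ
  have hlT : Sum.inl l ∈ T := by
    by_contra hlT
    have := hT.1 l.castSucc l.succ
    rw [← Finset.erase_eq_of_notMem hlT] at this
    exact hls (hno _ _ this le_rfl)
  refine ⟨hlT, fun v => ⟨fun hr => ?_, fun hv => ?_⟩⟩
  · by_contra hv
    exact hls (hno _ _ hr.symm (not_lt.1 hv))
  · have h1 := hT.1 l.succ v
    rw [← Finset.insert_erase hlT] at h1
    rcases reach_insert h1 with h2 | ⟨h2, _⟩ | ⟨_, h2⟩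
    · exact h2
    · exact absurd (hno _ _ h2.symm le_rfl) hls
    · exact absurd (hno _ _ h2 le_rfl) (not_le.2 hv)

theorem norm_coeff_le {z : Line h → ℝ} (hz : ∀ e, 0 < z e) (l : Fin (2 * h)) :
    ‖G.coeff z l‖ ≤ numSets h := by
  have key : ∀ f : Finset (Line h) → ℝ, (∀ T, |f T| ≤ 1) → |treeAverage G z l f| ≤ numSets h := by
    intro f hf
    have := abs_treeAverage_sub_le (G := G) hz l f 0 1 zero_le_one ?_
    · simpa using this
    · intro T hT
      have h1 := hT.prod_le_D hz
      have h2 : |(if Sum.inl l ∈ T then f T else 0) - 0| ≤ 1 := by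
        split_ifs
        · simpa using hf T
        · simp
      exact mul_le_mul h1 h2 (abs_nonneg _) (G.D_pos hz).le
  rw [Prod.norm_def]
  exact max_le (key _ fun T => abs_treeCoeffIn_le T l) (key _ fun T => abs_treeCoeffOut_le T l)

/-- A 1-tree without photon lines over `l` gives exactly the bare coefficients. The other 1-trees
have relative weight at most `r` and deviate by at most `2`. -/
theorem norm_coeff_sub_bareCoeff_le {z : Line h → ℝ} (hz : ∀ e, 0 < z e) (l : Fin (2 * h))
    {r : ℝ} (hr : 0 ≤ r)
    (hphoton : ∀ T, G.IsOneTree T → ∀ i, Sum.inr i ∈ T → ∏ e ∈ Tᶜ, z e ≤ G.D z * r) :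
    ‖G.coeff z l - G.bareCoeff l‖ ≤ numSets h * (2 * r) := by
  have key : ∀ (f : Finset (Line h) → ℝ) (c : ℝ), (∀ T, |f T| ≤ 1) → |c| ≤ 1 →
      (∀ T, Sum.inl l ∈ T → (∀ v, G.Reach (T.erase (Sum.inl l)) l.succ v ↔ l.castSucc < v) →
        f T = c) → |treeAverage G z l f - c| ≤ numSets h * (2 * r) := by
    intro f c hf hc hfc
    refine abs_treeAverage_sub_le hz l f c _ (by positivity) fun T hT => ?_
    by_cases hl : ∀ i, Sum.inr i ∈ T → Sum.inl l ∉ G.lpath i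
    · obtain ⟨h1, h2⟩ := hT.reach_iff_of_no_photon hl
      rw [if_pos h1, hfc T h1 h2, sub_self, abs_zero, mul_zero]
      exact mul_nonneg (G.D_pos hz).le (by positivity)
    · push Not at hl
      obtain ⟨i, hi, _⟩ := hl
      have h1 := hphoton T hT i hi
      have h2 : |(if Sum.inl l ∈ T then f T else 0) - c| ≤ 2 := by
        refine (abs_sub _ _).trans ?_
        split_ifs
        · linarith [hf T]
        · simp; linarith
      calc _ ≤ G.D z * r * 2 := mul_le_mul h1 h2 (abs_nonneg _)
              (mul_nonneg (G.D_pos hz).le hr)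
        _ = _ := by ring
  rw [Prod.norm_def]
  have h0 : ¬ l.castSucc < (0 : Fin (2 * h + 1)) := by simp
  have hlast : l.castSucc < Fin.last (2 * h) := Fin.castSucc_lt_last l
  refine max_le (key _ _ (fun T => abs_treeCoeffIn_le T l) ?_ ?_)
    (key _ _ (fun T => abs_treeCoeffOut_le T l) ?_ ?_)
  · unfold bareCoeff; split_ifs <;> simp
  · intro T _ hT
    unfold treeCoeffIn bareCoeff
    simp only [hT, h0, if_false, sub_zero]
    split_ifs <;> rfl
  · unfold bareCoeff; split_ifs <;> simp
  · intro T _ hT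
    unfold treeCoeffOut bareCoeff
    simp only [hT, hlast, if_true]
    split_ifs <;> simp

/-! ### The bound for `W` -/

theorem sum_sub_succ {n : ℕ} (φ : Fin (n + 1) → ℝ) :
    ∑ l : Fin n, (φ l.castSucc - φ l.succ) = φ 0 - φ (Fin.last n) := by
  have h1 := Fin.sum_univ_succ φ
  have h2 := Fin.sum_univ_castSucc φ
  rw [Finset.sum_sub_distrib]
  linarith

theorem sum_lpath_sub (φ : Fin (2 * h + 1) → ℝ) (i : Fin h) :
    ∑ l : Fin (2 * h), (if Sum.inl l ∈ G.lpath i then φ l.castSucc - φ l.succ else 0)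
      = φ (G.fst i) - φ (G.snd i) := by
  -- The potential with its argument clamped to the interval between the ends of `i` telescopes to
  -- the right side, and its differences vanish off `LPath(i)`.
  have h1 := sum_sub_succ (fun v => φ (max (G.fst i) (min (G.snd i) v)))
  have hlt := G.fst_lt_snd i
  have e1 : max (G.fst i) (min (G.snd i) 0) = G.fst i := by simp
  have e2 : max (G.fst i) (min (G.snd i) (Fin.last (2 * h))) = G.snd i := by
    rw [min_eq_left (Fin.le_last _), max_eq_right hlt.le]
  simp only [e1, e2] at h1
  rw [← h1]
  refine Finset.sum_congr rfl fun l _ => ?_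
  have hls : l.castSucc < l.succ := Fin.castSucc_lt_succ
  split_ifs with hl <;> rw [inl_mem_lpath] at hl
  · rw [min_eq_right (hls.le.trans hl.2), max_eq_right hl.1, min_eq_right hl.2,
      max_eq_right (hl.1.trans hls.le)]
  · rw [not_and_or, not_le, not_le] at hl
    rcases hl with hl | hl
    · have hl' : l.succ ≤ G.fst i := Fin.castSucc_lt_iff_succ_le.1 hl
      rw [max_eq_left ((min_le_right _ _).trans hl.le), max_eq_left ((min_le_right _ _).trans hl'),
        sub_self]
    · have hl' : G.snd i ≤ l.castSucc := by
        rw [Fin.lt_def, Fin.val_succ] at hl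
        rw [Fin.le_def, Fin.val_castSucc]; omega
      rw [min_eq_left hl', min_eq_left hl.le, sub_self]

/-- Kirchhoff's law at each vertex is multiplied by the potential there and summed over the
vertices. -/
theorem IsPotential.power {z : Line h → ℝ} {φ : Fin (2 * h + 1) → ℝ} (hφ : G.IsPotential z φ) :
    ∑ e, (φ (G.src e) - φ (G.tgt e)) ^ 2 / z e = φ 0 - φ (Fin.last (2 * h)) := by
  have h1 : ∑ v, φ v * (∑ e, ((if G.src e = v then 1 else 0) - (if G.tgt e = v then 1 else 0)) *
      ((φ (G.src e) - φ (G.tgt e)) / z e))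
      = ∑ v, φ v * ((if v = 0 then 1 else 0) - (if v = Fin.last (2 * h) then 1 else 0)) :=
    Finset.sum_congr rfl fun v _ => by rw [hφ v]
  have h2 : ∑ v, φ v * ((if v = 0 then 1 else 0) - (if v = Fin.last (2 * h) then 1 else 0) : ℝ)
      = φ 0 - φ (Fin.last (2 * h)) := by
    simp [mul_sub, Finset.sum_sub_distrib]
  rw [← h2, ← h1]
  simp only [Finset.mul_sum]
  rw [Finset.sum_comm]
  refine Finset.sum_congr rfl fun e _ => ?_
  have : ∀ v, φ v * (((if G.src e = v then 1 else 0) - (if G.tgt e = v then 1 else 0)) *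
      ((φ (G.src e) - φ (G.tgt e)) / z e))
      = ((if G.src e = v then φ v else 0) - (if G.tgt e = v then φ v else 0)) *
      ((φ (G.src e) - φ (G.tgt e)) / z e) := by
    intro v; split_ifs <;> ring
  simp only [this, ← Finset.sum_mul, Finset.sum_sub_distrib]
  simp
  ring

/-- The resistance of the lepton path in parallel with one photon line bounds the resistance of the
circuit. -/
theorem resistance_le {z : Line h → ℝ} (hz : ∀ e, 0 < z e) (i : Fin h) {R : ℝ}
    (hR : R = ∑ l : Fin (2 * h), if Sum.inl l ∈ G.lpath i then z (Sum.inl l) else 0) :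
    G.resistance z ≤ ∑ l : Fin (2 * h), z (Sum.inl l) - R ^ 2 / (R + z (Sum.inr i)) := by
  have hzi := hz (Sum.inr i)
  have hR0 : 0 ≤ R := by
    rw [hR]; exact Finset.sum_nonneg fun l _ => by split_ifs; exacts [(hz _).le, le_rfl]
  have hRz : R ≤ ∑ l : Fin (2 * h), z (Sum.inl l) := by
    rw [hR]; exact Finset.sum_le_sum fun l _ => by split_ifs; exacts [le_rfl, (hz _).le]
  unfold resistance
  split_ifs with hφ
  · set φ := hφ.choose with hφdef
    have hpot : G.IsPotential z φ := hφ.choose_spec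
    have hpow := hpot.power
    -- The share of the current sent through the photon line: it minimizes `(1 - x)² R + x² z_i`.
    -- The flow `θ` sends the rest along `LPath(i)`.
    set x := R / (R + z (Sum.inr i)) with hx
    let θ : Line h → ℝ := Sum.elim (fun l => if Sum.inl l ∈ G.lpath i then 1 - x else 1)
      (fun k => if k = i then x else 0)
    have h1 : ∑ e, θ e * (φ (G.src e) - φ (G.tgt e)) = φ 0 - φ (Fin.last (2 * h)) := by
      rw [Fintype.sum_sum_type, ← sum_sub_succ]
      have e1 : ∀ l : Fin (2 * h), θ (Sum.inl l) * (φ (G.src (Sum.inl l)) - φ (G.tgt (Sum.inl l)))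
          = (φ l.castSucc - φ l.succ)
            - x * (if Sum.inl l ∈ G.lpath i then φ l.castSucc - φ l.succ else 0) := by
        intro l
        simp only [θ, Sum.elim_inl, src, tgt]
        split_ifs <;> ring
      have e2 : ∀ k : Fin h, θ (Sum.inr k) * (φ (G.src (Sum.inr k)) - φ (G.tgt (Sum.inr k)))
          = if k = i then x * (φ (G.fst k) - φ (G.snd k)) else 0 := by
        intro k
        simp only [θ, Sum.elim_inr, src, tgt]
        split_ifs <;> ring
      simp only [e1, e2, Finset.sum_sub_distrib, ← Finset.mul_sum, sum_lpath_sub]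
      simp
    have h2 : ∑ e, z e * θ e ^ 2 = ∑ l : Fin (2 * h), z (Sum.inl l)
        - R ^ 2 / (R + z (Sum.inr i)) := by
      rw [Fintype.sum_sum_type]
      have e1 : ∀ l : Fin (2 * h), z (Sum.inl l) * θ (Sum.inl l) ^ 2
          = z (Sum.inl l)
            - (2 * x - x ^ 2) * (if Sum.inl l ∈ G.lpath i then z (Sum.inl l) else 0) := by
        intro l
        simp only [θ, Sum.elim_inl]
        split_ifs <;> ring
      have e2 : ∀ k : Fin h, z (Sum.inr k) * θ (Sum.inr k) ^ 2
          = if k = i then z (Sum.inr k) * x ^ 2 else 0 := by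
        intro k
        simp only [θ, Sum.elim_inr]
        split_ifs <;> ring
      simp only [e1, e2, Finset.sum_sub_distrib, ← Finset.mul_sum, ← hR]
      simp only [Finset.sum_ite_eq', Finset.mem_univ, if_true]
      have : R + z (Sum.inr i) ≠ 0 := by positivity
      rw [hx]
      field_simp
      ring
    -- Thomson's principle: among unit flows the true current dissipates the least power. Expanding
    -- the squared difference of the two flows gives resistance at most `∑ z θ²`.
    have h3 : 0 ≤ ∑ e, z e * (θ e - (φ (G.src e) - φ (G.tgt e)) / z e) ^ 2 :=
      Finset.sum_nonneg fun e _ => mul_nonneg (hz e).le (sq_nonneg _)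
    have h4 : ∀ e, z e * (θ e - (φ (G.src e) - φ (G.tgt e)) / z e) ^ 2
        = z e * θ e ^ 2 - 2 * (θ e * (φ (G.src e) - φ (G.tgt e)))
          + (φ (G.src e) - φ (G.tgt e)) ^ 2 / z e := by
      intro e
      have := (hz e).ne'
      field_simp
      ring
    simp only [h4, Finset.sum_add_distrib, Finset.sum_sub_distrib, ← Finset.mul_sum, h1, h2,
      hpow] at h3
    linarith
  -- Without a potential, `resistance` has the default value `0`; the right side is nonnegative
  -- anyway, so solvability of the circuit equations is not needed.
  · have : R ^ 2 / (R + z (Sum.inr i)) ≤ R := by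
      rw [div_le_iff₀ (by positivity)]
      nlinarith
    linarith

/-- The gain `R² / (R + z_i)` from the parallel photon line is estimated by `R ≥ z_e` and `R / (R +
z_i) ≥ ½ min(1, z_e / z_i)`. -/
theorem le_neg_W {m : ℝ} {z : Line h → ℝ} (hz : ∀ e, 0 < z e) {i : Fin h} {e : Line h}
    (he : e ∈ G.lpath i) :
    m ^ 2 * (1 / 2 * (z e * min 1 (z e / z (Sum.inr i)))) ≤ -G.W m z := by
  set R := ∑ l : Fin (2 * h), if Sum.inl l ∈ G.lpath i then z (Sum.inl l) else 0 with hR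
  have h1 := resistance_le hz i hR
  have heR : z e ≤ R := by
    cases e with
    | inr k => exact absurd he inr_notMem_lpath
    | inl l =>
      have := Finset.single_le_sum
        (f := fun l : Fin (2 * h) => if Sum.inl l ∈ G.lpath i then z (Sum.inl l) else 0)
        (fun l _ => by split_ifs; exacts [(hz _).le, le_rfl]) (Finset.mem_univ l)
      simpa only [if_pos he] using this
  have hze := hz e
  have hzi := hz (Sum.inr i)
  have h2 : 1 / 2 * (z e * min 1 (z e / z (Sum.inr i))) ≤ R ^ 2 / (R + z (Sum.inr i)) := by
    have hRp : 0 < R := hze.trans_le heR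
    have h3 : min 1 (z e / z (Sum.inr i)) ≤ 2 * (R / (R + z (Sum.inr i))) := by
      rcases le_total (z (Sum.inr i)) R with h4 | h4
      · refine (min_le_left _ _).trans ?_
        rw [← mul_div_assoc, le_div_iff₀ (by positivity)]
        linarith
      · refine (min_le_right _ _).trans ?_
        rw [← mul_div_assoc, div_le_div_iff₀ hzi (by positivity)]
        nlinarith
    have h5 : 0 ≤ min 1 (z e / z (Sum.inr i)) := le_min zero_le_one (by positivity)
    have h6 : z e * min 1 (z e / z (Sum.inr i)) ≤ R * (2 * (R / (R + z (Sum.inr i)))) :=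
      mul_le_mul heR h3 h5 hRp.le
    calc _ ≤ 1 / 2 * (R * (2 * (R / (R + z (Sum.inr i))))) := by linarith
      _ = _ := by ring
  unfold W
  have : m ^ 2 * (1 / 2 * (z e * min 1 (z e / z (Sum.inr i)))) ≤
      m ^ 2 * (∑ l : Fin (2 * h), z (Sum.inl l) - G.resistance z) :=
    mul_le_mul_of_nonneg_left (by linarith) (sq_nonneg m)
  linarith

end QED.VertexGraph

namespace QED

/-! ### Dirac algebra -/

theorem metric_mul_self (k : Fin 4) : metric k * metric k = 1 := by
  unfold metric; split_ifs <;> norm_num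

set_option maxHeartbeats 2000000 in
theorem gamma_mul_add (i k : Fin 4) :
    gamma i * gamma k + gamma k * gamma i
      = if i = k then (2 * (metric k : ℂ)) • (1 : Mat4) else 0 := by
  rw [← Matrix.ext_iff]
  fin_cases i <;> fin_cases k <;>
    simp [gamma, metric, Fin.forall_fin_succ, Matrix.one_apply] <;> norm_num

/-- The matrix `∑ x^k γ^k`. -/
def vec (x : Fin 4 → ℂ) : Mat4 := ∑ k, x k • gamma k

theorem gamma_mul_vec (k : Fin 4) (x : Fin 4 → ℂ) :
    gamma k * vec x = (2 * (metric k * x k)) • (1 : Mat4) - vec x * gamma k := by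
  rw [eq_sub_iff_add_eq, vec, Finset.mul_sum, Finset.sum_mul, ← Finset.sum_add_distrib]
  have : ∀ i, gamma k * x i • gamma i + x i • gamma i * gamma k
      = if k = i then (2 * (metric k * x k)) • (1 : Mat4) else 0 := by
    intro i
    rw [mul_smul_comm, smul_mul_assoc, ← smul_add, gamma_mul_add]
    split_ifs with hk
    · subst hk; rw [smul_smul]; ring_nf
    · rw [smul_zero]
  rw [Finset.sum_congr rfl fun i _ => this i, Finset.sum_ite_eq, if_pos (Finset.mem_univ _)]

theorem slash_eq_vec (a : Fin 4 → ℝ) : slash a = vec (fun k => (a k : ℂ) * metric k) := by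
  simp only [slash, vec, gammaLow, smul_smul]

theorem gammaLow_eq_vec (μ : Fin 4) :
    gammaLow μ = vec (fun k => if k = μ then (metric μ : ℂ) else 0) := by
  simp [vec, gammaLow]

theorem gamma_eq_vec (μ : Fin 4) : gamma μ = vec (fun k => if k = μ then 1 else 0) := by
  simp [vec]

theorem slash_smul (c : ℝ) (a : Fin 4 → ℝ) : slash (c • a) = (c : ℂ) • slash a := by
  simp only [slash, Finset.smul_sum, smul_smul, Pi.smul_apply, smul_eq_mul, Complex.ofReal_mul]

theorem slash_add (a b : Fin 4 → ℝ) : slash (a + b) = slash a + slash b := by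
  simp [slash, add_smul, Finset.sum_add_distrib]

theorem metric_mul_self_complex (k : Fin 4) : (metric k : ℂ) * metric k = 1 := by
  exact_mod_cast metric_mul_self k

theorem gamma_mul_slash (k : Fin 4) (a : Fin 4 → ℝ) :
    gamma k * slash a = (2 * (a k : ℂ)) • (1 : Mat4) - slash a * gamma k := by
  rw [slash_eq_vec, gamma_mul_vec]
  congr 2
  linear_combination 2 * (a k : ℂ) * metric_mul_self_complex k

theorem gammaLow_mul_slash (k : Fin 4) (a : Fin 4 → ℝ) :
    gammaLow k * slash a
      = (2 * ((metric k * a k : ℝ) : ℂ)) • (1 : Mat4) - slash a * gammaLow k := by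
  rw [gammaLow, smul_mul_assoc, gamma_mul_slash, mul_smul_comm, smul_sub, smul_smul]
  push_cast
  congr 2
  ring

theorem slash_mul_slash (a b : Fin 4 → ℝ) :
    slash a * slash b = (2 * (mdot a b : ℂ)) • (1 : Mat4) - slash b * slash a := by
  rw [eq_sub_iff_add_eq]
  conv_lhs => lhs; lhs; rw [slash]
  conv_lhs => rhs; rhs; rw [slash]
  rw [Finset.sum_mul, Finset.mul_sum, ← Finset.sum_add_distrib]
  have : ∀ k, (a k : ℂ) • gammaLow k * slash b + slash b * (a k : ℂ) • gammaLow k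
      = (2 * ((metric k * a k * b k : ℝ) : ℂ)) • (1 : Mat4) := by
    intro k
    rw [smul_mul_assoc, gammaLow_mul_slash, mul_smul_comm, ← smul_add, sub_add_cancel, smul_smul]
    push_cast
    congr 1
    ring
  simp only [this, ← Finset.sum_smul, ← Finset.mul_sum, mdot]
  push_cast
  rfl

theorem slash_mul_self (a : Fin 4 → ℝ) : slash a * slash a = (mdot a a : ℂ) • (1 : Mat4) := by
  have h1 := slash_mul_slash a a
  rw [eq_sub_iff_add_eq, ← two_smul ℂ, mul_smul] at h1
  exact smul_right_injective _ (two_ne_zero (α := ℂ)) h1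

/-- The contraction `γ_k X γ^k`. -/
def contract (X : Mat4) : Mat4 := ∑ k, (metric k : ℂ) • (gamma k * X * gamma k)

theorem contract_one : contract 1 = (4 : ℂ) • (1 : Mat4) := by
  have : ∀ k, (metric k : ℂ) • (gamma k * 1 * gamma k) = (1 : Mat4) := by
    intro k
    have h1 := gamma_mul_add k k
    rw [if_pos rfl, ← two_smul ℂ, mul_smul] at h1
    rw [mul_one, smul_right_injective _ (two_ne_zero (α := ℂ)) h1, smul_smul,
      metric_mul_self_complex, one_smul]
  simp only [contract, this]
  simp [← Nat.cast_smul_eq_nsmul ℂ]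

/-- Anticommuting `γ_k` through the first factor leaves the scalar `2 x_k`, which the sum over `k`
turns into that factor placed behind `U`. -/
theorem contract_vec_mul (x : Fin 4 → ℂ) (U : Mat4) :
    contract (vec x * U) = (2 : ℂ) • (U * vec x) - vec x * contract U := by
  have h1 : ∀ k, (metric k : ℂ) • (gamma k * (vec x * U) * gamma k)
      = (2 * x k) • (U * gamma k) - vec x * ((metric k : ℂ) • (gamma k * U * gamma k)) := by
    intro k
    rw [← mul_assoc, gamma_mul_vec, sub_mul, sub_mul, smul_sub, smul_mul_assoc, smul_mul_assoc,
      one_mul, smul_smul, mul_smul_comm]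
    congr 1
    · congr 1
      linear_combination 2 * x k * metric_mul_self_complex k
    · simp only [mul_assoc]
  simp only [contract, h1, Finset.sum_sub_distrib, ← Finset.mul_sum]
  simp [vec, Finset.mul_sum, Finset.smul_sum, mul_smul]

/-! ### Words of Dirac matrices and their contractions -/

section Words

variable {E Λ α : Type*}

/-- The product of the values of the letters of a word. -/
def evalWord (val : E → Λ → Mat4) (w : List Λ) (e : E) : Mat4 := (w.map (val e)).prod

/-- The linear span of a set of words. -/
def wordSpan (val : E → Λ → Mat4) (S : Set (List Λ)) : Submodule ℂ (E → Mat4) :=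
  Submodule.span ℂ (evalWord val '' S)

theorem evalWord_mem {val : E → Λ → Mat4} {S : Set (List Λ)} {w : List Λ} (hw : w ∈ S) :
    evalWord val w ∈ wordSpan val S :=
  Submodule.subset_span ⟨w, hw, rfl⟩

theorem wordSpan_map_le {E' : Type*} {val : E → Λ → Mat4} {S : Set (List Λ)}
    (L : (E → Mat4) →ₗ[ℂ] (E' → Mat4)) (V : Submodule ℂ (E' → Mat4))
    (hL : ∀ w ∈ S, L (evalWord val w) ∈ V) {f : E → Mat4} (hf : f ∈ wordSpan val S) :
    L f ∈ V := by
  have : wordSpan val S ≤ V.comap L := by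
    rw [wordSpan, Submodule.span_le]
    rintro _ ⟨w, hw, rfl⟩
    exact hL w hw
  exact this hf

/-- Multiplication of matrix-valued functions from both sides. -/
def mulLeftRight (A B : E → Mat4) : (E → Mat4) →ₗ[ℂ] (E → Mat4) where
  toFun f e := A e * f e * B e
  map_add' f g := by ext1 e; simp [mul_add, add_mul]
  map_smul' c f := by ext1 e; simp

theorem evalWord_append (val : E → Λ → Mat4) (w w' : List Λ) (e : E) :
    evalWord val (w ++ w') e = evalWord val w e * evalWord val w' e := by
  simp [evalWord]

theorem mul_mem_wordSpan {val : E → Λ → Mat4} {S S' : Set (List Λ)} {f : E → Mat4}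
    (hf : f ∈ wordSpan val S) (A B : List Λ) (hS : ∀ w ∈ S, A ++ w ++ B ∈ S') :
    (fun e => evalWord val A e * f e * evalWord val B e) ∈ wordSpan val S' := by
  refine wordSpan_map_le (mulLeftRight (evalWord val A) (evalWord val B)) _
    (fun w hw => ?_) hf
  have : mulLeftRight (evalWord val A) (evalWord val B) (evalWord val w)
      = evalWord val (A ++ w ++ B) := by
    ext1 e
    simp [mulLeftRight, evalWord_append, mul_assoc]
  rw [this]
  exact evalWord_mem (hS w hw)

/-- The contraction of a word is a linear combination of its permutations. -/
theorem contract_mem_wordSpan {val : E → Λ → Mat4} (hval : ∀ e a, ∃ x, val e a = vec x)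
    (U : List Λ) :
    (fun e => contract (evalWord val U e)) ∈ wordSpan val {w | w.Perm U} := by
  induction U with
  | nil =>
    have : (fun e => contract (evalWord val [] e)) = (4 : ℂ) • evalWord val [] := by
      ext1 e
      simp [evalWord, contract_one]
    rw [this]
    exact Submodule.smul_mem _ _ (evalWord_mem (List.Perm.refl _))
  | cons a U ih =>
    have : (fun e => contract (evalWord val (a :: U) e)) = (2 : ℂ) • evalWord val (U ++ [a])
        - fun e => evalWord val [a] e * contract (evalWord val U e) * evalWord val [] e := by
      ext1 e
      obtain ⟨x, hx⟩ := hval e a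
      have h1 : evalWord val (a :: U) e = vec x * evalWord val U e := by simp [evalWord, hx]
      rw [h1, contract_vec_mul]
      simp [evalWord, hx]
    rw [this]
    refine Submodule.sub_mem _ (Submodule.smul_mem _ _ (evalWord_mem ?_))
      (mul_mem_wordSpan ih _ _ ?_)
    · exact (List.perm_append_singleton a U)
    · intro w hw
      simpa using hw

/-- The number of occurrences of a letter in a word. -/
def occ (x : Λ) (w : List Λ) : ℕ := w.countP (fun y => decide (y = x))

theorem occ_cons (x y : Λ) (w : List Λ) : occ x (y :: w) = occ x w + if y = x then 1 else 0 := by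
  simp [occ, List.countP_cons]

theorem occ_append (x : Λ) (w w' : List Λ) : occ x (w ++ w') = occ x w + occ x w' := by
  simp [occ]

theorem occ_eq_zero {x : Λ} {w : List Λ} : occ x w = 0 ↔ x ∉ w := by
  simp only [occ, List.countP_eq_zero, decide_eq_true_eq]
  exact ⟨fun h hx => h x hx rfl, fun h y hy hyx => h (hyx ▸ hy)⟩

theorem mem_of_occ_pos {x : Λ} {w : List Λ} (hx : 0 < occ x w) : x ∈ w := by
  by_contra h
  rw [occ_eq_zero.2 h] at hx
  exact lt_irrefl _ hx

theorem occ_perm {x : Λ} {w w' : List Λ} (hw : w.Perm w') : occ x w = occ x w' :=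
  hw.countP_eq _

/-- Removal of the letter number `0` and renumbering of the others. -/
def dropZero {n : ℕ} : α ⊕ Fin (n + 1) → Option (α ⊕ Fin n)
  | Sum.inl a => some (Sum.inl a)
  | Sum.inr k => Fin.cases none (fun i => some (Sum.inr i)) k

@[simp] theorem dropZero_inl {n : ℕ} (a : α) :
    dropZero (Sum.inl a : α ⊕ Fin (n + 1)) = some (Sum.inl a) := rfl

@[simp] theorem dropZero_zero {n : ℕ} : dropZero (Sum.inr 0 : α ⊕ Fin (n + 1)) = none := rfl

@[simp] theorem dropZero_succ {n : ℕ} (i : Fin n) :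
    dropZero (Sum.inr i.succ : α ⊕ Fin (n + 1)) = some (Sum.inr i) := rfl

theorem filterMap_getLeft_dropZero {n : ℕ} (w : List (α ⊕ Fin (n + 1))) :
    (w.filterMap dropZero).filterMap Sum.getLeft? = w.filterMap Sum.getLeft? := by
  rw [List.filterMap_filterMap]
  congr 1
  ext1 x
  rcases x with a | k
  · rfl
  · refine Fin.cases rfl (fun i => rfl) k

theorem occ_dropZero {n : ℕ} (w : List (α ⊕ Fin (n + 1))) (i : Fin n) :
    occ (Sum.inr i) (w.filterMap dropZero) = occ (Sum.inr i.succ) w := by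
  induction w with
  | nil => rfl
  | cons x w ih =>
    rcases x with a | k
    · simp [occ_cons, ih]
    · induction k using Fin.cases with
      | zero => simp [List.filterMap_cons, occ_cons, ih, (Fin.succ_ne_zero i).symm]
      | succ k => simp [occ_cons, ih]

theorem prod_dropZero {n : ℕ} (f : α → Mat4) (k : Fin 4) (ν : Fin n → Fin 4)
    (w : List (α ⊕ Fin (n + 1))) (hw : Sum.inr 0 ∉ w) :
    (w.map (Sum.elim f (gamma ∘ (Fin.cons k ν : Fin (n + 1) → Fin 4)))).prod
      = ((w.filterMap dropZero).map (Sum.elim f (gamma ∘ ν))).prod := by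
  induction w with
  | nil => rfl
  | cons x w ih =>
    have ih := ih (fun h => hw (List.mem_cons_of_mem _ h))
    rcases x with a | i
    · simp [ih]
    · induction i using Fin.cases with
      | zero => exact absurd List.mem_cons_self hw
      | succ i => simp [ih]

/-- Summation over the values of the contracted indices. -/
def sumIndices (E : Type*) (β : Type*) [Fintype β] [DecidableEq β] :
    (E × (β → Fin 4) → Mat4) →ₗ[ℂ] (E → Mat4) where
  toFun f e := ∑ ν : β → Fin 4, (∏ i, (metric (ν i) : ℂ)) • f (e, ν)
  map_add' f g := by ext1 e; simp [Finset.sum_add_distrib]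
  map_smul' c f := by
    ext1 e
    simp only [Pi.smul_apply, RingHom.id_apply, Finset.smul_sum]
    exact Finset.sum_congr rfl fun ν _ => smul_comm _ _ _

/-- The values of letters, some of which are contracted indices. -/
def indexedVal {β : Type*} (val : E → α → Mat4) (e : E × (β → Fin 4)) : α ⊕ β → Mat4 :=
  Sum.elim (val e.1) (gamma ∘ e.2)

/-- If each contracted index occurs twice in a word, the contraction is a linear combination of
permutations of the other letters. -/
theorem sumIndices_fin_mem {val : E → α → Mat4} (hval : ∀ e a, ∃ x, val e a = vec x) (n : ℕ) :
    ∀ w : List (α ⊕ Fin n), (∀ i, occ (Sum.inr i) w = 2) →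
      sumIndices E (Fin n) (evalWord (indexedVal val) w)
        ∈ wordSpan val {w' | w'.Perm (w.filterMap Sum.getLeft?)} := by
  induction n with
  | zero =>
    intro w _
    have : sumIndices E (Fin 0) (evalWord (indexedVal val) w)
        = evalWord val (w.filterMap Sum.getLeft?) := by
      ext1 e
      simp only [sumIndices, LinearMap.coe_mk, AddHom.coe_mk, Finset.univ_unique,
        Finset.sum_singleton, Finset.univ_eq_empty, Finset.prod_empty, one_smul]
      unfold evalWord
      congr 1
      clear * -
      induction w with
      | nil => rfl
      | cons x w ih =>
        rcases x with a | i
        · simpa [indexedVal, List.filterMap_cons] using ih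
        · exact i.elim0
    rw [this]
    exact evalWord_mem (List.Perm.refl _)
  | succ n ih =>
    intro w hw
    obtain ⟨A, R, rfl, hA⟩ := List.eq_append_cons_of_mem
      (mem_of_occ_pos (by rw [hw 0]; norm_num) : Sum.inr 0 ∈ w)
    have hR : occ (Sum.inr 0) R = 1 := by
      have := hw 0
      rw [occ_append, occ_cons, occ_eq_zero.2 hA, if_pos rfl] at this
      omega
    obtain ⟨U, B, rfl, hU⟩ := List.eq_append_cons_of_mem
      (mem_of_occ_pos (by rw [hR]; norm_num) : Sum.inr 0 ∈ R)
    have hB : Sum.inr 0 ∉ B := by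
      rw [occ_append, occ_cons, occ_eq_zero.2 hU, if_pos rfl] at hR
      exact occ_eq_zero.1 (by omega)
    -- The index `0` gets a dummy value: the letters to which `val'` is applied do not include it.
    let val' : E × (Fin n → Fin 4) → α ⊕ Fin (n + 1) → Mat4 :=
      fun e => Sum.elim (val e.1) (gamma ∘ (Fin.cons 0 e.2 : Fin (n + 1) → Fin 4))
    have hval' : ∀ e a, ∃ x, val' e a = vec x := by
      rintro e (a | i)
      · exact hval e.1 a
      · exact ⟨_, gamma_eq_vec _⟩
    have h1 := mul_mem_wordSpan (contract_mem_wordSpan hval' U) A B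
      (S' := {w | w.Perm (A ++ U ++ B)})
      (fun w hw => ((List.Perm.append_left A hw).append_right B))
    have h2 : sumIndices E (Fin (n + 1)) (evalWord (indexedVal val)
        (A ++ Sum.inr 0 :: (U ++ Sum.inr 0 :: B)))
        = sumIndices E (Fin n)
          (fun e => evalWord val' A e * contract (evalWord val' U e) * evalWord val' B e) := by
      ext1 e
      simp only [sumIndices, LinearMap.coe_mk, AddHom.coe_mk]
      rw [← Equiv.sum_comp (Fin.consEquiv (fun _ : Fin (n + 1) => Fin 4)),
        Fintype.sum_prod_type, Finset.sum_comm]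
      refine Finset.sum_congr rfl fun ν _ => ?_
      simp only [contract, Finset.mul_sum, Finset.sum_mul, Finset.smul_sum]
      refine Finset.sum_congr rfl fun k _ => ?_
      have hk : ∀ w : List (α ⊕ Fin (n + 1)), Sum.inr 0 ∉ w →
          evalWord (indexedVal val) w (e, (Fin.cons k ν : Fin (n + 1) → Fin 4))
            = evalWord val' w (e, ν) := by
        intro w hw
        simp only [evalWord, indexedVal, val']
        rw [prod_dropZero _ _ _ _ hw, prod_dropZero _ _ _ _ hw]
      have hg : indexedVal val (e, (Fin.cons k ν : Fin (n + 1) → Fin 4)) (Sum.inr 0)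
          = gamma k := by simp [indexedVal]
      have hcons : ∀ w : List (α ⊕ Fin (n + 1)), evalWord (indexedVal val) (Sum.inr 0 :: w)
          (e, (Fin.cons k ν : Fin (n + 1) → Fin 4)) = gamma k *
          evalWord (indexedVal val) w (e, (Fin.cons k ν : Fin (n + 1) → Fin 4)) := by
        intro w
        rw [← hg]; simp [evalWord]
      rw [show Fin.consEquiv (fun _ : Fin (n + 1) => Fin 4) (k, ν) = Fin.cons k ν from rfl,
        evalWord_append, hcons, evalWord_append, hcons, hk A hA, hk U hU, hk B hB,
        Fin.prod_univ_succ]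
      simp only [Fin.cons_zero, Fin.cons_succ]
      rw [mul_comm, mul_smul, mul_smul_comm, smul_mul_assoc]
      simp only [mul_assoc]
    rw [h2]
    refine wordSpan_map_le _ _ (fun w' hw' => ?_) h1
    have hw0 : Sum.inr 0 ∉ w' := by
      rw [List.Perm.mem_iff hw']
      simp [hA, hU, hB]
    have h3 : sumIndices E (Fin n) (evalWord val' w')
        = sumIndices E (Fin n) (evalWord (indexedVal val) (w'.filterMap dropZero)) := by
      congr 1
      ext1 e
      exact prod_dropZero _ _ _ _ hw0
    rw [h3]
    have h4 := ih (w'.filterMap dropZero) fun i => by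
      rw [occ_dropZero, occ_perm hw', ← hw i.succ]
      simp [occ_append, occ_cons, (Fin.succ_ne_zero i).symm]
    rw [filterMap_getLeft_dropZero] at h4
    have h5 : (w'.filterMap Sum.getLeft?).Perm
        ((A ++ Sum.inr 0 :: (U ++ Sum.inr 0 :: B)).filterMap Sum.getLeft?) := by
      refine (List.Perm.filterMap _ hw').trans ?_
      simp [List.filterMap_append, List.filterMap_cons]
    refine Submodule.span_mono (Set.image_mono fun x hx => ?_) h4
    exact List.Perm.trans hx h5

theorem sumIndices_mem {β : Type*} [Fintype β] [DecidableEq β] {val : E → α → Mat4}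
    (hval : ∀ e a, ∃ x, val e a = vec x) (w : List (α ⊕ β)) (hw : ∀ i, occ (Sum.inr i) w = 2) :
    sumIndices E β (evalWord (indexedVal val) w)
      ∈ wordSpan val {w' | w'.Perm (w.filterMap Sum.getLeft?)} := by
  let eb := Fintype.equivFin β
  let g : α ⊕ β → α ⊕ Fin (Fintype.card β) := Sum.map id eb
  have hg : Function.Injective g := Function.Injective.sumMap Function.injective_id eb.injective
  have h1 := sumIndices_fin_mem hval _ (w.map g) fun i => by
    have : (Sum.inr i : α ⊕ Fin (Fintype.card β)) = g (Sum.inr (eb.symm i)) := by simp [g]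
    rw [this, ← hw (eb.symm i), occ, occ, List.countP_map]
    congr 1
    ext1 y
    simp [hg.eq_iff]
  have h2 : sumIndices E (Fin (Fintype.card β)) (evalWord (indexedVal val) (w.map g))
      = sumIndices E β (evalWord (indexedVal val) w) := by
    ext1 e
    simp only [sumIndices, LinearMap.coe_mk, AddHom.coe_mk]
    rw [← Equiv.sum_comp (Equiv.arrowCongr eb (Equiv.refl (Fin 4)))]
    refine Finset.sum_congr rfl fun ν _ => ?_
    congr 1
    · rw [← eb.prod_comp]; simp
    · simp only [evalWord, List.map_map]
      congr 2
      ext1 x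
      rcases x with a | b <;> simp [g, indexedVal]
  have h3 : (w.map g).filterMap Sum.getLeft? = w.filterMap Sum.getLeft? := by
    rw [List.filterMap_map]
    congr 1
    ext1 x
    rcases x with a | b <;> rfl
  rwa [h2, h3] at h1

end Words

end QED

namespace QED

/-! ### Form factors of words between solutions of the Dirac equation -/

/-- The arguments of a normalized amplitude: the coefficients of the line momenta at the external
lepton momenta, the external lepton momenta divided by the mass, the index of the photon. -/
structure Env (N : ℕ) where
  θ : Fin N → ℝ × ℝ
  u₁ : Fin 4 → ℝ
  u₂ : Fin 4 → ℝ
  μ : Fin 4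

/-- The arguments of the form factors. -/
abbrev Param (N : ℕ) := (Fin N → ℝ × ℝ) × ℝ

namespace Env

variable {N : ℕ} (e : Env N)

/-- The arguments of the form factors at given momenta. -/
def param : Param N := (e.θ, mdot e.u₁ e.u₂)

/-- The normalized momentum of a line. -/
def lineMomentum (l : Fin N) : Fin 4 → ℝ := (e.θ l).1 • e.u₁ + (e.θ l).2 • e.u₂

/-- The letters: the photon vertex and the momenta of the lines. -/
def letterVal : Option (Fin N) → Mat4
  | none => gammaLow e.μ
  | some l => slash (e.lineMomentum l)

/-- The mass shell conditions and the Dirac equations for the external spinors. -/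
structure Dirac (ψ₁ ψ₂ : Fin 4 → ℂ) : Prop where
  sq_one : mdot e.u₁ e.u₁ = 1
  sq_two : mdot e.u₂ e.u₂ = 1
  mulVec_one : slash e.u₁ *ᵥ ψ₁ = ψ₁
  vecMul_two : ψ₂ ᵥ* slash e.u₂ = ψ₂

/-- The lower components of the normalized incoming momentum. -/
def low₁ : ℂ := ((metric e.μ * e.u₁ e.μ : ℝ) : ℂ)

/-- The lower components of the normalized outgoing momentum. -/
def low₂ : ℂ := ((metric e.μ * e.u₂ e.μ : ℝ) : ℂ)

end Env

variable {N : ℕ}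

theorem exists_eq_vec (e : Env N) (a : Option (Fin N)) : ∃ x, e.letterVal a = vec x := by
  cases a with
  | none => exact ⟨_, gammaLow_eq_vec _⟩
  | some l => exact ⟨_, slash_eq_vec _⟩

theorem contDiff_coeff_fst (l : Fin N) :
    ContDiff ℝ 1 (fun x : Param N => ((x.1 l).1 : ℂ)) := by
  have : ContDiff ℝ 1 (fun x : Param N => (x.1 l).1) := by fun_prop
  exact Complex.ofRealCLM.contDiff.comp this

theorem contDiff_coeff_snd (l : Fin N) :
    ContDiff ℝ 1 (fun x : Param N => ((x.1 l).2 : ℂ)) := by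
  have : ContDiff ℝ 1 (fun x : Param N => (x.1 l).2) := by fun_prop
  exact Complex.ofRealCLM.contDiff.comp this

theorem contDiff_cos : ContDiff ℝ 1 (fun x : Param N => (x.2 : ℂ)) := by
  have : ContDiff ℝ 1 (fun x : Param N => x.2) := by fun_prop
  exact Complex.ofRealCLM.contDiff.comp this

theorem slash_lineMomentum (e : Env N) (l : Fin N) :
    slash (e.lineMomentum l) = ((e.θ l).1 : ℂ) • slash e.u₁ + ((e.θ l).2 : ℂ) • slash e.u₂ := by
  rw [Env.lineMomentum, slash_add, slash_smul, slash_smul]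

/-- The span of `ψ₂` and `ψ₂ û₁` is stable under right multiplication by `û₁` and `û₂`, by `û₁² =
1`, `ψ₂ û₂ = ψ₂` and `û₁ û₂ = 2 u₁·u₂ - û₂ û₁`. The recursion for the two coefficients is polynomial
in the line coefficients and `u₁·u₂`. -/
theorem exists_left_form (L : List (Fin N)) :
    ∃ s t : Param N → ℂ, ContDiff ℝ 1 s ∧ ContDiff ℝ 1 t ∧ ∀ (e : Env N) (ψ₁ ψ₂ : Fin 4 → ℂ),
      e.Dirac ψ₁ ψ₂ → ψ₂ ᵥ* evalWord Env.letterVal (L.map some) e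
        = s e.param • ψ₂ + t e.param • (ψ₂ ᵥ* slash e.u₁) := by
  induction L using List.reverseRecOn with
  | nil =>
    exact ⟨fun _ => 1, fun _ => 0, contDiff_const, contDiff_const, fun e ψ₁ ψ₂ _ => by
      simp [evalWord]⟩
  | append_singleton L l ih =>
    obtain ⟨s, t, hs, ht, hst⟩ := ih
    have ha := contDiff_coeff_fst l
    have hb := contDiff_coeff_snd l
    have hc := contDiff_cos (N := N)
    refine ⟨fun x => t x * (x.1 l).1 + s x * (x.1 l).2 + 2 * x.2 * (t x * (x.1 l).2),
      fun x => s x * (x.1 l).1 - t x * (x.1 l).2, by fun_prop, by fun_prop,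
      fun e ψ₁ ψ₂ hψ => ?_⟩
    have h1 := hst e ψ₁ ψ₂ hψ
    have h2 : evalWord Env.letterVal ((L ++ [l]).map some) e
        = evalWord Env.letterVal (L.map some) e * slash (e.lineMomentum l) := by
      simp [evalWord, Env.letterVal]
    have h3 : (ψ₂ ᵥ* slash e.u₁) ᵥ* slash e.u₁ = ψ₂ := by
      rw [Matrix.vecMul_vecMul, slash_mul_self, hψ.sq_one]; simp
    have h4 : (ψ₂ ᵥ* slash e.u₁) ᵥ* slash e.u₂
        = (2 * (mdot e.u₁ e.u₂ : ℂ)) • ψ₂ - ψ₂ ᵥ* slash e.u₁ := by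
      rw [Matrix.vecMul_vecMul, slash_mul_slash, Matrix.vecMul_sub, ← Matrix.vecMul_vecMul,
        hψ.vecMul_two, Matrix.vecMul_smul, Matrix.vecMul_one]
    rw [h2, ← Matrix.vecMul_vecMul, h1, slash_lineMomentum]
    simp only [Matrix.vecMul_add, Matrix.add_vecMul, Matrix.vecMul_smul, Matrix.smul_vecMul, h3, h4,
      hψ.vecMul_two, Env.param]
    module

/-- The mirror image of `exists_left_form`, with the span of `ψ₁` and `û₂ ψ₁`. -/
theorem exists_right_form (R : List (Fin N)) :
    ∃ s t : Param N → ℂ, ContDiff ℝ 1 s ∧ ContDiff ℝ 1 t ∧ ∀ (e : Env N) (ψ₁ ψ₂ : Fin 4 → ℂ),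
      e.Dirac ψ₁ ψ₂ → evalWord Env.letterVal (R.map some) e *ᵥ ψ₁
        = s e.param • ψ₁ + t e.param • (slash e.u₂ *ᵥ ψ₁) := by
  induction R with
  | nil =>
    exact ⟨fun _ => 1, fun _ => 0, contDiff_const, contDiff_const, fun e ψ₁ ψ₂ _ => by
      simp [evalWord]⟩
  | cons l R ih =>
    obtain ⟨s, t, hs, ht, hst⟩ := ih
    have ha := contDiff_coeff_fst l
    have hb := contDiff_coeff_snd l
    have hc := contDiff_cos (N := N)
    refine ⟨fun x => (x.1 l).1 * s x + 2 * x.2 * ((x.1 l).1 * t x) + (x.1 l).2 * t x,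
      fun x => (x.1 l).2 * s x - (x.1 l).1 * t x, by fun_prop, by fun_prop,
      fun e ψ₁ ψ₂ hψ => ?_⟩
    have h1 := hst e ψ₁ ψ₂ hψ
    have h2 : evalWord Env.letterVal ((l :: R).map some) e
        = slash (e.lineMomentum l) * evalWord Env.letterVal (R.map some) e := by
      simp [evalWord, Env.letterVal]
    have h3 : slash e.u₂ *ᵥ (slash e.u₂ *ᵥ ψ₁) = ψ₁ := by
      rw [Matrix.mulVec_mulVec, slash_mul_self, hψ.sq_two]; simp
    have h4 : slash e.u₁ *ᵥ (slash e.u₂ *ᵥ ψ₁)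
        = (2 * (mdot e.u₁ e.u₂ : ℂ)) • ψ₁ - slash e.u₂ *ᵥ ψ₁ := by
      rw [Matrix.mulVec_mulVec, slash_mul_slash, Matrix.sub_mulVec, ← Matrix.mulVec_mulVec,
        hψ.mulVec_one, Matrix.smul_mulVec, Matrix.one_mulVec]
    rw [h2, ← Matrix.mulVec_mulVec, h1, slash_lineMomentum]
    simp only [Matrix.mulVec_add, Matrix.add_mulVec, Matrix.mulVec_smul, Matrix.smul_mulVec, h3, h4,
      hψ.mulVec_one, Env.param]
    module

/-- The functions `F`, `A`, `B` are smooth form factors of `f`. -/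
structure IsForm (f : Env N → Mat4) (F A B : Param N → ℂ) : Prop where
  contDiff_F : ContDiff ℝ 1 F
  contDiff_A : ContDiff ℝ 1 A
  contDiff_B : ContDiff ℝ 1 B
  eq : ∀ (e : Env N) (ψ₁ ψ₂ : Fin 4 → ℂ), e.Dirac ψ₁ ψ₂ →
    ψ₂ ⬝ᵥ (f e *ᵥ ψ₁) = F e.param * (ψ₂ ⬝ᵥ (gammaLow e.μ *ᵥ ψ₁))
      + (A e.param * e.low₁ + B e.param * e.low₂) * (ψ₂ ⬝ᵥ ψ₁)

variable (N) in
/-- The normalized amplitudes with smooth form factors. -/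
def formSubmodule : Submodule ℂ (Env N → Mat4) where
  carrier := {f | ∃ F A B, IsForm f F A B}
  add_mem' := by
    rintro f f' ⟨F, A, B, h⟩ ⟨F', A', B', h'⟩
    refine ⟨F + F', A + A', B + B', h.1.add h'.1, h.2.add h'.2, h.3.add h'.3, fun e ψ₁ ψ₂ hψ => ?_⟩
    rw [Pi.add_apply, Matrix.add_mulVec, dotProduct_add, h.4 e ψ₁ ψ₂ hψ, h'.4 e ψ₁ ψ₂ hψ]
    simp only [Pi.add_apply]
    ring
  zero_mem' := ⟨0, 0, 0, contDiff_const, contDiff_const, contDiff_const, by simp⟩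
  smul_mem' := by
    rintro c f ⟨F, A, B, h⟩
    refine ⟨c • F, c • A, c • B, contDiff_const.smul h.1, contDiff_const.smul h.2,
      contDiff_const.smul h.3, fun e ψ₁ ψ₂ hψ => ?_⟩
    rw [Pi.smul_apply, Matrix.smul_mulVec, dotProduct_smul, h.4 e ψ₁ ψ₂ hψ]
    simp only [Pi.smul_apply, smul_eq_mul]
    ring

namespace Env.Dirac

variable {e : Env N} {ψ₁ ψ₂ : Fin 4 → ℂ} (hψ : e.Dirac ψ₁ ψ₂)
include hψ

theorem slash_one_mul_gamma :
    ψ₂ ⬝ᵥ ((slash e.u₁ * gammaLow e.μ) *ᵥ ψ₁)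
      = 2 * e.low₁ * (ψ₂ ⬝ᵥ ψ₁) - ψ₂ ⬝ᵥ (gammaLow e.μ *ᵥ ψ₁) := by
  have h1 : slash e.u₁ * gammaLow e.μ = (2 * e.low₁) • (1 : Mat4) - gammaLow e.μ * slash e.u₁ := by
    rw [gammaLow_mul_slash, Env.low₁, sub_sub_cancel]
  rw [h1, Matrix.sub_mulVec, ← Matrix.mulVec_mulVec, hψ.mulVec_one, dotProduct_sub,
    Matrix.smul_mulVec, Matrix.one_mulVec, dotProduct_smul, smul_eq_mul]

theorem gamma_mul_slash_two :
    ψ₂ ⬝ᵥ ((gammaLow e.μ * slash e.u₂) *ᵥ ψ₁)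
      = 2 * e.low₂ * (ψ₂ ⬝ᵥ ψ₁) - ψ₂ ⬝ᵥ (gammaLow e.μ *ᵥ ψ₁) := by
  rw [gammaLow_mul_slash, Matrix.sub_mulVec, ← Matrix.mulVec_mulVec, dotProduct_sub,
    Matrix.dotProduct_mulVec ψ₂ (slash e.u₂), hψ.vecMul_two,
    Matrix.smul_mulVec, Matrix.one_mulVec, dotProduct_smul, smul_eq_mul, Env.low₂]

theorem slash_two : ψ₂ ⬝ᵥ (slash e.u₂ *ᵥ ψ₁) = ψ₂ ⬝ᵥ ψ₁ := by
  rw [Matrix.dotProduct_mulVec, hψ.vecMul_two]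

theorem slash_one_mul_gamma_mul_slash_two :
    ψ₂ ⬝ᵥ ((slash e.u₁ * gammaLow e.μ * slash e.u₂) *ᵥ ψ₁)
      = (2 * e.low₁ + 2 * e.low₂) * (ψ₂ ⬝ᵥ ψ₁)
        - (2 * (mdot e.u₁ e.u₂ : ℂ) + 1) * (ψ₂ ⬝ᵥ (gammaLow e.μ *ᵥ ψ₁)) := by
  have h1 : slash e.u₁ * gammaLow e.μ * slash e.u₂ = (2 * e.low₁) • slash e.u₂
      - (2 * (mdot e.u₁ e.u₂ : ℂ)) • gammaLow e.μ
      + (gammaLow e.μ * slash e.u₂) * slash e.u₁ := by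
    have h1 : slash e.u₁ * gammaLow e.μ
        = (2 * e.low₁) • (1 : Mat4) - gammaLow e.μ * slash e.u₁ := by
      rw [gammaLow_mul_slash, Env.low₁, sub_sub_cancel]
    rw [h1, sub_mul, mul_assoc, slash_mul_slash, mul_sub, smul_mul_assoc, one_mul, mul_smul_comm,
      mul_one, mul_assoc]
    abel
  rw [h1, Matrix.add_mulVec, Matrix.sub_mulVec, ← Matrix.mulVec_mulVec ψ₁ _ (slash e.u₁),
    hψ.mulVec_one, dotProduct_add, dotProduct_sub, Matrix.smul_mulVec, Matrix.smul_mulVec,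
    dotProduct_smul, dotProduct_smul, hψ.slash_two, hψ.gamma_mul_slash_two]
  simp only [smul_eq_mul]
  ring

end Env.Dirac

/-- The word is cut at its only `γ_μ`. The left and right forms leave `γ_μ` with at most one `û₁`
before it and one `û₂` after it, and the lemmas of `Env.Dirac` reduce these products. -/
theorem evalWord_mem_formSubmodule (w : List (Option (Fin N))) (hw : occ none w = 1) :
    evalWord Env.letterVal w ∈ formSubmodule N := by
  have key : ∀ w : List (Option (Fin N)), none ∉ w → ∃ L : List (Fin N), w = L.map some := by
    intro w hw
    induction w with
    | nil => exact ⟨[], rfl⟩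
    | cons x w ih =>
      obtain ⟨L, rfl⟩ := ih fun h => hw (List.mem_cons_of_mem _ h)
      cases x with
      | none => exact absurd List.mem_cons_self hw
      | some l => exact ⟨l :: L, rfl⟩
  obtain ⟨L, R, rfl, hL⟩ := List.eq_append_cons_of_mem (mem_of_occ_pos (by rw [hw]; norm_num))
  have hR : none ∉ R := by
    rw [occ_append, occ_cons, occ_eq_zero.2 hL, if_pos rfl] at hw
    exact occ_eq_zero.1 (by omega)
  obtain ⟨L, rfl⟩ := key L hL
  obtain ⟨R, rfl⟩ := key R hR
  obtain ⟨s, t, hs, ht, hst⟩ := exists_left_form L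
  obtain ⟨s', t', hs', ht', hst'⟩ := exists_right_form R
  have hc := contDiff_cos (N := N)
  refine ⟨fun x => s x * s' x - t x * s' x - s x * t' x - (2 * x.2 + 1) * (t x * t' x),
    fun x => 2 * (t x * s' x) + 2 * (t x * t' x), fun x => 2 * (s x * t' x) + 2 * (t x * t' x),
    by fun_prop, by fun_prop, by fun_prop, fun e ψ₁ ψ₂ hψ => ?_⟩
  have h1 : evalWord Env.letterVal (L.map some ++ none :: R.map some) e
      = evalWord Env.letterVal (L.map some) e *
        (gammaLow e.μ * evalWord Env.letterVal (R.map some) e) := by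
    simp [evalWord, Env.letterVal]
  rw [h1, ← Matrix.mulVec_mulVec, Matrix.dotProduct_mulVec, hst e ψ₁ ψ₂ hψ,
    ← Matrix.mulVec_mulVec, hst' e ψ₁ ψ₂ hψ]
  have e1 := hψ.slash_one_mul_gamma
  have e2 := hψ.gamma_mul_slash_two
  have e3 := hψ.slash_one_mul_gamma_mul_slash_two
  rw [← Matrix.mulVec_mulVec, Matrix.dotProduct_mulVec] at e1
  rw [← Matrix.mulVec_mulVec] at e2
  rw [mul_assoc, ← Matrix.mulVec_mulVec, ← Matrix.mulVec_mulVec, Matrix.dotProduct_mulVec] at e3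
  simp only [Matrix.mulVec_add, Matrix.mulVec_smul, dotProduct_add, add_dotProduct,
    dotProduct_smul, smul_dotProduct, e1, e2, e3, smul_eq_mul, Env.param]
  ring

/-! ### From form factors to the projector -/

theorem sum_sigmaLow (μ : Fin 4) (q : Fin 4 → ℝ) :
    ∑ ν, ((q ν : ℝ) : ℂ) • sigmaLow μ ν
      = (1 / 2 : ℂ) • (gammaLow μ * slash q - slash q * gammaLow μ) := by
  simp only [sigmaLow, slash, Finset.mul_sum, Finset.sum_mul, ← Finset.sum_sub_distrib,
    Finset.smul_sum]
  refine Finset.sum_congr rfl fun ν _ => ?_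
  rw [mul_smul_comm, smul_mul_assoc, ← smul_sub, smul_comm]

/-- The arguments of a normalized amplitude for given momenta. -/
def mkEnv (θ : Fin N → ℝ × ℝ) (m : ℝ) (p q : Fin 4 → ℝ) (μ : Fin 4) : Env N where
  θ := θ
  u₁ := m⁻¹ • (p - (1 / 2 : ℝ) • q)
  u₂ := m⁻¹ • (p + (1 / 2 : ℝ) • q)
  μ := μ

theorem mdot_smul_smul (c : ℝ) (a b : Fin 4 → ℝ) : mdot (c • a) (c • b) = c ^ 2 * mdot a b := by
  simp only [mdot, Finset.mul_sum, Pi.smul_apply, smul_eq_mul]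
  exact Finset.sum_congr rfl fun _ _ => by ring

theorem mdot_mkEnv (θ : Fin N → ℝ × ℝ) {m : ℝ} (hm : 0 < m) {p q : Fin 4 → ℝ}
    (hpq : OnShell m p q) (μ : Fin 4) :
    mdot (mkEnv θ m p q μ).u₁ (mkEnv θ m p q μ).u₂ = 1 - mdot q q / (2 * m ^ 2) := by
  have h1 : mdot (p - (1 / 2 : ℝ) • q) (p + (1 / 2 : ℝ) • q)
      = (mdot (p - (1 / 2 : ℝ) • q) (p - (1 / 2 : ℝ) • q)
        + mdot (p + (1 / 2 : ℝ) • q) (p + (1 / 2 : ℝ) • q)) / 2 - mdot q q / 2 := by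
    simp only [mdot, Fin.sum_univ_four, Pi.sub_apply, Pi.add_apply, Pi.smul_apply, smul_eq_mul]
    ring
  simp only [mkEnv, mdot_smul_smul]
  rw [h1, hpq.1, hpq.2]
  field_simp
  ring

theorem dirac_mkEnv (θ : Fin N → ℝ × ℝ) {m : ℝ} (hm : 0 < m) {p q : Fin 4 → ℝ}
    (hpq : OnShell m p q) (μ : Fin 4) {ψ₁ ψ₂ : Fin 4 → ℂ}
    (h₁ : (slash (p - (1 / 2 : ℝ) • q) - (m : ℂ) • (1 : Mat4)) *ᵥ ψ₁ = 0)
    (h₂ : ψ₂ ᵥ* (slash (p + (1 / 2 : ℝ) • q) - (m : ℂ) • (1 : Mat4)) = 0) :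
    (mkEnv θ m p q μ).Dirac ψ₁ ψ₂ := by
  have hm' : (m : ℂ) ≠ 0 := by exact_mod_cast hm.ne'
  constructor
  · simp only [mkEnv, mdot_smul_smul]
    rw [hpq.1]
    field_simp
  · simp only [mkEnv, mdot_smul_smul]
    rw [hpq.2]
    field_simp
  · rw [Matrix.sub_mulVec, Matrix.smul_mulVec, Matrix.one_mulVec, sub_eq_zero] at h₁
    simp only [mkEnv, slash_smul, Matrix.smul_mulVec, h₁, smul_smul]
    rw [Complex.ofReal_inv, inv_mul_cancel₀ hm', one_smul]
  · rw [Matrix.vecMul_sub, Matrix.vecMul_smul, Matrix.vecMul_one, sub_eq_zero] at h₂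
    simp only [mkEnv, slash_smul, Matrix.vecMul_smul, h₂, smul_smul]
    rw [Complex.ofReal_inv, inv_mul_cancel₀ hm', one_smul]

/-- The Gordon identity. -/
theorem gordon (θ : Fin N → ℝ × ℝ) {m : ℝ} (hm : 0 < m) {p q : Fin 4 → ℝ} {μ : Fin 4}
    {ψ₁ ψ₂ : Fin 4 → ℂ} (hψ : (mkEnv θ m p q μ).Dirac ψ₁ ψ₂) :
    ψ₂ ⬝ᵥ ((∑ ν, ((q ν : ℝ) : ℂ) • sigmaLow μ ν) *ᵥ ψ₁)
      = m * (((mkEnv θ m p q μ).low₁ + (mkEnv θ m p q μ).low₂) * (ψ₂ ⬝ᵥ ψ₁)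
        - 2 * (ψ₂ ⬝ᵥ (gammaLow μ *ᵥ ψ₁))) := by
  have hm' : m ≠ 0 := hm.ne'
  set e := mkEnv θ m p q μ with he
  have hq : slash q = (m : ℂ) • (slash e.u₂ - slash e.u₁) := by
    have : q = m • (e.u₂ + (-1 : ℝ) • e.u₁) := by
      ext ν
      simp only [he, mkEnv, Pi.add_apply, Pi.smul_apply, Pi.sub_apply, smul_eq_mul]
      field_simp
      ring
    conv_lhs => rw [this]
    rw [slash_smul, slash_add, slash_smul]
    push_cast
    rw [neg_one_smul, sub_eq_add_neg]
  have e1 := hψ.slash_one_mul_gamma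
  have e2 := hψ.gamma_mul_slash_two
  have e3 : ψ₂ ⬝ᵥ ((gammaLow μ * slash e.u₁) *ᵥ ψ₁) = ψ₂ ⬝ᵥ (gammaLow μ *ᵥ ψ₁) := by
    rw [← Matrix.mulVec_mulVec, hψ.mulVec_one]
  have e4 : ψ₂ ⬝ᵥ ((slash e.u₂ * gammaLow μ) *ᵥ ψ₁) = ψ₂ ⬝ᵥ (gammaLow μ *ᵥ ψ₁) := by
    rw [← Matrix.mulVec_mulVec, Matrix.dotProduct_mulVec, hψ.vecMul_two]
  have hμ : e.μ = μ := rfl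
  rw [hμ] at e1 e2
  rw [sum_sigmaLow, hq]
  simp only [mul_smul_comm, smul_mul_assoc, mul_sub, sub_mul, Matrix.smul_mulVec,
    Matrix.sub_mulVec, dotProduct_smul, dotProduct_sub, e1, e2, e3, e4, smul_eq_mul]
  ring

theorem low_sub (θ : Fin N → ℝ × ℝ) {m : ℝ} (hm : 0 < m) (p q : Fin 4 → ℝ) (μ : Fin 4) :
    m * ((mkEnv θ m p q μ).low₂ - (mkEnv θ m p q μ).low₁) = ((metric μ * q μ : ℝ) : ℂ) := by
  rw [Env.low₁, Env.low₂, ← Complex.ofReal_sub, ← Complex.ofReal_mul]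
  congr 1
  simp only [mkEnv, Pi.add_apply, Pi.smul_apply, Pi.sub_apply, smul_eq_mul]
  field_simp
  ring

/-- The decomposition with `p₁`, `p₂` rewritten as the one with `γ_μ`, `σ_{μν} q^ν`, `q_μ`. -/
theorem form_eq (θ : Fin N → ℝ × ℝ) {m : ℝ} (hm : 0 < m) {p q : Fin 4 → ℝ} {μ : Fin 4}
    {ψ₁ ψ₂ : Fin 4 → ℂ} (hψ : (mkEnv θ m p q μ).Dirac ψ₁ ψ₂) (F A B : ℂ) :
    F * (ψ₂ ⬝ᵥ (gammaLow μ *ᵥ ψ₁))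
      + (A * (mkEnv θ m p q μ).low₁ + B * (mkEnv θ m p q μ).low₂) * (ψ₂ ⬝ᵥ ψ₁)
    = ψ₂ ⬝ᵥ (((F + A + B) • gammaLow μ
          - (-(A + B) / (2 * (m : ℂ))) • ∑ ν, ((q ν : ℝ) : ℂ) • sigmaLow μ ν
          + ((B - A) / (2 * m) * ((metric μ * q μ : ℝ) : ℂ)) • (1 : Mat4)) *ᵥ ψ₁) := by
  have hm' : (m : ℂ) ≠ 0 := by exact_mod_cast hm.ne'
  rw [Matrix.add_mulVec, Matrix.sub_mulVec, dotProduct_add, dotProduct_sub, Matrix.smul_mulVec,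
    Matrix.smul_mulVec, Matrix.smul_mulVec, dotProduct_smul, dotProduct_smul, dotProduct_smul,
    gordon θ hm hψ, ← low_sub θ hm, Matrix.one_mulVec]
  simp only [smul_eq_mul]
  field_simp
  ring

/-- The Gordon identity trades the `p₁ + p₂` part for `γ_μ` and `σ_{μν} q^ν`, whence `g = -(A + B)`
up to the factor `c`. On shell `u₁·u₂ = 1 - q²/(2m²)`, so the limit is taken at `u₁·u₂ = 1`. -/
theorem IsForm.isAMM {f : Env N → Mat4} {F A B : Param N → ℂ} (hf : IsForm f F A B)
    (θ : Fin N → ℝ × ℝ) {m : ℝ} (hm : 0 < m) (c : ℂ) {Γ : Amplitude}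
    (hΓ : ∀ p q μ, Γ p q μ = c • f (mkEnv θ m p q μ)) :
    IsAMM m Γ (c * -(A (θ, 1) + B (θ, 1))) := by
  let x : ℝ → Param N := fun t => (θ, 1 - t / (2 * m ^ 2))
  refine ⟨fun t => c * (F (x t) + A (x t) + B (x t)), fun t => c * -(A (x t) + B (x t)),
    fun t => c * ((B (x t) - A (x t)) / (2 * m)), ?_, ?_⟩
  · intro p q hpq ψ₁ ψ₂ h₁ h₂ μ
    have hψ := dirac_mkEnv θ hm hpq μ h₁ h₂
    have h1 := hf.eq _ _ _ hψ
    have h2 : (mkEnv θ m p q μ).param = x (mdot q q) := by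
      simp only [Env.param, x, mdot_mkEnv θ hm hpq]
      rfl
    rw [h2, show (mkEnv θ m p q μ).μ = μ from rfl, form_eq θ hm hψ] at h1
    rw [hΓ, Matrix.smul_mulVec, dotProduct_smul, h1, ← dotProduct_smul, ← Matrix.smul_mulVec]
    congr 2
    rw [smul_add, smul_sub, smul_smul, smul_smul, smul_smul]
    congr 2
    · congr 1
      ring
    · ring
  · have hx : Continuous x := by fun_prop
    have hA := hf.contDiff_A.continuous
    have hB := hf.contDiff_B.continuous
    have hcont : Continuous fun t => c * -(A (x t) + B (x t)) := by fun_prop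
    have h0 : x 0 = (θ, 1) := by simp [x]
    have := hcont.tendsto 0
    rw [h0] at this
    exact this.mono_left nhdsWithin_le_nhds

/-! ### Uniqueness -/

/-- Real momenta and spinors that determine the form factor `g`. -/
theorem exists_kinematics {m Q : ℝ} (hm : 0 < m) (hQ : 0 < Q) :
    ∃ p q : Fin 4 → ℝ, OnShell m p q ∧ mdot q q = -Q ^ 2 ∧ ∀ f g k : ℂ,
      (∀ ψ₁ ψ₂ : Fin 4 → ℂ,
        (slash (p - (1 / 2 : ℝ) • q) - (m : ℂ) • (1 : Mat4)) *ᵥ ψ₁ = 0 →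
        ψ₂ ᵥ* (slash (p + (1 / 2 : ℝ) • q) - (m : ℂ) • (1 : Mat4)) = 0 →
        ∀ μ, ψ₂ ⬝ᵥ ((f • gammaLow μ - (g / (2 * (m : ℂ))) • ∑ ν, ((q ν : ℝ) : ℂ) • sigmaLow μ ν
          + (k * ((metric μ * q μ : ℝ) : ℂ)) • (1 : Mat4)) *ᵥ ψ₁) = 0) → g = 0 := by
  obtain ⟨E, hE, hE2⟩ : ∃ E : ℝ, 0 < E ∧ E ^ 2 = m ^ 2 + Q ^ 2 / 4 :=
    ⟨√(m ^ 2 + Q ^ 2 / 4), Real.sqrt_pos.2 (by positivity), Real.sq_sqrt (by positivity)⟩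
  have hE2' : (E : ℂ) ^ 2 = m ^ 2 + Q ^ 2 / 4 := by exact_mod_cast hE2
  -- The Breit frame: the lepton momenta are `(E, 0, 0, ∓Q/2)`.
  refine ⟨![E, 0, 0, 0], ![0, 0, 0, Q], ⟨?_, ?_⟩, ?_, fun f g k hfg => ?_⟩
  · simp [mdot, Fin.sum_univ_four, metric]; linarith
  · simp [mdot, Fin.sum_univ_four, metric]; linarith
  · simp [mdot, Fin.sum_univ_four, metric]; ring
  -- Plane wave spinors with spin along the third axis: `μ = 0` without spin flip and `μ = 1` with
  -- spin flip. Both components of `q` vanish, which removes `k`.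
  have hup := hfg ![E + m, 0, -Q / 2, 0] ![E + m, 0, -Q / 2, 0] ?_ ?_ 0
  have hdown := hfg ![0, E + m, 0, Q / 2] ![E + m, 0, -Q / 2, 0] ?_ ?_ 1
  · have hm' : (m : ℂ) ≠ 0 := by exact_mod_cast hm.ne'
    simp only [sum_sigmaLow] at hup hdown
    simp [slash, gammaLow, gamma, metric, Fin.sum_univ_four, Matrix.mulVec,
        dotProduct] at hup hdown
    have hQ' : (Q : ℂ) ≠ 0 := by exact_mod_cast hQ.ne'
    have hEm : (E : ℂ) + m ≠ 0 := by exact_mod_cast (by positivity : E + m ≠ 0)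
    have hD : (4 * m ^ 2 + Q ^ 2 : ℂ) ≠ 0 := by
      exact_mod_cast (by positivity : 4 * m ^ 2 + Q ^ 2 ≠ 0)
    -- With `g = 2ma` the two amplitudes give `2mf = aQ²` and `f = -2ma`, hence `(4m² + Q²) a = 0`.
    obtain ⟨a, rfl⟩ : ∃ a, g = a * (2 * m) := ⟨g / (2 * m), by field_simp⟩
    rw [mul_div_cancel_right₀ _ (mul_ne_zero two_ne_zero hm')] at hup hdown
    have h1 : (E + m : ℂ) * (2 * m * f - a * Q ^ 2) = 0 := by
      linear_combination hup - f * hE2'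
    have h2 : ((E + m : ℂ) * Q) * (2 * m * a + f) = 0 := by
      linear_combination -hdown - a * Q * hE2'
    have h3 := (mul_eq_zero.1 h1).resolve_left hEm
    have h4 := (mul_eq_zero.1 h2).resolve_left (mul_ne_zero hEm hQ')
    have h5 : (4 * m ^ 2 + Q ^ 2 : ℂ) * a = 0 := by linear_combination 2 * m * h4 - h3
    rw [(mul_eq_zero.1 h5).resolve_left hD, zero_mul]
  all_goals
    ext i
    fin_cases i <;>
      simp [slash, gammaLow, gamma, metric, Fin.sum_univ_four, Matrix.mulVec, Matrix.vecMul,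
        dotProduct, Matrix.one_apply] <;> first | ring1 | linear_combination hE2'

theorem HasFormFactors.unique {m : ℝ} (hm : 0 < m) {Γ : Amplitude} {f g k f' g' k' : ℝ → ℂ}
    (h₁ : HasFormFactors m Γ f g k) (h₂ : HasFormFactors m Γ f' g' k') {t : ℝ} (ht : t < 0) :
    g t = g' t := by
  obtain ⟨p, q, hpq, hq, huniq⟩ := exists_kinematics hm (Real.sqrt_pos.2 (neg_pos.2 ht))
  rw [Real.sq_sqrt (neg_pos.2 ht).le, neg_neg] at hq
  rw [← sub_eq_zero]
  refine huniq (f t - f' t) _ (k t - k' t) fun ψ₁ ψ₂ e₁ e₂ μ => ?_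
  have a1 := h₁ p q hpq ψ₁ ψ₂ e₁ e₂ μ
  rw [h₂ p q hpq ψ₁ ψ₂ e₁ e₂ μ, hq, eq_comm, ← sub_eq_zero, ← dotProduct_sub,
    ← Matrix.sub_mulVec] at a1
  rw [← a1]
  congr 2
  rw [sub_div]
  module

theorem IsAMM.unique {m : ℝ} (hm : 0 < m) {Γ : Amplitude} {a b : ℂ}
    (ha : IsAMM m Γ a) (hb : IsAMM m Γ b) : a = b := by
  obtain ⟨f, g, k, hf, hg⟩ := ha
  obtain ⟨f', g', k', hf', hg'⟩ := hb
  refine tendsto_nhds_unique (hg.congr' ?_) hg'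
  filter_upwards [self_mem_nhdsWithin] with t ht
  exact hf.unique hm hf' ht

theorem amm_eq {m : ℝ} (hm : 0 < m) {Γ : Amplitude} {a : ℂ} (ha : IsAMM m Γ a) :
    amm m Γ = a := by
  have h1 : ∃ a, IsAMM m Γ a := ⟨a, ha⟩
  rw [amm, dif_pos h1]
  exact h1.choose_spec.unique hm ha

end QED

namespace QED.VertexGraph

variable {h : ℕ} (G : VertexGraph h)

/-! ### Numerators as combinations of words -/

/-- The multiplier of a lepton line, divided by the mass if the line is not paired. -/
def normLineFactor (P : Finset (Fin (2 * h) × Fin (2 * h))) (e : Env (2 * h))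
    (ρ : {a // a ∈ P} → Fin 4) (l : Fin (2 * h)) : Mat4 :=
  if ∃ a ∈ P, l = a.1 ∨ l = a.2 then
    ∑ a : {a // a ∈ P}, if l = a.1.1 ∨ l = a.1.2 then gamma (ρ a) else 0
  else 1 + slash (e.lineMomentum l)

/-- The matrix product along the lepton path. -/
def pathProduct (P : Finset (Fin (2 * h) × Fin (2 * h))) (e : Env (2 * h))
    (ν : Fin h → Fin 4) (ρ : {a // a ∈ P} → Fin 4) : Mat4 :=
  (List.ofFn (fun l : Fin (2 * h) =>
    G.vertexFactor e.μ ν l.succ * normLineFactor P e ρ l)).reverse.prod * G.vertexFactor e.μ ν 0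

/-- The matrix part of the term of `P`, divided by a power of the mass. -/
def normNumerator (P : Finset (Fin (2 * h) × Fin (2 * h))) (e : Env (2 * h)) : Mat4 :=
  ∑ ν : Fin h → Fin 4, ∑ ρ : {a // a ∈ P} → Fin 4,
    (((∏ i, metric (ν i)) * ∏ a, metric (ρ a) : ℝ) : ℂ) • G.pathProduct P e ν ρ

theorem prod_reverse_ofFn_smul {n : ℕ} (c : Fin n → ℂ) (A : Fin n → Mat4) :
    (List.ofFn (fun l => c l • A l)).reverse.prod = (∏ l, c l) • (List.ofFn A).reverse.prod := by
  induction n with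
  | zero => simp
  | succ n ih =>
    have := ih (fun l => c l.succ) (fun l => A l.succ)
    simp only [List.ofFn_succ, List.reverse_cons, List.prod_append, List.prod_singleton, this,
      Fin.prod_univ_succ, smul_mul_assoc, mul_smul_comm, smul_smul]

/-- The lepton lines that belong to the pairs. -/
def pairedLines (P : Finset (Fin (2 * h) × Fin (2 * h))) : Finset (Fin (2 * h)) :=
  Finset.univ.filter (fun l => ∃ a ∈ P, l = a.1 ∨ l = a.2)

theorem card_pairedLines {P : Finset (Fin (2 * h) × Fin (2 * h))} (hP : IsPairing P) :
    (pairedLines P).card = 2 * P.card := by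
  have h1 : pairedLines P = P.biUnion (fun a => {a.1, a.2}) := by
    ext l
    simp [pairedLines]
  rw [h1, Finset.card_biUnion]
  · rw [Finset.sum_congr rfl fun a ha => Finset.card_pair (hP.1 a ha).ne]
    simp [mul_comm]
  · intro a ha b hb hab
    have := hP.2 a ha b hb hab
    rw [Function.onFun, Finset.disjoint_left]
    intro x hx hx'
    simp only [Finset.mem_insert, Finset.mem_singleton] at hx hx'
    rcases hx with rfl | rfl <;> rcases hx' with h1 | h1 <;> simp_all

theorem card_le_of_isPairing {P : Finset (Fin (2 * h) × Fin (2 * h))} (hP : IsPairing P) :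
    P.card ≤ h := by
  have h1 := card_pairedLines hP
  have h2 := Finset.card_le_univ (pairedLines P)
  rw [Fintype.card_fin] at h2
  omega

/-- Each unpaired lepton line gives one factor `m` once the external momenta are divided by `m`.
This power later cancels the one coming from `W`. -/
theorem numerator_eq {P : Finset (Fin (2 * h) × Fin (2 * h))} (hP : IsPairing P) {m : ℝ}
    (hm : 0 < m) (z : Line h → ℝ) (p q : Fin 4 → ℝ) (μ : Fin 4) :
    G.numerator m z P p q μ = ((m : ℂ) ^ (2 * h - 2 * P.card)) •
      G.normNumerator P (mkEnv (G.coeff z) m p q μ) := by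
  have hm' : (m : ℂ) ≠ 0 := by exact_mod_cast hm.ne'
  have h1 : ∀ (ρ : {a // a ∈ P} → Fin 4) (l : Fin (2 * h)), G.lineFactor m z P ρ p q l
      = (if l ∈ pairedLines P then (1 : ℂ) else m) •
        normLineFactor P (mkEnv (G.coeff z) m p q μ) ρ l := by
    intro ρ l
    unfold lineFactor normLineFactor
    by_cases hl : ∃ a ∈ P, l = a.1 ∨ l = a.2
    · have hl' : l ∈ pairedLines P := by simpa [pairedLines] using hl
      rw [if_pos hl, if_pos hl, if_pos hl', one_smul]
    · have hl' : l ∉ pairedLines P := by simpa [pairedLines] using hl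
      have e1 : slash (mkEnv (G.coeff z) m p q μ).u₁
          = (m : ℂ)⁻¹ • slash (p - (1 / 2 : ℝ) • q) := by
        rw [mkEnv, slash_smul, Complex.ofReal_inv]
      have e2 : slash (mkEnv (G.coeff z) m p q μ).u₂
          = (m : ℂ)⁻¹ • slash (p + (1 / 2 : ℝ) • q) := by
        rw [mkEnv, slash_smul, Complex.ofReal_inv]
      rw [if_neg hl, if_neg hl, if_neg hl', inv_D_smul_Q, slash_lineMomentum, slash_add, slash_smul,
        slash_smul, e1, e2, smul_add, smul_add, smul_comm (m : ℂ) (((mkEnv _ _ _ _ _).θ l).1 : ℂ),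
        smul_comm (m : ℂ) (((mkEnv _ _ _ _ _).θ l).2 : ℂ), smul_inv_smul₀ hm', smul_inv_smul₀ hm']
      rfl
  have h2 : ∏ l : Fin (2 * h), (if l ∈ pairedLines P then (1 : ℂ) else m)
      = (m : ℂ) ^ (2 * h - 2 * P.card) := by
    rw [Finset.prod_ite]
    simp only [Finset.prod_const_one, one_mul, Finset.prod_const]
    congr 1
    rw [Finset.filter_not, Finset.card_sdiff_of_subset (Finset.filter_subset _ _)]
    simp [card_pairedLines hP]
  unfold numerator normNumerator pathProduct
  simp only [h1, mul_smul_comm, prod_reverse_ofFn_smul, h2, smul_mul_assoc, Finset.smul_sum]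
  refine Finset.sum_congr rfl fun ν _ => Finset.sum_congr rfl fun ρ _ => ?_
  rw [smul_comm]
  rfl

/-- The indices of a term: photon lines and pairs. -/
abbrev Index (h : ℕ) (P : Finset (Fin (2 * h) × Fin (2 * h))) := Fin h ⊕ {a // a ∈ P}

/-- Letters of the words of a term. -/
abbrev Letter (h : ℕ) (P : Finset (Fin (2 * h) × Fin (2 * h))) :=
  Option (Fin (2 * h)) ⊕ Index h P

/-- The letter of a vertex. -/
def vertexLetter (P : Finset (Fin (2 * h) × Fin (2 * h))) (v : Fin (2 * h + 1)) : Letter h P :=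
  if hv : v ≠ G.ext then Sum.inr (Sum.inl (G.existsUnique_photon v hv).choose) else Sum.inl none

theorem vertexLetter_eq_photon_iff (P : Finset (Fin (2 * h) × Fin (2 * h)))
    (v : Fin (2 * h + 1)) (i : Fin h) :
    G.vertexLetter P v = Sum.inr (Sum.inl i) ↔ v = G.fst i ∨ v = G.snd i := by
  unfold vertexLetter
  split_ifs with hv
  · have h1 := (G.existsUnique_photon v hv).choose_spec
    simp only [Sum.inr.injEq, Sum.inl.injEq]
    constructor
    · rintro rfl; exact h1.1
    · exact fun h2 => (h1.2 i h2).symm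
  · simp only [false_iff]
    push Not at hv
    rw [hv]
    rintro (h1 | h1)
    · exact G.fst_ne_ext i h1.symm
    · exact G.snd_ne_ext i h1.symm

theorem vertexLetter_eq_none_iff (P : Finset (Fin (2 * h) × Fin (2 * h))) (v : Fin (2 * h + 1)) :
    G.vertexLetter P v = Sum.inl none ↔ v = G.ext := by
  unfold vertexLetter
  split_ifs with hv
  · simpa using hv
  · simpa using hv

theorem vertexLetter_ne_pair (P : Finset (Fin (2 * h) × Fin (2 * h))) (v : Fin (2 * h + 1))
    (a : {a // a ∈ P}) : G.vertexLetter P v ≠ Sum.inr (Sum.inr a) := by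
  unfold vertexLetter
  split_ifs <;> simp

theorem vertexFactor_of_ne {v : Fin (2 * h + 1)} {i : Fin h} (hi : v = G.fst i ∨ v = G.snd i)
    (μ : Fin 4) (ν : Fin h → Fin 4) : G.vertexFactor μ ν v = gamma (ν i) := by
  have hv : v ≠ G.ext := by
    rintro rfl
    rcases hi with h1 | h1
    · exact G.fst_ne_ext i h1.symm
    · exact G.snd_ne_ext i h1.symm
  rw [vertexFactor, if_neg hv, Finset.sum_eq_single i, if_pos hi]
  · intro k _ hk
    exact if_neg fun h1 => hk ((G.existsUnique_photon v hv).unique h1 hi)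
  · simp

theorem vertexFactor_eq (P : Finset (Fin (2 * h) × Fin (2 * h))) (e : Env (2 * h))
    (ν : Index h P → Fin 4) (v : Fin (2 * h + 1)) :
    G.vertexFactor e.μ (ν ∘ Sum.inl) v = indexedVal Env.letterVal (e, ν) (G.vertexLetter P v) := by
  by_cases hv : v = G.ext
  · rw [(G.vertexLetter_eq_none_iff P v).2 hv, vertexFactor, if_pos hv]
    rfl
  · obtain ⟨i, hi, _⟩ := G.existsUnique_photon v hv
    rw [(G.vertexLetter_eq_photon_iff P v i).2 hi, vertexFactor_of_ne G hi]
    rfl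

/-- The letters of paired lines. -/
def lineLetters (P : Finset (Fin (2 * h) × Fin (2 * h))) (l : Fin (2 * h)) : List (Letter h P) :=
  if hl : ∃ a : {a // a ∈ P}, l = a.1.1 ∨ l = a.1.2 then [Sum.inr (Sum.inr hl.choose)] else []

theorem occ_lineLetters_pair {P : Finset (Fin (2 * h) × Fin (2 * h))} (hP : IsPairing P)
    (l : Fin (2 * h)) (a : {a // a ∈ P}) :
    occ (Sum.inr (Sum.inr a)) (lineLetters P l) = if l = a.1.1 ∨ l = a.1.2 then 1 else 0 := by
  unfold lineLetters
  split_ifs with h1 h2 h2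
  · have : h1.choose = a := by
      by_contra hne
      have h3 := hP.2 _ h1.choose.2 _ a.2 (fun h => hne (Subtype.ext h))
      have h4 := h1.choose_spec
      generalize h1.choose = b at *
      rcases h2 with rfl | rfl <;> rcases h4 with h5 | h5 <;> simp_all
    simp [this, occ]
  · have : h1.choose ≠ a := fun h3 => h2 (h3 ▸ h1.choose_spec)
    simp [this, occ]
  · exact absurd ⟨a, h2⟩ h1
  · simp [occ]

theorem occ_lineLetters_of_ne (P : Finset (Fin (2 * h) × Fin (2 * h)))
    (l : Fin (2 * h)) {x : Letter h P} (hx : ∀ a, x ≠ Sum.inr (Sum.inr a)) :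
    occ x (lineLetters P l) = 0 := by
  unfold lineLetters
  split_ifs with h1
  · simp [(hx _).symm, occ]
  · simp [occ]

theorem normLineFactor_of_mem {P : Finset (Fin (2 * h) × Fin (2 * h))} (hP : IsPairing P)
    (e : Env (2 * h)) (ν : Index h P → Fin 4) {l : Fin (2 * h)}
    (hl : ∃ a : {a // a ∈ P}, l = a.1.1 ∨ l = a.1.2) :
    normLineFactor P e (ν ∘ Sum.inr) l
      = evalWord (indexedVal Env.letterVal) (lineLetters P l) (e, ν) := by
  have hl' : ∃ a ∈ P, l = a.1 ∨ l = a.2 := by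
    obtain ⟨a, ha⟩ := hl
    exact ⟨a.1, a.2, ha⟩
  rw [normLineFactor, if_pos hl', Finset.sum_eq_single hl.choose, if_pos hl.choose_spec,
    lineLetters, dif_pos hl]
  · simp [evalWord, indexedVal]
  · intro a _ ha
    refine if_neg fun h1 => ha ?_
    by_contra hne
    have h3 := hP.2 _ hl.choose.2 _ a.2 (fun h => hne (Subtype.ext h.symm))
    have h4 := hl.choose_spec
    generalize hl.choose = b at *
    rcases h1 with rfl | rfl <;> rcases h4 with h5 | h5 <;> simp_all
  · simp

/-- Words whose letters, except line momenta, are as in the part of the path with lines `ls`. -/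
def pathWords (P : Finset (Fin (2 * h) × Fin (2 * h))) (ls : List (Fin (2 * h))) :
    Set (List (Letter h P)) :=
  {w | ∀ x : Letter h P, (∀ l, x ≠ Sum.inl (some l)) → occ x w
    = (ls.map fun l => occ x (G.vertexLetter P l.succ :: lineLetters P l)).sum
      + occ x [G.vertexLetter P 0]}

/-- The factor `1 + slash` of an unpaired line doubles the words, with and without the momentum of
the line; this is why `pathWords` prescribes only the numbers of the other letters. -/
theorem pathProduct_mem {P : Finset (Fin (2 * h) × Fin (2 * h))} (hP : IsPairing P)
    (ls : List (Fin (2 * h))) :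
    (fun e : Env (2 * h) × (Index h P → Fin 4) =>
      (ls.map fun l => G.vertexFactor e.1.μ (e.2 ∘ Sum.inl) l.succ
        * normLineFactor P e.1 (e.2 ∘ Sum.inr) l).prod * G.vertexFactor e.1.μ (e.2 ∘ Sum.inl) 0)
      ∈ wordSpan (indexedVal Env.letterVal) (G.pathWords P ls) := by
  induction ls with
  | nil =>
    have : (fun e : Env (2 * h) × (Index h P → Fin 4) =>
      (List.map (fun l => G.vertexFactor e.1.μ (e.2 ∘ Sum.inl) l.succ
        * normLineFactor P e.1 (e.2 ∘ Sum.inr) l) []).prod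
          * G.vertexFactor e.1.μ (e.2 ∘ Sum.inl) 0)
        = evalWord (indexedVal Env.letterVal) [G.vertexLetter P 0] := by
      ext1 e
      simp [evalWord, vertexFactor_eq]
    rw [this]
    exact evalWord_mem fun x _ => by simp
  | cons l ls ih =>
    by_cases hl : ∃ a : {a // a ∈ P}, l = a.1.1 ∨ l = a.1.2
    · have h1 := mul_mem_wordSpan ih (G.vertexLetter P l.succ :: lineLetters P l) []
        (S' := G.pathWords P (l :: ls)) (fun w hw x hx => by
          rw [List.append_nil, occ_append, hw x hx, List.map_cons, List.sum_cons, add_assoc])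
      convert h1 using 2 with e
      rw [List.map_cons, List.prod_cons, normLineFactor_of_mem hP e.1 e.2 hl]
      simp [evalWord, vertexFactor_eq, mul_assoc]
    · have h1 := mul_mem_wordSpan ih [G.vertexLetter P l.succ] []
        (S' := G.pathWords P (l :: ls)) (fun w hw x hx => by
          rw [List.append_nil, occ_append, hw x hx, List.map_cons, List.sum_cons, add_assoc,
            lineLetters, dif_neg hl])
      have h2 := mul_mem_wordSpan ih [G.vertexLetter P l.succ, Sum.inl (some l)] []
        (S' := G.pathWords P (l :: ls)) (fun w hw x hx => by
          rw [List.append_nil, occ_append, hw x hx, List.map_cons, List.sum_cons, add_assoc,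
            lineLetters, dif_neg hl, occ_cons, occ_cons x (Sum.inl (some l)),
            if_neg (hx l).symm, add_zero, ← occ_cons])
      convert Submodule.add_mem _ h1 h2 using 1
      ext1 e
      have hl' : ¬ ∃ a ∈ P, l = a.1 ∨ l = a.2 := by
        rintro ⟨a, ha, h3⟩
        exact hl ⟨⟨a, ha⟩, h3⟩
      rw [List.map_cons, List.prod_cons, normLineFactor, if_neg hl']
      simp [evalWord, vertexFactor_eq, mul_assoc, mul_add, add_mul, indexedVal, Env.letterVal]

theorem sum_ite_or_eq {n : ℕ} {a b : Fin n} (hab : a ≠ b) :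
    ∑ v, (if v = a ∨ v = b then 1 else 0) = 2 := by
  rw [← Finset.card_filter]
  have : Finset.univ.filter (fun v => v = a ∨ v = b) = {a, b} := by ext; simp
  rw [this, Finset.card_pair hab]

theorem occ_of_mem_pathWords {P : Finset (Fin (2 * h) × Fin (2 * h))}
    {w : List (Letter h P)} (hw : w ∈ G.pathWords P (List.finRange (2 * h)).reverse)
    (x : Letter h P) (hx : ∀ l, x ≠ Sum.inl (some l)) :
    occ x w = ∑ v, (if G.vertexLetter P v = x then 1 else 0)
      + ∑ l, occ x (lineLetters P l) := by
  rw [hw x hx, List.map_reverse, List.sum_reverse, ← List.ofFn_eq_map, List.sum_ofFn,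
    Fin.sum_univ_succ]
  have h1 : ∀ l : Fin (2 * h), occ x (G.vertexLetter P l.succ :: lineLetters P l)
      = occ x [G.vertexLetter P l.succ] + occ x (lineLetters P l) :=
    fun l => occ_append x [_] _
  have h2 : ∀ v, occ x [G.vertexLetter P v] = if G.vertexLetter P v = x then 1 else 0 := by
    intro v
    simp [occ]
  simp only [h1, h2, Finset.sum_add_distrib]
  omega

/-- A photon index stands at the two ends of its line and a pair index at its two lepton lines, so
all indices can be contracted. The remaining words contain `γ_μ` exactly once. -/
theorem normNumerator_mem {P : Finset (Fin (2 * h) × Fin (2 * h))} (hP : IsPairing P) :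
    G.normNumerator P ∈ formSubmodule (2 * h) := by
  have h1 : G.normNumerator P = sumIndices (Env (2 * h)) (Index h P)
      (fun e => G.pathProduct P e.1 (e.2 ∘ Sum.inl) (e.2 ∘ Sum.inr)) := by
    ext1 e
    simp only [sumIndices, LinearMap.coe_mk, AddHom.coe_mk, normNumerator]
    rw [← Fintype.sum_prod_type', ← Equiv.sum_comp (Equiv.sumArrowEquivProdArrow _ _ _)]
    refine Finset.sum_congr rfl fun ν _ => ?_
    simp only [Equiv.sumArrowEquivProdArrow, Equiv.coe_fn_mk, Fintype.prod_sum_type]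
    push_cast
    rfl
  have h2 := G.pathProduct_mem hP (List.finRange (2 * h)).reverse
  rw [h1]
  refine wordSpan_map_le _ _ (fun w hw => ?_) (f := fun e : Env (2 * h) × (Index h P → Fin 4) =>
    G.pathProduct P e.1 (e.2 ∘ Sum.inl) (e.2 ∘ Sum.inr)) (val := indexedVal Env.letterVal)
    (S := G.pathWords P (List.finRange (2 * h)).reverse) ?_
  · have hocc := G.occ_of_mem_pathWords hw
    have h3 := sumIndices_mem (exists_eq_vec (N := 2 * h)) w ?_
    · refine wordSpan_map_le LinearMap.id _ (fun w' hw' => ?_) h3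
      refine evalWord_mem_formSubmodule w' ?_
      rw [occ_perm hw']
      have h4 : occ none (w.filterMap Sum.getLeft?) = occ (Sum.inl none) w := by
        clear * -
        induction w with
        | nil => rfl
        | cons x w ih => rcases x with a | i <;> simp [List.filterMap_cons, occ_cons, ih]
      rw [h4, hocc _ (by simp), Finset.sum_eq_zero (s := Finset.univ)
        (f := fun l => occ (Sum.inl none) (lineLetters P l))
        (fun l _ => occ_lineLetters_of_ne P l (by simp))]
      simp [vertexLetter_eq_none_iff]
    · rintro (i | a)
      · rw [hocc _ (by simp), Finset.sum_eq_zero (s := Finset.univ)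
          (f := fun l => occ (Sum.inr (Sum.inl i)) (lineLetters P l))
          (fun l _ => occ_lineLetters_of_ne P l (by simp))]
        simp only [vertexLetter_eq_photon_iff, add_zero]
        rw [sum_ite_or_eq (G.fst_lt_snd i).ne]
      · rw [hocc _ (by simp)]
        simp only [vertexLetter_ne_pair, occ_lineLetters_pair hP]
        rw [sum_ite_or_eq (hP.1 a.1 a.2).ne]
        simp
  · convert h2 using 2 with e
    rw [pathProduct, List.ofFn_eq_map, ← List.map_reverse]

/-! ### Vanishing of the anomalous magnetic moment for bare momenta -/

theorem prod_reverse_ofFn {n : ℕ} (A : Fin n → Mat4) (R : Fin (n + 1) → Mat4)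
    (hR : ∀ l, R l.succ = A l * R l.castSucc) :
    (List.ofFn A).reverse.prod * R 0 = R (Fin.last n) := by
  induction n with
  | zero => simp
  | succ n ih =>
    rw [List.ofFn_succ, List.reverse_cons, List.prod_append, List.prod_singleton, mul_assoc]
    have h1 := hR 0
    rw [Fin.castSucc_zero] at h1
    rw [← h1]
    exact ih (fun l => A l.succ) (fun v => R v.succ) fun l => by
      rw [hR, Fin.succ_castSucc]

/-- On bare momenta the Dirac equation removes all vertices other than the external one, one by one
from both ends of the path. The scalar must not depend on `μ` and the spinors, since the uniqueness
of form factors is applied to it. -/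
theorem exists_pathProduct_bareCoeff (u₁ u₂ : Fin 4 → ℝ) (ν : Fin h → Fin 4)
    (ρ : {a // a ∈ (∅ : Finset (Fin (2 * h) × Fin (2 * h)))} → Fin 4) :
    ∃ c : ℂ, ∀ μ ψ₁ ψ₂, (⟨G.bareCoeff, u₁, u₂, μ⟩ : Env (2 * h)).Dirac ψ₁ ψ₂ →
      ψ₂ ⬝ᵥ (G.pathProduct ∅ ⟨G.bareCoeff, u₁, u₂, μ⟩ ν ρ *ᵥ ψ₁)
        = c * (ψ₂ ⬝ᵥ (gammaLow μ *ᵥ ψ₁)) := by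
  let e : Fin 4 → Env (2 * h) := fun μ => ⟨G.bareCoeff, u₁, u₂, μ⟩
  let A : Fin 4 → Fin (2 * h) → Mat4 := fun μ l =>
    G.vertexFactor μ ν l.succ * normLineFactor ∅ (e μ) ρ l
  let R : Fin 4 → Fin (2 * h + 1) → Mat4 := fun μ =>
    Fin.induction (G.vertexFactor μ ν 0) (fun l x => A μ l * x)
  have hR : ∀ μ l, R μ l.succ = A μ l * R μ l.castSucc := fun μ l => by
    simp only [R, Fin.induction_succ]
  have hline : ∀ μ l, normLineFactor ∅ (e μ) ρ l
      = if l.castSucc < G.ext then 1 + slash u₁ else 1 + slash u₂ := by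
    intro μ l
    rw [normLineFactor, if_neg (by simp), slash_lineMomentum]
    simp only [e, bareCoeff]
    split_ifs <;> simp
  -- Before the external vertex: `(1 + û₁) γ^ν ψ₁ = 2 u₁^ν ψ₁`.
  have hright : ∀ v, v ≤ G.ext → ∃ c : ℂ, ∀ μ ψ₁ ψ₂, (e μ).Dirac ψ₁ ψ₂ →
      R μ v *ᵥ ψ₁ = c • (G.vertexFactor μ ν v *ᵥ ψ₁) := by
    intro v
    induction v using Fin.induction with
    | zero => exact fun _ => ⟨1, fun μ ψ₁ ψ₂ _ => by simp [R]⟩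
    | succ l ih =>
      intro hl
      have hl' : l.castSucc < G.ext := Fin.castSucc_lt_iff_succ_le.2 hl
      obtain ⟨c, hc⟩ := ih hl'.le
      obtain ⟨i, hi, _⟩ := G.existsUnique_photon l.castSucc hl'.ne
      refine ⟨c * (2 * u₁ (ν i)), fun μ ψ₁ ψ₂ hψ => ?_⟩
      have h1 := hψ.mulVec_one
      have h2 : slash u₁ * gamma (ν i)
          = (2 * (u₁ (ν i) : ℂ)) • (1 : Mat4) - gamma (ν i) * slash u₁ := by
        rw [gamma_mul_slash, sub_sub_cancel]
      have h3 : (1 + slash u₁) *ᵥ (gamma (ν i) *ᵥ ψ₁) = (2 * (u₁ (ν i) : ℂ)) • ψ₁ := by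
        rw [Matrix.add_mulVec, Matrix.one_mulVec, Matrix.mulVec_mulVec, h2, Matrix.sub_mulVec,
          ← Matrix.mulVec_mulVec, h1, Matrix.smul_mulVec, Matrix.one_mulVec]
        abel
      rw [hR, ← Matrix.mulVec_mulVec, hc μ ψ₁ ψ₂ hψ, vertexFactor_of_ne G hi]
      simp only [A, hline, if_pos hl']
      rw [← Matrix.mulVec_mulVec, Matrix.mulVec_smul, h3, smul_smul, Matrix.mulVec_smul]
  -- After the external vertex: `ψ₂ γ^ν (1 + û₂) = 2 u₂^ν ψ₂`.
  have hleft : ∀ v, G.ext ≤ v → ∃ c : ℂ, ∀ μ ψ₁ ψ₂, (e μ).Dirac ψ₁ ψ₂ →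
      ψ₂ ᵥ* R μ v = c • (ψ₂ ᵥ* R μ G.ext) := by
    intro v
    induction v using Fin.induction with
    | zero =>
      intro hv
      have : G.ext = 0 := le_antisymm hv (Fin.zero_le _)
      exact ⟨1, fun μ ψ₁ ψ₂ _ => by rw [this, one_smul]⟩
    | succ l ih =>
      intro hl
      rcases eq_or_lt_of_le hl with heq | hlt
      · exact ⟨1, fun μ ψ₁ ψ₂ _ => by rw [heq, one_smul]⟩
      have hl' : G.ext ≤ l.castSucc := by
        rw [Fin.lt_def, Fin.val_succ] at hlt
        rw [Fin.le_def, Fin.val_castSucc]; omega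
      obtain ⟨c, hc⟩ := ih hl'
      obtain ⟨i, hi, _⟩ := G.existsUnique_photon l.succ hlt.ne'
      refine ⟨(2 * u₂ (ν i)) * c, fun μ ψ₁ ψ₂ hψ => ?_⟩
      have h1 := hψ.vecMul_two
      have h3 : (ψ₂ ᵥ* gamma (ν i)) ᵥ* (1 + slash u₂) = (2 * (u₂ (ν i) : ℂ)) • ψ₂ := by
        rw [Matrix.vecMul_add, Matrix.vecMul_one, Matrix.vecMul_vecMul, gamma_mul_slash,
          Matrix.vecMul_sub, ← Matrix.vecMul_vecMul, h1, Matrix.vecMul_smul, Matrix.vecMul_one]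
        abel
      rw [hR]
      simp only [A, hline, if_neg (not_lt.2 hl'), vertexFactor_of_ne G hi]
      rw [← Matrix.vecMul_vecMul, ← Matrix.vecMul_vecMul, h3, Matrix.smul_vecMul,
        hc μ ψ₁ ψ₂ hψ, smul_smul]
  obtain ⟨c₁, hc₁⟩ := hright G.ext le_rfl
  obtain ⟨c₂, hc₂⟩ := hleft (Fin.last _) (Fin.le_last _)
  refine ⟨c₂ * c₁, fun μ ψ₁ ψ₂ hψ => ?_⟩
  have h1 : G.pathProduct ∅ (e μ) ν ρ = R μ (Fin.last _) := prod_reverse_ofFn (A μ) (R μ) (hR μ)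
  have h2 : G.vertexFactor μ ν G.ext = gammaLow μ := by simp [vertexFactor]
  rw [h1, Matrix.dotProduct_mulVec, hc₂ μ ψ₁ ψ₂ hψ, smul_dotProduct, ← Matrix.dotProduct_mulVec,
    hc₁ μ ψ₁ ψ₂ hψ, dotProduct_smul, h2, smul_eq_mul, smul_eq_mul, mul_assoc]

/-- The amplitude is a multiple of `γ_μ`, so uniqueness of `g` forces `A + B = 0`. Uniqueness is
available only for `q² = -Q² < 0`, where `u₁·u₂ = 1 + Q²/2` at unit mass; continuity as `Q → 0`
gives the value at `1`. -/
theorem IsForm.bareCoeff_eq_zero {F A B : Param (2 * h) → ℂ}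
    (hf : IsForm (G.normNumerator ∅) F A B) :
    A (G.bareCoeff, 1) + B (G.bareCoeff, 1) = 0 := by
  have key : ∀ Q : ℝ, 0 < Q → A (G.bareCoeff, 1 + Q ^ 2 / 2) + B (G.bareCoeff, 1 + Q ^ 2 / 2)
      = 0 := by
    intro Q hQ
    obtain ⟨p, q, hpq, hq, huniq⟩ := exists_kinematics one_pos hQ
    choose c hc using G.exists_pathProduct_bareCoeff ((1 : ℝ)⁻¹ • (p - (1 / 2 : ℝ) • q))
      ((1 : ℝ)⁻¹ • (p + (1 / 2 : ℝ) • q))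
    obtain ⟨S, hS⟩ : ∃ S : ℂ, S = ∑ ν : Fin h → Fin 4, ∑ ρ, (((∏ i, metric (ν i)) *
      ∏ a, metric (ρ a) : ℝ) : ℂ) * c ν ρ := ⟨_, rfl⟩
    set x : Param (2 * h) := (G.bareCoeff, 1 + Q ^ 2 / 2) with hx
    rw [← neg_eq_zero]
    refine huniq (F x - S + A x + B x) _ ((B x - A x) / (2 * (1 : ℝ)))
      fun ψ₁ ψ₂ h₁ h₂ μ => ?_
    have hψ := dirac_mkEnv G.bareCoeff one_pos hpq μ h₁ h₂
    rw [← form_eq G.bareCoeff one_pos hψ]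
    have h1 := hf.eq _ _ _ hψ
    have h2 : (mkEnv G.bareCoeff 1 p q μ).param = x := by
      simp only [Env.param, hx, mdot_mkEnv G.bareCoeff one_pos hpq, hq]
      congr 1
      ring
    have h3 : ψ₂ ⬝ᵥ (G.normNumerator ∅ (mkEnv G.bareCoeff 1 p q μ) *ᵥ ψ₁)
        = S * (ψ₂ ⬝ᵥ (gammaLow μ *ᵥ ψ₁)) := by
      rw [normNumerator, hS]
      simp only [Matrix.sum_mulVec, dotProduct_sum, Matrix.smul_mulVec, dotProduct_smul,
        Finset.sum_mul]
      refine Finset.sum_congr rfl fun ν _ => Finset.sum_congr rfl fun ρ _ => ?_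
      rw [smul_eq_mul, mul_assoc]
      congr 1
      exact hc ν ρ μ ψ₁ ψ₂ hψ
    rw [h2, h3] at h1
    rw [show (mkEnv G.bareCoeff 1 p q μ).μ = μ from rfl] at h1
    linear_combination -h1
  have hA := hf.contDiff_A.continuous
  have hB := hf.contDiff_B.continuous
  have hcont : Continuous fun Q : ℝ =>
      A (G.bareCoeff, 1 + Q ^ 2 / 2) + B (G.bareCoeff, 1 + Q ^ 2 / 2) := by fun_prop
  have h1 := (hcont.tendsto 0).mono_left (nhdsWithin_le_nhds (s := Set.Ioi 0))
  have h2 : (fun Q : ℝ => A (G.bareCoeff, 1 + Q ^ 2 / 2) + B (G.bareCoeff, 1 + Q ^ 2 / 2))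
      =ᶠ[𝓝[>] 0] fun _ => 0 := by
    filter_upwards [self_mem_nhdsWithin] with Q hQ
    exact key Q hQ
  have h3 := tendsto_nhds_unique (h1.congr' h2) tendsto_const_nhds
  simpa using h3

/-- The projections of the numerators are smooth functions of the coefficients of the line momenta
multiplied by powers of the mass. -/
theorem exists_amm_numerator {P : Finset (Fin (2 * h) × Fin (2 * h))} (hP : IsPairing P) :
    ∃ a : (Fin (2 * h) → ℝ × ℝ) → ℂ, ContDiff ℝ 1 a ∧ (P = ∅ → a G.bareCoeff = 0) ∧
      ∀ (m : ℝ) (z : Line h → ℝ), 0 < m →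
        IsAMM m (G.numerator m z P) ((m : ℂ) ^ (2 * h - 2 * P.card) * a (G.coeff z)) := by
  obtain ⟨F, A, B, hf⟩ := G.normNumerator_mem hP
  have hA := hf.contDiff_A
  have hB := hf.contDiff_B
  refine ⟨fun θ => -(A (θ, 1) + B (θ, 1)), by fun_prop, ?_, fun m z hm =>
    hf.isAMM _ hm _ (G.numerator_eq hP hm z)⟩
  rintro rfl
  exact neg_eq_zero.2 (IsForm.bareCoeff_eq_zero G hf)

/-- Bounds for smooth functions of the coefficients of the line momenta. -/
theorem exists_coeff_bound {a : (Fin (2 * h) → ℝ × ℝ) → ℂ} (ha : ContDiff ℝ 1 a) :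
    ∃ C : ℝ, 0 < C ∧ ∀ z : Line h → ℝ, (∀ e, 0 < z e) → ‖a (G.coeff z)‖ ≤ C ∧
      ∀ r, 0 ≤ r →
        (∀ T, G.IsOneTree T → ∀ i, Sum.inr i ∈ T → ∏ e ∈ Tᶜ, z e ≤ G.D z * r) →
        ‖a (G.coeff z) - a G.bareCoeff‖ ≤ C * r := by
  -- A convex compact set containing both the true and the bare coefficients, on which the function
  -- and its derivative are bounded.
  let K : Set (Fin (2 * h) → ℝ × ℝ) := Metric.closedBall 0 (numSets h + 1)
  have hK : IsCompact K := isCompact_closedBall _ _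
  obtain ⟨C₁, hC₁⟩ := hK.exists_bound_of_continuousOn ha.continuous.continuousOn
  obtain ⟨C₂, hC₂⟩ := hK.exists_bound_of_continuousOn
    (ha.continuous_fderiv one_ne_zero).continuousOn
  have hn := numSets_pos h
  have hbare : G.bareCoeff ∈ K := by
    rw [mem_closedBall_zero_iff, pi_norm_le_iff_of_nonneg (by positivity)]
    intro l
    unfold bareCoeff
    have : (1 : ℝ) ≤ numSets h + 1 := by linarith
    split_ifs <;> simpa [Prod.norm_def] using this
  refine ⟨|C₁| + |C₂| * (numSets h * 2) + 1, by positivity, fun z hz => ?_⟩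
  have hcoeff : G.coeff z ∈ K := by
    rw [mem_closedBall_zero_iff, pi_norm_le_iff_of_nonneg (by positivity)]
    intro l
    linarith [norm_coeff_le (G := G) hz l]
  refine ⟨?_, fun r hr hT => ?_⟩
  · have := hC₁ _ hcoeff
    have h2 := le_abs_self C₁
    have h3 : 0 ≤ |C₂| * (numSets h * 2) := by positivity
    linarith
  · have h1 := (convex_closedBall (0 : Fin (2 * h) → ℝ × ℝ)
      (numSets h + 1)).norm_image_sub_le_of_norm_fderiv_le (𝕜 := ℝ)
      (fun x _ => (ha.differentiable one_ne_zero).differentiableAt) hC₂ hbare hcoeff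
    have h2 : ‖G.coeff z - G.bareCoeff‖ ≤ numSets h * (2 * r) := by
      rw [pi_norm_le_iff_of_nonneg (by positivity)]
      intro l
      exact norm_coeff_sub_bareCoeff_le hz l hr hT
    calc _ ≤ C₂ * ‖G.coeff z - G.bareCoeff‖ := h1
      _ ≤ |C₂| * (numSets h * (2 * r)) :=
          mul_le_mul (le_abs_self _) h2 (norm_nonneg _) (abs_nonneg _)
      _ = |C₂| * (numSets h * 2) * r := by ring
      _ ≤ _ := by
          refine mul_le_mul_of_nonneg_right ?_ hr
          linarith [abs_nonneg C₁]

end QED.VertexGraph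

namespace QED.VertexGraph

variable {h : ℕ}

/-! ### Monomials in sector variables -/

/-- The monomial `∏ t_k ^ (x k)` in the sector variables. -/
def sectorMonomial (z : Line h → ℝ) (j : Fin (3 * h) ≃ Line h) (x : Fin (3 * h) → ℝ) : ℝ :=
  ∏ k ∈ Finset.univ.filter (fun k : Fin (3 * h) => 0 < k.val), sectorVar z j k ^ x k

/-- The indicator of `e ∈ s^{[k]}`. -/
def tailInd (j : Fin (3 * h) ≃ Line h) (e : Line h) (k : Fin (3 * h)) : ℝ :=
  if e ∈ tail j k then 1 else 0

section Sector

variable {z : Line h → ℝ} (hz : ∀ e, 0 < z e) {j : Fin (3 * h) ≃ Line h}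
  (hj : Antitone (z ∘ j))
include hz

theorem sectorVar_pos (k : Fin (3 * h)) : 0 < sectorVar z j k := by
  unfold sectorVar
  split_ifs
  · exact hz _
  · exact div_pos (hz _) (hz _)

theorem sectorMonomial_pos (x : Fin (3 * h) → ℝ) : 0 < sectorMonomial z j x :=
  Finset.prod_pos fun k _ => Real.rpow_pos_of_pos (sectorVar_pos hz k) _

theorem sectorMonomial_add (x y : Fin (3 * h) → ℝ) :
    sectorMonomial z j (x + y) = sectorMonomial z j x * sectorMonomial z j y := by
  rw [sectorMonomial, sectorMonomial, sectorMonomial, ← Finset.prod_mul_distrib]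
  exact Finset.prod_congr rfl fun k _ => Real.rpow_add (sectorVar_pos hz k) _ _

theorem sectorMonomial_neg (x : Fin (3 * h) → ℝ) :
    sectorMonomial z j (-x) = (sectorMonomial z j x)⁻¹ := by
  rw [sectorMonomial, sectorMonomial, ← Finset.prod_inv_distrib]
  exact Finset.prod_congr rfl fun k _ => Real.rpow_neg (sectorVar_pos hz k).le _

theorem sectorMonomial_smul (w : ℝ) (x : Fin (3 * h) → ℝ) :
    sectorMonomial z j (w • x) = sectorMonomial z j x ^ w := by
  rw [sectorMonomial, sectorMonomial,
    ← Real.finsetProd_rpow _ _ fun k _ => Real.rpow_nonneg (sectorVar_pos hz k).le _]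
  refine Finset.prod_congr rfl fun k _ => ?_
  rw [Pi.smul_apply, smul_eq_mul, mul_comm, Real.rpow_mul (sectorVar_pos hz k).le]

omit hz in
theorem sectorMonomial_zero : sectorMonomial z j 0 = 1 := by
  simp [sectorMonomial]

theorem sectorMonomial_sum {ι : Type*} (s : Finset ι) (x : ι → Fin (3 * h) → ℝ) :
    sectorMonomial z j (∑ i ∈ s, x i) = ∏ i ∈ s, sectorMonomial z j (x i) := by
  induction s using Finset.induction_on with
  | empty => simp [sectorMonomial_zero]
  | insert a s ha ih => rw [Finset.sum_insert ha, Finset.prod_insert ha, sectorMonomial_add hz, ih]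

include hj

theorem sectorVar_le_one {k : Fin (3 * h)} (hk : 0 < k.val) : sectorVar z j k ≤ 1 := by
  rw [sectorVar, if_neg hk.ne', div_le_one (hz _)]
  exact hj (Fin.le_def.2 (Nat.sub_le _ _))

/-- This turns the estimate of the integrand into the comparison of exponents. -/
theorem sectorMonomial_anti {x y : Fin (3 * h) → ℝ} (hxy : ∀ k, 0 < k.val → y k ≤ x k) :
    sectorMonomial z j x ≤ sectorMonomial z j y := by
  refine Finset.prod_le_prod (fun k _ => Real.rpow_nonneg (sectorVar_pos hz k).le _)
    fun k hk => ?_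
  have hk : 0 < k.val := by simpa using hk
  exact Real.rpow_le_rpow_of_exponent_ge (sectorVar_pos hz k) (sectorVar_le_one hz hj hk)
    (hxy k hk)

omit hj in
-- The ratios telescope, and `t_k` occurs in `z e` exactly when `e` is in the tail number `k`.
theorem eq_mul_sectorMonomial (h0 : 0 < 3 * h) (e : Line h) :
    z e = z (j ⟨0, h0⟩) * sectorMonomial z j (tailInd j e) := by
  have key : ∀ n (hn : n < 3 * h), z (j ⟨n, hn⟩) = z (j ⟨0, h0⟩) *
      ∏ k ∈ Finset.univ.filter (fun k : Fin (3 * h) => 0 < k.val ∧ k.val ≤ n),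
        sectorVar z j k := by
    intro n
    induction n with
    | zero =>
      intro hn
      rw [Finset.filter_false_of_mem (fun k _ => by omega), Finset.prod_empty, mul_one]
    | succ n ih =>
      intro hn
      have h1 : Finset.univ.filter (fun k : Fin (3 * h) => 0 < k.val ∧ k.val ≤ n + 1)
          = insert ⟨n + 1, hn⟩
            (Finset.univ.filter (fun k : Fin (3 * h) => 0 < k.val ∧ k.val ≤ n)) := by
        ext k
        simp only [Finset.mem_filter, Finset.mem_univ, true_and, Finset.mem_insert, Fin.ext_iff]
        omega
      rw [h1, Finset.prod_insert (by simp), mul_left_comm, ← ih (by omega), sectorVar,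
        if_neg (by simp)]
      exact (div_mul_cancel₀ _ (hz _).ne').symm
  have h1 := key (j.symm e) (j.symm e).isLt
  rw [Fin.eta, Equiv.apply_symm_apply] at h1
  rw [h1, sectorMonomial, ← Finset.filter_filter, Finset.prod_filter]
  congr 1
  refine Finset.prod_congr rfl fun k _ => ?_
  simp only [tailInd, mem_tail, Fin.le_def]
  split_ifs <;> simp

omit hj in
theorem first_le_one (hsum : ∑ e, z e = 1) (e : Line h) : z e ≤ 1 := by
  rw [← hsum]
  exact Finset.single_le_sum (fun e _ => (hz e).le) (Finset.mem_univ e)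

omit hz in
-- The largest of `3h` numbers with sum `1`. It is bounded away from `0`, so it affects only
-- constants.
theorem inv_le_first (h0 : 0 < 3 * h) (hsum : ∑ e, z e = 1) :
    ((3 * h : ℕ) : ℝ)⁻¹ ≤ z (j ⟨0, h0⟩) := by
  have h1 : ∑ e, z e ≤ ∑ _e : Line h, z (j ⟨0, h0⟩) := by
    refine Finset.sum_le_sum fun e _ => ?_
    have := hj (Fin.le_def.2 (Nat.zero_le _) : (⟨0, h0⟩ : Fin (3 * h)) ≤ j.symm e)
    simpa using this
  rw [hsum, Finset.sum_const, nsmul_eq_mul, Finset.card_univ] at h1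
  have h2 : Fintype.card (Line h) = 3 * h := by simp; omega
  rw [h2] at h1
  have h3 : (0 : ℝ) < (3 * h : ℕ) := by exact_mod_cast h0
  rwa [inv_le_iff_one_le_mul₀' h3]

omit hz hj in
theorem sum_tailInd (s : Finset (Line h)) (k : Fin (3 * h)) :
    (∑ e ∈ s, tailInd j e) k = ((s ∩ tail j k).card : ℝ) := by
  rw [Finset.sum_apply]
  simp only [tailInd]
  rw [Finset.sum_boole, Finset.filter_mem_eq_inter]

/-! ### Monomial bounds for products of `z`, `D`, `B / D` and `K` -/

omit hj in
theorem prod_eq_pow_mul (h0 : 0 < 3 * h) (s : Finset (Line h)) :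
    ∏ e ∈ s, z e = z (j ⟨0, h0⟩) ^ s.card *
      sectorMonomial z j (fun k => ((s ∩ tail j k).card : ℝ)) := by
  have h1 : (fun k => ((s ∩ tail j k).card : ℝ)) = ∑ e ∈ s, tailInd j e := by
    ext1 k
    rw [sum_tailInd]
  rw [h1, sectorMonomial_sum hz, ← Finset.prod_const, ← Finset.prod_mul_distrib]
  exact Finset.prod_congr rfl fun e _ => eq_mul_sectorMonomial hz h0 e

omit hj in
theorem prod_le_sectorMonomial (h0 : 0 < 3 * h) (hsum : ∑ e, z e = 1) :
    ∏ e, z e ≤ sectorMonomial z j (fun k => ((tail j k).card : ℝ)) := by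
  rw [prod_eq_pow_mul hz h0 (j := j)]
  simp only [Finset.univ_inter]
  exact mul_le_of_le_one_left (sectorMonomial_pos hz _).le
    (pow_le_one₀ (hz _).le (first_le_one hz hsum _))

/-- The single term of the tree optimal for all tails suffices. -/
theorem le_D (G : VertexGraph h) (h0 : 0 < 3 * h) (hsum : ∑ e, z e = 1) :
    (((3 * h : ℕ) : ℝ)⁻¹) ^ (3 * h) * sectorMonomial z j (fun k => (G.nLoops (tail j k) : ℝ))
      ≤ G.D z := by
  obtain ⟨T, hT, hopt⟩ := G.exists_optimal_tree j
  refine le_trans ?_ (hT.prod_le_D hz)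
  rw [prod_eq_pow_mul hz h0 (j := j)]
  have h1 : (fun k => ((Tᶜ ∩ tail j k).card : ℝ)) = fun k => (G.nLoops (tail j k) : ℝ) := by
    ext1 k
    rw [← hopt k, Finset.inter_comm, Finset.sdiff_eq_inter_compl]
  rw [h1]
  refine mul_le_mul_of_nonneg_right ?_ (sectorMonomial_pos hz _).le
  have h2 : Tᶜ.card ≤ 3 * h := by
    refine (Finset.card_le_univ _).trans ?_
    simp; omega
  calc (((3 * h : ℕ) : ℝ)⁻¹) ^ (3 * h) ≤ z (j ⟨0, h0⟩) ^ (3 * h) :=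
        pow_le_pow_left₀ (by positivity) (inv_le_first hj h0 hsum) _
    _ ≤ z (j ⟨0, h0⟩) ^ Tᶜ.card := pow_le_pow_of_le_one (hz _).le (first_le_one hz hsum _) h2

theorem inv_le_of_line (h0 : 0 < 3 * h) (hsum : ∑ e, z e = 1) (e : Line h) :
    (z e)⁻¹ ≤ (3 * h : ℕ) * sectorMonomial z j (-tailInd j e) := by
  rw [eq_mul_sectorMonomial hz h0 (j := j) e, mul_inv, sectorMonomial_neg hz]
  refine mul_le_mul_of_nonneg_right ?_ (inv_nonneg.2 (sectorMonomial_pos hz _).le)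
  have h3 : (0 : ℝ) < (3 * h : ℕ) := by exact_mod_cast h0
  rw [inv_le_comm₀ (hz _) h3]
  exact inv_le_first hj h0 hsum

theorem le_of_line (h0 : 0 < 3 * h) (hsum : ∑ e, z e = 1) (e : Line h) :
    ((3 * h : ℕ) : ℝ)⁻¹ * sectorMonomial z j (tailInd j e) ≤ z e := by
  rw [eq_mul_sectorMonomial hz h0 (j := j) e]
  exact mul_le_mul_of_nonneg_right (inv_le_first hj h0 hsum) (sectorMonomial_pos hz _).le

/-- The indicator of both lines of a pair being in `s^{[k]}`. -/
def pairInd (j : Fin (3 * h) ≃ Line h) (a : Fin (2 * h) × Fin (2 * h)) (k : Fin (3 * h)) : ℝ :=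
  if Sum.inl a.1 ∈ tail j k ∧ Sum.inl a.2 ∈ tail j k then 1 else 0

/-- The line with the larger `z` gives the better bound; it comes first in the order, so it lies in
a tail exactly when both lines do. -/
theorem abs_B_div_D_le_monomial (G : VertexGraph h) (h0 : 0 < 3 * h) (hsum : ∑ e, z e = 1)
    (a : Fin (2 * h) × Fin (2 * h)) :
    |G.B z a.1 a.2 / G.D z| ≤ numSets h * (3 * h : ℕ) * sectorMonomial z j (-pairInd j a) := by
  obtain ⟨l, hl, hle⟩ : ∃ l, (l = a.1 ∨ l = a.2) ∧ tailInd j (Sum.inl l) = pairInd j a := by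
    rcases le_total (j.symm (Sum.inl a.1)) (j.symm (Sum.inl a.2)) with h1 | h1
    · refine ⟨a.1, Or.inl rfl, ?_⟩
      ext1 k
      simp only [tailInd, pairInd, mem_tail]
      exact if_congr ⟨fun h2 => ⟨h2, h2.trans h1⟩, fun h2 => h2.1⟩ rfl rfl
    · refine ⟨a.2, Or.inr rfl, ?_⟩
      ext1 k
      simp only [tailInd, pairInd, mem_tail]
      exact if_congr ⟨fun h2 => ⟨h2.trans h1, h2⟩, fun h2 => h2.2⟩ rfl rfl
  refine (abs_B_div_D_le hz a.1 a.2 l hl).trans ?_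
  rw [div_eq_mul_inv, mul_assoc, ← hle]
  exact mul_le_mul_of_nonneg_left (inv_le_of_line hz hj h0 hsum _) (numSets_pos h).le

/-- The bound for the global multipliers. -/
theorem abs_K_le (G : VertexGraph h) (h0 : 0 < 3 * h) (hsum : ∑ e, z e = 1)
    (P : Finset (Fin (2 * h) × Fin (2 * h))) :
    |G.K z P| ≤ (((3 * h : ℕ) : ℝ) ^ (3 * h)) ^ 2 * (numSets h * (3 * h : ℕ)) ^ P.card *
      sectorMonomial z j (fun k => -(2 * G.nLoops (tail j k) : ℝ) - ∑ a ∈ P, pairInd j a k) := by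
  have hD := G.D_pos hz
  have h3 : (0 : ℝ) < (3 * h : ℕ) := by exact_mod_cast h0
  have h1 : (fun k => -(2 * G.nLoops (tail j k) : ℝ) - ∑ a ∈ P, pairInd j a k)
      = (-fun k => (G.nLoops (tail j k) : ℝ)) + (-fun k => (G.nLoops (tail j k) : ℝ))
        + ∑ a ∈ P, -pairInd j a := by
    ext1 k
    simp only [Pi.add_apply, Pi.neg_apply, Finset.sum_apply, Finset.sum_neg_distrib]
    ring
  rw [h1, sectorMonomial_add hz, sectorMonomial_add hz, sectorMonomial_sum hz,
    sectorMonomial_neg hz, K, abs_mul, Finset.abs_prod]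
  have h2 : |1 / G.D z ^ 2| ≤ (((3 * h : ℕ) : ℝ) ^ (3 * h)) ^ 2 *
      ((sectorMonomial z j fun k => (G.nLoops (tail j k) : ℝ))⁻¹ *
        (sectorMonomial z j fun k => (G.nLoops (tail j k) : ℝ))⁻¹) := by
    have h4 := le_D hz hj G h0 hsum
    rw [inv_pow, inv_mul_le_iff₀ (by positivity)] at h4
    have hM := sectorMonomial_pos hz (j := j) fun k => (G.nLoops (tail j k) : ℝ)
    set M := sectorMonomial z j fun k => (G.nLoops (tail j k) : ℝ)
    rw [abs_of_pos (by positivity), div_le_iff₀ (by positivity)]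
    have h5 : 1 ≤ ((3 * h : ℕ) : ℝ) ^ (3 * h) * G.D z * M⁻¹ := by
      rw [← div_eq_mul_inv, one_le_div hM]; exact h4
    calc (1 : ℝ) ≤ (((3 * h : ℕ) : ℝ) ^ (3 * h) * G.D z * M⁻¹) ^ 2 := one_le_pow₀ h5
      _ = _ := by ring
  have h4 : ∏ a ∈ P, |G.B z a.1 a.2 / G.D z| ≤ (numSets h * (3 * h : ℕ)) ^ P.card *
      ∏ a ∈ P, sectorMonomial z j (-pairInd j a) := by
    rw [← Finset.prod_const, ← Finset.prod_mul_distrib]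
    exact Finset.prod_le_prod (fun a _ => abs_nonneg _)
      fun a _ => abs_B_div_D_le_monomial hz hj G h0 hsum a
  calc _ ≤ _ := mul_le_mul h2 h4 (Finset.prod_nonneg fun a _ => abs_nonneg _) (by
        have := sectorMonomial_pos hz (j := j) fun k => (G.nLoops (tail j k) : ℝ)
        positivity)
    _ = _ := by ring

/-! ### Lepton paths in a sector and monomial bounds for `W` -/

omit hz hj

theorem exists_first_line (G : VertexGraph h) (j : Fin (3 * h) ≃ Line h) (i : Fin h) :
    ∃ e ∈ G.lpath i, ∀ e' ∈ G.lpath i, j.symm e ≤ j.symm e' :=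
  Finset.exists_min_image _ _ (lpath_nonempty i)

/-- The first of the lines of the lepton path of a photon line in the order `j`. -/
def firstLine (G : VertexGraph h) (j : Fin (3 * h) ≃ Line h) (i : Fin h) : Line h :=
  (exists_first_line G j i).choose

theorem firstLine_mem (G : VertexGraph h) (i : Fin h) : firstLine G j i ∈ G.lpath i :=
  (exists_first_line G j i).choose_spec.1

theorem symm_firstLine_le (G : VertexGraph h) {i : Fin h} {e : Line h} (he : e ∈ G.lpath i) :
    j.symm (firstLine G j i) ≤ j.symm e :=
  (exists_first_line G j i).choose_spec.2 e he

theorem lpath_subset_tail_iff (G : VertexGraph h) (i : Fin h) (k : Fin (3 * h)) :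
    G.lpath i ⊆ tail j k ↔ firstLine G j i ∈ tail j k := by
  constructor
  · exact fun h1 => h1 (firstLine_mem G i)
  · intro h1 e he
    rw [mem_tail] at h1 ⊢
    exact h1.trans (symm_firstLine_le G he)

theorem apply_le_of_symm_le (hj : Antitone (z ∘ j)) {e e' : Line h}
    (he : j.symm e ≤ j.symm e') : z e' ≤ z e := by
  simpa using hj he

/-- The indicator of `LPath(i) ⊆ s^{[k]}`. -/
def pathInd (G : VertexGraph h) (j : Fin (3 * h) ≃ Line h) (i : Fin h) (k : Fin (3 * h)) : ℝ :=
  if G.lpath i ⊆ tail j k then 1 else 0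

/-- The indicator of `LPath(i) ⊆ s^{[k]}`, `i ∉ s^{[k]}`. -/
def outInd (G : VertexGraph h) (j : Fin (3 * h) ≃ Line h) (i : Fin h) (k : Fin (3 * h)) : ℝ :=
  if G.lpath i ⊆ tail j k ∧ Sum.inr i ∉ tail j k then 1 else 0

theorem sum_pathInd (G : VertexGraph h) (k : Fin (3 * h)) :
    ∑ i, pathInd G j i k = ((G.photonsIn (tail j k)).card : ℝ) := by
  simp only [pathInd, photonsIn]
  rw [Finset.sum_boole]

theorem sum_outInd (G : VertexGraph h) (k : Fin (3 * h)) :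
    ∑ i, outInd G j i k = ((G.photonsOut (tail j k)).card : ℝ) := by
  simp only [outInd, photonsOut]
  rw [Finset.sum_boole]

theorem tailInd_firstLine (G : VertexGraph h) (i : Fin h) :
    tailInd j (firstLine G j i) = pathInd G j i := by
  ext1 k
  simp only [tailInd, pathInd]
  exact if_congr (lpath_subset_tail_iff G i k).symm rfl rfl

include hz hj

/-- If the photon line comes first in the order, the ratio is the product of the `t_k` over the
tails that contain the whole path but not `i`; otherwise there are no such tails and the minimum is
`1`. -/
theorem min_one_div_eq (G : VertexGraph h) (h0 : 0 < 3 * h) (i : Fin h) :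
    min 1 (z (firstLine G j i) / z (Sum.inr i)) = sectorMonomial z j (outInd G j i) := by
  rcases le_total (j.symm (Sum.inr i)) (j.symm (firstLine G j i)) with h1 | h1
  · have h2 := apply_le_of_symm_le hj h1
    rw [min_eq_right (div_le_one_of_le₀ h2 (hz _).le)]
    rw [eq_mul_sectorMonomial hz h0 (j := j) (firstLine G j i),
      eq_mul_sectorMonomial hz h0 (j := j) (Sum.inr i), mul_div_mul_left _ _ (hz _).ne',
      div_eq_mul_inv, ← sectorMonomial_neg hz, ← sectorMonomial_add hz]
    congr 1
    ext1 k
    simp only [Pi.add_apply, Pi.neg_apply, tailInd, outInd, lpath_subset_tail_iff, mem_tail]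
    by_cases h3 : k ≤ j.symm (Sum.inr i)
    · simp [h3, h3.trans h1]
    · by_cases h4 : k ≤ j.symm (firstLine G j i) <;> simp [h3, h4]
  · have h2 := apply_le_of_symm_le hj h1
    rw [min_eq_left ((one_le_div (hz _)).2 h2)]
    have h3 : outInd G j i = 0 := by
      ext1 k
      simp only [outInd, lpath_subset_tail_iff, mem_tail, Pi.zero_apply]
      exact if_neg fun h4 => h4.2 (h4.1.trans h1)
    rw [h3, sectorMonomial_zero]

theorem le_neg_W_monomial (G : VertexGraph h) (h0 : 0 < 3 * h) (hsum : ∑ e, z e = 1) (m : ℝ)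
    (i : Fin h) :
    m ^ 2 * ((2 * (3 * h : ℕ) : ℝ)⁻¹ * sectorMonomial z j (pathInd G j i + outInd G j i))
      ≤ -G.W m z := by
  refine le_trans ?_ (le_neg_W hz (firstLine_mem (j := j) G i))
  refine mul_le_mul_of_nonneg_left ?_ (sq_nonneg m)
  rw [min_one_div_eq hz hj G h0, sectorMonomial_add hz, ← tailInd_firstLine]
  have h1 := le_of_line hz hj h0 hsum (firstLine G j i)
  have h2 := sectorMonomial_pos hz (j := j) (outInd G j i)
  have h3 := mul_le_mul_of_nonneg_right h1 h2.le
  calc _ = 1 / 2 * (((3 * h : ℕ) : ℝ)⁻¹ * sectorMonomial z j (tailInd j (firstLine G j i)) *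
          sectorMonomial z j (outInd G j i)) := by rw [mul_inv]; ring
    _ ≤ _ := by linarith

/-- The product of the bounds for `W` with weights. -/
theorem le_abs_W_pow (G : VertexGraph h) (h0 : 0 < 3 * h) (hsum : ∑ e, z e = 1) {m : ℝ}
    (hm : 0 < m) {n : ℕ} {w : Fin h → ℝ} (hw : ∀ i, 0 ≤ w i) (hwn : ∑ i, w i = n) :
    m ^ (2 * n) * ((2 * (3 * h : ℕ) : ℝ)⁻¹ ^ n *
      sectorMonomial z j (fun k => ∑ i, w i * (pathInd G j i k + outInd G j i k)))
      ≤ |G.W m z| ^ n := by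
  have h3 : (0 : ℝ) < (3 * h : ℕ) := by exact_mod_cast h0
  set c : ℝ := m ^ 2 * (2 * (3 * h : ℕ) : ℝ)⁻¹ with hc
  have hcpos : 0 < c := by positivity
  have hbound : ∀ i, c * sectorMonomial z j (pathInd G j i + outInd G j i) ≤ |G.W m z| := by
    intro i
    have := le_neg_W_monomial hz hj G h0 hsum m i
    rw [← mul_assoc] at this
    exact this.trans (neg_le_abs _)
  rcases isEmpty_or_nonempty (Fin h) with hemp | ⟨⟨i₀⟩⟩
  · exact (hemp.false ⟨0, by omega⟩).elim
  have hWpos : 0 < |G.W m z| :=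
    (mul_pos hcpos (sectorMonomial_pos hz _)).trans_le (hbound i₀)
  have h1 : (fun k => ∑ i, w i * (pathInd G j i k + outInd G j i k))
      = ∑ i, w i • (pathInd G j i + outInd G j i) := by
    ext1 k
    simp [Finset.sum_apply, mul_add]
  -- `|W|^n` is split into the real powers `|W|^(w i)`, and the bound from the photon line `i` is
  -- applied to factor number `i`.
  rw [h1, sectorMonomial_sum hz, pow_mul, ← mul_assoc, ← mul_pow, ← hc,
    ← Real.rpow_natCast c n, ← Real.rpow_natCast (|G.W m z|) n, ← hwn,
    Real.rpow_sum_of_pos hcpos, Real.rpow_sum_of_pos hWpos, ← Finset.prod_mul_distrib]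
  refine Finset.prod_le_prod (fun i _ => mul_nonneg (Real.rpow_nonneg hcpos.le _)
    (sectorMonomial_pos hz _).le) fun i _ => ?_
  rw [sectorMonomial_smul hz, ← Real.mul_rpow hcpos.le (sectorMonomial_pos hz _).le]
  exact Real.rpow_le_rpow (mul_pos hcpos (sectorMonomial_pos hz _)).le (hbound i) (hw i)

end Sector

/-! ### Choice of the weights -/

theorem exists_top_set {κ : Fin h → ℕ} (p : ℕ) (hp : p ≤ h) :
    ∃ Z : Finset (Fin h), Z.card = p ∧ ∀ i ∈ Z, ∀ i' ∉ Z, κ i' ≤ κ i := by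
  induction p with
  | zero => exact ⟨∅, rfl, by simp⟩
  | succ p ih =>
    obtain ⟨Z, hZ, htop⟩ := ih (by omega)
    have hne : (Zᶜ).Nonempty := by
      rw [← Finset.card_pos, Finset.card_compl, Fintype.card_fin]; omega
    obtain ⟨i₀, hi₀, hmax⟩ := Finset.exists_max_image Zᶜ κ hne
    have hi₀ : i₀ ∉ Z := by simpa using hi₀
    refine ⟨insert i₀ Z, by rw [Finset.card_insert_of_notMem hi₀, hZ], ?_⟩
    intro i hi i' hi'
    simp only [Finset.mem_insert, not_or] at hi hi'
    rcases hi with rfl | hi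
    · exact hmax i' (by simpa using hi'.2)
    · exact htop i hi i' hi'.2

/-- The sets `{i | k ≤ κ i}` form a chain, so weight `0` is put on `p` indices `Z` with the largest
`κ`: such a set meets the complement of `Z` only after it has absorbed all of `Z`. Half a unit then
moves from `i₂` to the element `i₁` of `Z` with the smallest `κ`, which is counted only when all of
`Z` is. -/
theorem exists_weights (κ : Fin h → ℕ) {p : ℕ} (hp0 : 0 < p) (hp : p ≤ h) (i₂ : Fin h) :
    ∃ w : Fin h → ℝ, (∀ i, 0 ≤ w i) ∧ (∀ i, w i ≤ 1) ∧ w i₂ ≤ 1 / 2 ∧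
      ∑ i, w i = ((h - p : ℕ) : ℝ) ∧
      ∀ k, (∑ i ∈ Finset.univ.filter (fun i => k ≤ κ i), w i ≤ 0) ∨
        (p ≤ (Finset.univ.filter (fun i => k ≤ κ i)).card ∧
          ∑ i ∈ Finset.univ.filter (fun i => k ≤ κ i), w i
            ≤ (Finset.univ.filter (fun i => k ≤ κ i)).card - p + 1 / 2) := by
  obtain ⟨Z, hZ, htop⟩ := exists_top_set (κ := κ) p hp
  obtain ⟨i₁, hi₁, hmin⟩ := Finset.exists_min_image Z κ (by rw [← Finset.card_pos, hZ]; exact hp0)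
  -- Nothing has to be moved if `i₂` has weight `0` already.
  let ε : ℝ := if i₂ ∈ Z then 0 else 1 / 2
  have hε : 0 ≤ ε ∧ ε ≤ 1 / 2 := by simp only [ε]; split_ifs <;> norm_num
  let w : Fin h → ℝ := fun i =>
    (if i ∈ Z then 0 else 1) + ε * ((if i = i₁ then 1 else 0) - (if i = i₂ then 1 else 0))
  have hwsum : ∀ U : Finset (Fin h), ∑ i ∈ U, w i = ((U \ Z).card : ℝ)
      + ε * ((if i₁ ∈ U then 1 else 0) - (if i₂ ∈ U then 1 else 0)) := by
    intro U
    simp only [w, Finset.sum_add_distrib, ← Finset.mul_sum, Finset.sum_sub_distrib,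
      Finset.sum_ite_eq']
    congr 1
    have : ∀ i, (if i ∈ Z then (0 : ℝ) else 1) = if i ∉ Z then 1 else 0 := by
      intro i; split_ifs <;> simp_all
    simp only [this]
    rw [Finset.sum_boole, Finset.filter_notMem_eq_sdiff]
  refine ⟨w, fun i => ?_, fun i => ?_, ?_, ?_, fun k => ?_⟩
  · simp only [w, ε]
    split_ifs <;> simp_all <;> norm_num
  · simp only [w, ε]
    split_ifs <;> simp_all <;> norm_num
  · simp only [w, ε]
    split_ifs <;> simp_all <;> norm_num
  · rw [hwsum, if_pos (Finset.mem_univ _), if_pos (Finset.mem_univ _), sub_self, mul_zero, add_zero,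
      ← Finset.compl_eq_univ_sdiff, Finset.card_compl, Fintype.card_fin, hZ]
  · rw [hwsum]
    set U := Finset.univ.filter (fun i => k ≤ κ i) with hU
    have hmem : ∀ i, i ∈ U ↔ k ≤ κ i := by simp [hU]
    by_cases hUZ : U ⊆ Z
    · rw [Finset.sdiff_eq_empty_iff_subset.2 hUZ]
      by_cases hi : i₁ ∈ U
      · right
        have hZU : Z ⊆ U := fun i hiZ => (hmem i).2 (((hmem i₁).1 hi).trans (hmin i hiZ))
        rw [Finset.Subset.antisymm hUZ hZU, hZ]
        refine ⟨le_rfl, ?_⟩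
        simp only [Finset.card_empty, Nat.cast_zero, hi₁, if_true]
        split_ifs <;> linarith
      · left
        rw [if_neg hi]
        simp only [Finset.card_empty, Nat.cast_zero]
        split_ifs <;> linarith
    · right
      obtain ⟨i', hi', hi'Z⟩ := Finset.not_subset.1 hUZ
      have hZU : Z ⊆ U := fun i hiZ => (hmem i).2 (((hmem i').1 hi').trans (htop i hiZ i' hi'Z))
      have hcard := Finset.card_sdiff_add_card_eq_card hZU
      rw [hZ] at hcard
      refine ⟨by omega, ?_⟩
      have : ((U \ Z).card : ℝ) = U.card - p := by
        rw [← hcard]; push_cast; ring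
      rw [this]
      split_ifs <;> linarith

/-! ### Power counting -/

section Counting

variable {G : VertexGraph h} (hG : G.NoUVDivergentSubgraphs) {j : Fin (3 * h) ≃ Line h}

theorem self_mem_tail (k : Fin (3 * h)) : j k ∈ tail j k := by simp [mem_tail]

theorem first_notMem_tail (h0 : 0 < 3 * h) {k : Fin (3 * h)} (hk : 0 < k.val) :
    j ⟨0, h0⟩ ∉ tail j k := by
  rw [mem_tail, Equiv.symm_apply_apply, Fin.le_def]
  exact not_le.2 hk

theorem pathInd_nonneg (i : Fin h) (k : Fin (3 * h)) : 0 ≤ pathInd G j i k := by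
  unfold pathInd; split_ifs <;> norm_num

theorem outInd_nonneg (i : Fin h) (k : Fin (3 * h)) : 0 ≤ outInd G j i k := by
  unfold outInd; split_ifs <;> norm_num

theorem card_add_photonsOut {s : Finset (Line h)} (hs : leptons Finset.univ ⊆ s) :
    s.card + (G.photonsOut s).card = 3 * h := by
  rw [← card_iclos, (iclos_eq_univ_iff s).2 hs, Finset.card_univ]
  simp
  omega

theorem sum_pairInd_le {P : Finset (Fin (2 * h) × Fin (2 * h))} (hP : IsPairing P)
    (k : Fin (3 * h)) :
    ∑ a ∈ P, pairInd j a k ≤ P.card ∧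
      2 * ∑ a ∈ P, pairInd j a k ≤ ((leptons (tail j k)).card : ℝ) := by
  simp only [pairInd]
  rw [Finset.sum_boole]
  set P' := P.filter (fun a => Sum.inl a.1 ∈ tail j k ∧ Sum.inl a.2 ∈ tail j k) with hP'
  have hpair : IsPairing P' :=
    ⟨fun a ha => hP.1 a (Finset.mem_filter.1 ha).1, fun a ha b hb =>
      hP.2 a (Finset.mem_filter.1 ha).1 b (Finset.mem_filter.1 hb).1⟩
  refine ⟨by exact_mod_cast Finset.card_filter_le _ _, ?_⟩
  have h1 := card_pairedLines hpair
  have h2 : ((pairedLines P').image Sum.inl : Finset (Line h)) ⊆ leptons (tail j k) := by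
    intro e he
    obtain ⟨l, hl, rfl⟩ := Finset.mem_image.1 he
    obtain ⟨a, ha, hla⟩ := (Finset.mem_filter.1 hl).2
    have h3 := (Finset.mem_filter.1 ha).2
    rw [inl_mem_leptons]
    rcases hla with rfl | rfl
    exacts [h3.1, h3.2]
  have h4 := Finset.card_le_card h2
  rw [Finset.card_image_of_injective _ Sum.inl_injective, h1] at h4
  exact_mod_cast h4

/-- The exponent inequality for a set of a sector with all lepton lines. -/
theorem exponent_le_of_subset {k : Fin (3 * h)} (hk : leptons Finset.univ ⊆ tail j k)
    {p : ℕ} (hp : p ≤ h) {w : Fin h → ℝ} (hw : ∑ i, w i = ((h - p : ℕ) : ℝ)) {π δ : ℝ} (hπ : π ≤ p)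
    (hδ : ∑ i, w i * outInd G j i k - δ ≤ (G.photonsOut (tail j k)).card - 1 / 2) :
    2 * (G.nLoops (tail j k) : ℝ) + π + ∑ i, w i * (pathInd G j i k + outInd G j i k) - δ
      ≤ (tail j k).card - G.degree (tail j k) := by
  have hpath : ∀ i, pathInd G j i k = 1 := fun i => if_pos fun e he => by
    cases e with
    | inr k => exact absurd he inr_notMem_lpath
    | inl l => exact hk (by simp [leptons])
  rw [degree_of_subset hk]
  simp only [hpath, mul_add, mul_one, Finset.sum_add_distrib, hw]
  have h1 : ((tail j k).card : ℝ) + (G.photonsOut (tail j k)).card = 3 * h := by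
    exact_mod_cast card_add_photonsOut hk
  have h2 : (G.nLoops (tail j k) : ℝ) + 2 * h ≤ (tail j k).card := by
    exact_mod_cast nLoops_add_le_of_subset hk
  rw [Nat.cast_sub hp]
  linarith

include hG

/-- The exponent inequality for a set of a sector without some lepton line. -/
theorem exponent_le_of_not_subset {k : Fin (3 * h)} (hk : ¬ leptons Finset.univ ⊆ tail j k)
    {w : Fin h → ℝ} {π δ : ℝ}
    (hδ : π + ∑ i, w i * pathInd G j i k + ∑ i, w i * outInd G j i k - δ
      ≤ (G.photonsOut (tail j k)).card + ((leptons (tail j k)).card : ℝ) / 2) :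
    2 * (G.nLoops (tail j k) : ℝ) + π + ∑ i, w i * (pathInd G j i k + outInd G j i k) - δ
      ≤ (tail j k).card - G.degree (tail j k) := by
  have h1 := degree_le_of_not_subset hG hk ⟨_, self_mem_tail k⟩
  simp only [mul_add, Finset.sum_add_distrib]
  linarith

/-- Integrality turns the strict inequality `two_mul_card_photonsIn_lt` into a gap of `1/2`, which
absorbs a half unit of moved weight. -/
theorem photonsIn_bounds {s : Finset (Line h)} (hs : ¬ leptons Finset.univ ⊆ s) :
    ((G.photonsIn s).card : ℝ) ≤ ((leptons s).card : ℝ) / 2 ∧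
      (0 < (G.photonsIn s).card →
        ((G.photonsIn s).card : ℝ) + 1 / 2 ≤ ((leptons s).card : ℝ) / 2) := by
  rcases (leptons s).eq_empty_or_nonempty with h1 | h1
  · rw [photonsIn_eq_empty h1]
    simp
    positivity
  · have h2 := two_mul_card_photonsIn_lt hG hs h1
    have h3 : (2 * ((G.photonsIn s).card : ℝ)) + 1 ≤ ((leptons s).card : ℝ) := by
      exact_mod_cast h2
    exact ⟨by linarith, fun _ => by linarith⟩

/-- The pairs inside a tail number at most `P.card` and at most half of its lepton lines. The
weights are zero on `P.card` photon lines whose paths stay longest in the tails. Hence either no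
weight is counted and the second bound suffices, or the missing weight makes room for the first
bound up to `1/2`. -/
theorem exists_weights_of_nonempty (h0 : 0 < 3 * h) {P : Finset (Fin (2 * h) × Fin (2 * h))}
    (hP : IsPairing P) (hne : P ≠ ∅) :
    ∃ w : Fin h → ℝ, (∀ i, 0 ≤ w i) ∧ ∑ i, w i = ((h - P.card : ℕ) : ℝ) ∧ ∀ k, 0 < k.val →
      2 * (G.nLoops (tail j k) : ℝ) + ∑ a ∈ P, pairInd j a k
        + ∑ i, w i * (pathInd G j i k + outInd G j i k)
      ≤ (tail j k).card - G.degree (tail j k) := by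
  have hp0 : 0 < P.card := Finset.card_pos.2 (Finset.nonempty_iff_ne_empty.2 hne)
  have hph := card_le_of_isPairing hP
  -- A later tail can contain all lepton lines only if the first line of the order is a photon line.
  -- That line is `i₂`, and its weight at most `1/2` yields the required exponent; otherwise `i₂` is
  -- arbitrary.
  obtain ⟨i₂, hi₂⟩ : ∃ i₂ : Fin h, ∀ i, j ⟨0, h0⟩ = Sum.inr i → i = i₂ := by
    rcases hj : j ⟨0, h0⟩ with l | i
    · exact ⟨⟨0, by omega⟩, by simp⟩
    · exact ⟨i, fun i' hi' => (Sum.inr_injective hi').symm⟩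
  obtain ⟨w, hw0, hw1, hw2, hws, hwk⟩ := exists_weights
    (fun i => (j.symm (firstLine G j i)).val) hp0 hph i₂
  refine ⟨w, hw0, hws, fun k hk => ?_⟩
  obtain ⟨hπ1, hπ2⟩ := sum_pairInd_le (j := j) hP k
  rw [← sub_zero (_ + _)]
  by_cases hsub : leptons Finset.univ ⊆ tail j k
  · refine exponent_le_of_subset hsub hph hws hπ1 ?_
    have hfirst := first_notMem_tail (j := j) h0 hk
    have hout : outInd G j i₂ k = 1 := by
      rcases hj : j ⟨0, h0⟩ with l | i
      · rw [hj] at hfirst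
        exact absurd (hsub (by simp [leptons])) hfirst
      · rw [hj] at hfirst
        rw [← hi₂ i hj]
        refine if_pos ⟨fun e he => ?_, hfirst⟩
        cases e with
        | inr k => exact absurd he inr_notMem_lpath
        | inl l => exact hsub (by simp [leptons])
    rw [← sum_outInd]
    have h1 : ∑ i, (1 - w i) * outInd G j i k ≥ (1 - w i₂) * outInd G j i₂ k :=
      Finset.single_le_sum (f := fun i => (1 - w i) * outInd G j i k)
        (fun i _ => mul_nonneg (by linarith [hw1 i]) (outInd_nonneg i k)) (Finset.mem_univ i₂)
    simp only [sub_mul, one_mul, Finset.sum_sub_distrib, hout] at h1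
    linarith
  · refine exponent_le_of_not_subset hG hsub ?_
    have h1 : ∑ i, w i * outInd G j i k ≤ (G.photonsOut (tail j k)).card := by
      rw [← sum_outInd]
      exact Finset.sum_le_sum fun i _ => mul_le_of_le_one_left (outInd_nonneg i k) (hw1 i)
    have h2 : Finset.univ.filter (fun i => k.val ≤ (j.symm (firstLine G j i)).val)
        = G.photonsIn (tail j k) := by
      ext i
      simp only [photonsIn, Finset.mem_filter, Finset.mem_univ, true_and, lpath_subset_tail_iff,
        mem_tail, Fin.le_def]
    have h3 : ∑ i, w i * pathInd G j i k = ∑ i ∈ G.photonsIn (tail j k), w i := by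
      simp only [pathInd, photonsIn, Finset.sum_filter, mul_ite, mul_one, mul_zero]
    have h4 := hwk k.val
    rw [h2, ← h3] at h4
    rcases h4 with h4 | ⟨h4, h5⟩
    · linarith
    · have := (photonsIn_bounds hG hsub).2 (by omega)
      linarith

/-- No weight can be omitted here, so the half unit taken from the first photon line must go to a
line with weight `1` already. The line `i₁` is chosen because the smallness of the projection
compensates the increase of its `outInd` part. -/
theorem exists_weights_of_empty (h0 : 0 < 3 * h) (i₁ : Fin h) :
    ∃ w : Fin h → ℝ, (∀ i, 0 ≤ w i) ∧ ∑ i, w i = (h : ℝ) ∧ ∀ k, 0 < k.val →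
      2 * (G.nLoops (tail j k) : ℝ) + ∑ i, w i * (pathInd G j i k + outInd G j i k)
        - outInd G j i₁ k ≤ (tail j k).card - G.degree (tail j k) := by
  obtain ⟨i₂, hi₂⟩ : ∃ i₂ : Fin h, ∀ i, j ⟨0, h0⟩ = Sum.inr i → i = i₂ := by
    rcases hj : j ⟨0, h0⟩ with l | i
    · exact ⟨⟨0, by omega⟩, by simp⟩
    · exact ⟨i, fun i' hi' => (Sum.inr_injective hi').symm⟩
  let w : Fin h → ℝ := fun i =>
    1 + 1 / 2 * ((if i = i₁ then 1 else 0) - (if i = i₂ then 1 else 0))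
  have hsum : ∀ f : Fin h → ℝ, ∑ i, w i * f i = ∑ i, f i + 1 / 2 * (f i₁ - f i₂) := by
    intro f
    simp only [w, add_mul, one_mul, mul_assoc, sub_mul, ite_mul, zero_mul, Finset.sum_add_distrib,
      ← Finset.mul_sum, Finset.sum_sub_distrib, Finset.sum_ite_eq', Finset.mem_univ, if_true]
  have hws : ∑ i, w i = (h : ℝ) := by
    have := hsum fun _ => 1
    simpa using this
  refine ⟨w, fun i => ?_, hws, fun k hk => ?_⟩
  · simp only [w]
    split_ifs <;> norm_num
  rw [← add_zero (2 * (G.nLoops (tail j k) : ℝ))]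
  by_cases hsub : leptons Finset.univ ⊆ tail j k
  · refine exponent_le_of_subset (p := 0) hsub (Nat.zero_le _) (by simpa using hws) (by simp) ?_
    have hfirst := first_notMem_tail (j := j) h0 hk
    have hout : outInd G j i₂ k = 1 := by
      rcases hj : j ⟨0, h0⟩ with l | i
      · rw [hj] at hfirst
        exact absurd (hsub (by simp [leptons])) hfirst
      · rw [hj] at hfirst
        rw [← hi₂ i hj]
        refine if_pos ⟨fun e he => ?_, hfirst⟩
        cases e with
        | inr k => exact absurd he inr_notMem_lpath
        | inl l => exact hsub (by simp [leptons])
    rw [hsum, ← sum_outInd, hout]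
    have := outInd_nonneg (G := G) (j := j) i₁ k
    linarith
  · refine exponent_le_of_not_subset hG hsub ?_
    rw [hsum, hsum, sum_pathInd, sum_outInd]
    have h1 := outInd_nonneg (G := G) (j := j) i₁ k
    have h2 := outInd_nonneg (G := G) (j := j) i₂ k
    have h3 := pathInd_nonneg (G := G) (j := j) i₂ k
    obtain ⟨h4, h5⟩ := photonsIn_bounds hG hsub
    by_cases hi : G.lpath i₁ ⊆ tail j k
    · have h6 : i₁ ∈ G.photonsIn (tail j k) := by simpa [photonsIn] using hi
      have h7 := h5 (Finset.card_pos.2 ⟨_, h6⟩)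
      have h8 : pathInd G j i₁ k = 1 := if_pos hi
      linarith
    · have h8 : pathInd G j i₁ k = 0 := if_neg hi
      linarith

end Counting

/-! ### The bound for the terms of the integrand -/

/-- The powers of `m` from the projection and from `W` are both `2(h - |P|)` and cancel, so the
constant does not depend on the mass. -/
theorem exists_term_bound (G : VertexGraph h) (hG : G.NoUVDivergentSubgraphs)
    {P : Finset (Fin (2 * h) × Fin (2 * h))} (hP : IsPairing P) :
    ∃ C : ℝ, ∀ m : ℝ, 0 < m → ∀ z : Line h → ℝ, (∀ e, 0 < z e) → ∑ e, z e = 1 →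
      ∀ j : Fin (3 * h) ≃ Line h, Antitone (z ∘ j) →
        |G.K z P| * ‖amm m (G.numerator m z P)‖ / |G.W m z| ^ (3 * h - (2 * h + P.card))
          ≤ C * sectorMonomial z j (fun k => G.degree (tail j k)) / ∏ e, z e := by
  obtain ⟨a, ha, haP, hamm⟩ := G.exists_amm_numerator hP
  obtain ⟨C, hC, hbound⟩ := G.exists_coeff_bound ha
  have hph := card_le_of_isPairing hP
  set C₁ : ℝ := (((3 * h : ℕ) : ℝ) ^ (3 * h)) ^ 2 * (numSets h * (3 * h : ℕ)) ^ P.card with hC₁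
  refine ⟨C₁ * C * (2 * (3 * h : ℕ) : ℝ) ^ (h - P.card), fun m hm z hz hsum j hj => ?_⟩
  -- For `h = 0` there are no lines, and the sum of the `z` cannot be `1`.
  have h0 : 0 < 3 * h := by
    rcases Nat.eq_zero_or_pos h with rfl | hpos
    · simp [Line] at hsum
    · omega
  have h3 : (0 : ℝ) < (3 * h : ℕ) := by exact_mod_cast h0
  -- The exponents `δ` record the smallness of the projection: zero for nonempty `P`, those of
  -- `outInd` for `P = ∅`.
  obtain ⟨δ, w, hδ, hw, hws, hexp⟩ : ∃ (δ : Fin (3 * h) → ℝ) (w : Fin h → ℝ),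
      ‖a (G.coeff z)‖ ≤ C * sectorMonomial z j δ ∧ (∀ i, 0 ≤ w i) ∧
      ∑ i, w i = ((h - P.card : ℕ) : ℝ) ∧ ∀ k, 0 < k.val →
        2 * (G.nLoops (tail j k) : ℝ) + ∑ a ∈ P, pairInd j a k
          + ∑ i, w i * (pathInd G j i k + outInd G j i k) - δ k
        ≤ (tail j k).card - G.degree (tail j k) := by
    by_cases hne : P = ∅
    -- The photon line with the largest monomial controls all 1-trees with photon lines. It may
    -- depend on `z` and the sector, unlike the constant.
    · obtain ⟨i₁, -, hi₁⟩ := Finset.exists_max_image Finset.univ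
        (fun i => sectorMonomial z j (outInd G j i)) ⟨(⟨0, by omega⟩ : Fin h), Finset.mem_univ _⟩
      obtain ⟨w, hw, hws, hexp⟩ := exists_weights_of_empty hG (j := j) h0 i₁
      refine ⟨outInd G j i₁, w, ?_, hw, by simpa [hne] using hws, fun k hk => ?_⟩
      · have h1 := (hbound z hz).2 (sectorMonomial z j (outInd G j i₁))
          (sectorMonomial_pos hz _).le fun T hT i hi => ?_
        · rwa [haP hne, sub_zero] at h1
        · refine (hT.prod_le_of_photon hz hi (a := z (firstLine G j i)) fun e he =>
            apply_le_of_symm_le hj (symm_firstLine_le G he)).trans ?_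
          rw [min_one_div_eq hz hj G h0]
          exact mul_le_mul_of_nonneg_left (hi₁ i (Finset.mem_univ i)) (G.D_pos hz).le
      · simpa [hne] using hexp k hk
    · obtain ⟨w, hw, hws, hexp⟩ := exists_weights_of_nonempty hG (j := j) h0 hP hne
      refine ⟨0, w, ?_, hw, hws, fun k hk => by simpa using hexp k hk⟩
      rw [sectorMonomial_zero, mul_one]
      exact (hbound z hz).1
  have hK := abs_K_le hz hj G h0 hsum P
  rw [← hC₁] at hK
  have hW := le_abs_W_pow hz hj G h0 hsum hm hw hws
  have hA : ‖amm m (G.numerator m z P)‖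
      ≤ m ^ (2 * (h - P.card)) * (C * sectorMonomial z j δ) := by
    rw [amm_eq hm (hamm m z hm), norm_mul, norm_pow, Complex.norm_real, Real.norm_of_nonneg hm.le,
      ← Nat.mul_sub]
    exact mul_le_mul_of_nonneg_left hδ (by positivity)
  have hn : 3 * h - (2 * h + P.card) = h - P.card := by omega
  rw [hn]
  set xK : Fin (3 * h) → ℝ :=
    fun k => -(2 * G.nLoops (tail j k) : ℝ) - ∑ a ∈ P, pairInd j a k with hxK
  set xW : Fin (3 * h) → ℝ :=
    fun k => ∑ i, w i * (pathInd G j i k + outInd G j i k) with hxW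
  set n := h - P.card
  have hMK := sectorMonomial_pos hz (j := j) xK
  have hMW := sectorMonomial_pos hz (j := j) xW
  have hMδ := sectorMonomial_pos hz (j := j) δ
  have hC₁pos : 0 ≤ C₁ := by
    have := numSets_pos h
    positivity
  -- The exponents `-|s|` on the right stand for `1 / ∏ z`, up to a power of the largest variable,
  -- which is at most `1`.
  have hfinal : sectorMonomial z j (xK + δ + -xW)
      ≤ sectorMonomial z j ((fun k => G.degree (tail j k)) + -fun k => ((tail j k).card : ℝ)) := by
    refine sectorMonomial_anti hz hj fun k hk => ?_
    have := hexp k hk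
    simp only [Pi.add_apply, Pi.neg_apply, hxK, hxW]
    linarith
  rw [sectorMonomial_add hz, sectorMonomial_add hz, sectorMonomial_add hz, sectorMonomial_neg hz,
    sectorMonomial_neg hz] at hfinal
  have hprod := prod_le_sectorMonomial hz (j := j) h0 hsum
  have hprodpos : 0 < ∏ e, z e := Finset.prod_pos fun e _ => hz e
  have hWlow : 0 < m ^ (2 * n) * ((2 * (3 * h : ℕ) : ℝ)⁻¹ ^ n * sectorMonomial z j xW) := by
    positivity
  have hdeg := sectorMonomial_pos hz (j := j) fun k => G.degree (tail j k)
  calc |G.K z P| * ‖amm m (G.numerator m z P)‖ / |G.W m z| ^ n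
      ≤ (C₁ * sectorMonomial z j xK) * (m ^ (2 * n) * (C * sectorMonomial z j δ))
        / (m ^ (2 * n) * ((2 * (3 * h : ℕ) : ℝ)⁻¹ ^ n * sectorMonomial z j xW)) := by
        refine div_le_div₀ (by positivity) ?_ hWlow hW
        exact mul_le_mul hK hA (norm_nonneg _) (by positivity)
    _ = C₁ * C * (2 * (3 * h : ℕ) : ℝ) ^ n *
        (sectorMonomial z j xK * sectorMonomial z j δ * (sectorMonomial z j xW)⁻¹) := by
        rw [inv_pow]
        field_simp
    _ ≤ C₁ * C * (2 * (3 * h : ℕ) : ℝ) ^ n *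
        (sectorMonomial z j (fun k => G.degree (tail j k)) *
          (sectorMonomial z j fun k => ((tail j k).card : ℝ))⁻¹) :=
        mul_le_mul_of_nonneg_left hfinal (by positivity)
    _ ≤ C₁ * C * (2 * (3 * h : ℕ) : ℝ) ^ n *
        (sectorMonomial z j (fun k => G.degree (tail j k)) * (∏ e, z e)⁻¹) := by
        refine mul_le_mul_of_nonneg_left ?_ (by positivity)
        exact mul_le_mul_of_nonneg_left (inv_anti₀ hprodpos hprod) hdeg.le
    _ = _ := by rw [div_eq_mul_inv]; ring

end QED.VertexGraph

end

/-! ### The bound for the whole integrand -/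

theorem mainTheorem1 (h : ℕ) (G : QED.VertexGraph h) (hG : G.NoUVDivergentSubgraphs)
    (c : Finset (Fin (2 * h) × Fin (2 * h)) → ℂ) :
    ∃ C : ℝ, ∀ m : ℝ, 0 < m →
      ∀ z : QED.Line h → ℝ, (∀ e, 0 < z e) → ∑ e, z e = 1 →
        (∀ P, QED.VertexGraph.IsPairing P → ∃! a, QED.IsAMM m (G.numerator m z P) a) ∧
        ∀ j : Fin (3 * h) ≃ QED.Line h, Antitone (z ∘ j) →
          ‖G.integrand c m z‖ ≤
            C * (∏ k ∈ Finset.univ.filter (fun k : Fin (3 * h) => 0 < k.val),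
                  QED.VertexGraph.sectorVar z j k ^ G.degree (QED.VertexGraph.tail j k))
              / ∏ e, z e := by
  have hterm : ∀ P, ∃ C : ℝ, QED.VertexGraph.IsPairing P → ∀ m : ℝ, 0 < m →
      ∀ z : QED.Line h → ℝ, (∀ e, 0 < z e) → ∑ e, z e = 1 →
      ∀ j : Fin (3 * h) ≃ QED.Line h, Antitone (z ∘ j) →
        |G.K z P| * ‖QED.amm m (G.numerator m z P)‖ / |G.W m z| ^ (3 * h - (2 * h + P.card))
          ≤ C * QED.VertexGraph.sectorMonomial z j
            (fun k => G.degree (QED.VertexGraph.tail j k)) / ∏ e, z e := by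
    intro P
    by_cases hP : QED.VertexGraph.IsPairing P
    · obtain ⟨C, hC⟩ := QED.VertexGraph.exists_term_bound G hG hP
      exact ⟨C, fun _ => hC⟩
    · exact ⟨0, fun h => absurd h hP⟩
  choose C hC using hterm
  refine ⟨∑ P ∈ Finset.univ.filter QED.VertexGraph.IsPairing, ‖c P‖ * C P,
    fun m hm z hz hsum => ⟨fun P hP => ?_, fun j hj => ?_⟩⟩
  · obtain ⟨a, -, -, ha⟩ := G.exists_amm_numerator hP
    exact ⟨_, ha m z hm, fun b hb => hb.unique hm (ha m z hm)⟩
  · rw [QED.VertexGraph.integrand, Finset.sum_mul, Finset.sum_div]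
    refine (norm_sum_le _ _).trans (Finset.sum_le_sum fun P hP => ?_)
    have hP : QED.VertexGraph.IsPairing P := by simpa using hP
    have h1 := mul_le_mul_of_nonneg_left (hC P hP m hm z hz hsum j hj) (norm_nonneg (c P))
    rw [norm_div, norm_mul, norm_mul, norm_pow, Complex.norm_real, Complex.norm_real,
      Real.norm_eq_abs, Real.norm_eq_abs]
    calc _ = ‖c P‖ * (|G.K z P| * ‖QED.amm m (G.numerator m z P)‖
          / |G.W m z| ^ (3 * h - (2 * h + P.card))) := by ring
      _ ≤ _ := h1
      _ = _ := by rw [QED.VertexGraph.sectorMonomial]; ring
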